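/- Let $T>0$, let $\mathbb{T}=\mathbb{R}/T\mathbb{Z}$, and put $$\Omega=\{(x,y)\in\mathbb{R}\times\mathbb{T} : x\neq 0\},\qquad \Omega_+=\{x>0\},\qquad \Omega_-=\{x<0\}.$$ Let $\Phi:\mathbb{R}\times\mathbb{T}\to\mathbb{R}$ be a $C^\infty$ function (on the whole cylinder, in particular across $x=0$) which is constant for large $|x|$, i.e. there are $R,c_1,c_2\in\mathbb{R}$ such that $\Phi(x,y)=c_1$ whenever $x>R$ and $\Phi(x,y)=c_2$ whenever $x<-R$ (the case $c_1=c_2$ is included). Let $g$ be the Riemannian metric $\mathrm{diag}\left(1,\,x^{-2}e^{-2\Phi(x,y)}\right)$ on $\Omega$, let $d\omega=\omega\,dx\,dy$ with $\omega=\sqrt{\det g}=|x|^{-1}e^{-\Phi}$ be its Riemannian area, and let $$\Delta u=\frac1\omega\sum_{i,j}\partial_i\left(\omega\, g^{ij}\,\partial_j u\right)$$ be its Laplace–Beltrami operator. Then for each of $U=\Omega$, $U=\Omega_+$ and $U=\Omega_-$, the operator $\Delta$ with domain $C_0^\infty(U)$ (complex-valued smooth functions with compact support in $U$) is essentially self-adjoint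 on $L^2(U,d\omega)$; that is, it is densely defined and symmetric, and its closure is self-adjoint. (For $U=\Omega$ this is $L^2(\mathbb{R}\times\mathbb{T},d\omega)$, since $\{x=0\}$ is a null set for $dx\,dy$.) -/

import Mathlib

open MeasureTheory Set Filter Topology
open scoped ContDiff ENNReal

noncomputable section

namespace GrushinCylinder

/-! ### The cylinder `ℝ × 𝕋`, `𝕋 = ℝ / Tℤ`, and smooth functions on it -/

/-- The cylinder `ℝ × 𝕋` with `𝕋 = ℝ / Tℤ`. -/
abbrev Cyl (T : ℝ) : Type := ℝ × AddCircle T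

/-- The universal covering `ℝ × ℝ → ℝ × 𝕋`. -/
def cover (T : ℝ) (q : ℝ × ℝ) : Cyl T := (q.1, (q.2 : AddCircle T))

/-- `f` is `C^∞` on the (open) subset `U` of the cylinder: its lift to the universal covering is. -/
def SmoothOn {T : ℝ} {E : Type*} [NormedAddCommGroup E] [NormedSpace ℝ E]
    (f : Cyl T → E) (U : Set (Cyl T)) : Prop :=
  ContDiffOn ℝ ∞ (f ∘ cover T) (cover T ⁻¹' U)

/-- The coordinate directions: `0` is `x`, `1` is `y`. -/
def dir (i : Fin 2) : ℝ × ℝ := if i = 0 then (1, 0) else (0, 1)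

/-- The partial derivatives `∂_0 = ∂_x`, `∂_1 = ∂_y` of functions on the cylinder. -/
def pderiv {T : ℝ} {E : Type*} [NormedAddCommGroup E] [NormedSpace ℝ E]
    (i : Fin 2) (f : Cyl T → E) (p : Cyl T) : E :=
  deriv (fun s : ℝ => f (p + cover T (s • dir i))) 0

theorem cover_add (T : ℝ) (a b : ℝ × ℝ) : cover T (a + b) = cover T a + cover T b := by
  simp [cover]

theorem isOpenQuotientMap_cover (T : ℝ) : IsOpenQuotientMap (cover T) :=
  IsOpenQuotientMap.id.prodMap QuotientAddGroup.isOpenQuotientMap_mk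

section Calculus

variable {T : ℝ} {E : Type*} [NormedAddCommGroup E] [NormedSpace ℝ E]

theorem pderiv_cover (i : Fin 2) (f : Cyl T → E) (q : ℝ × ℝ) :
    pderiv i f (cover T q) = lineDeriv ℝ (f ∘ cover T) q (dir i) := by
  simp only [pderiv, lineDeriv, Function.comp, cover_add]

theorem isOpen_cover_preimage {U : Set (Cyl T)} (hU : IsOpen U) : IsOpen (cover T ⁻¹' U) :=
  hU.preimage (isOpenQuotientMap_cover T).continuous

theorem SmoothOn.continuousOn {f : Cyl T → E} {U : Set (Cyl T)} (hf : SmoothOn f U)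
    (hU : IsOpen U) : ContinuousOn f U := by
  intro p hp
  obtain ⟨q, rfl⟩ := (isOpenQuotientMap_cover T).surjective p
  refine ContinuousAt.continuousWithinAt ?_
  have h := (ContDiffOn.continuousOn hf).continuousAt
    ((isOpen_cover_preimage hU).mem_nhds (show q ∈ cover T ⁻¹' U from hp))
  rw [ContinuousAt, ← (isOpenQuotientMap_cover T).map_nhds_eq, tendsto_map'_iff]
  exact h

theorem SmoothOn.differentiableAt {f : Cyl T → E} {U : Set (Cyl T)} (hf : SmoothOn f U)
    (hU : IsOpen U) {q : ℝ × ℝ} (hq : cover T q ∈ U) : DifferentiableAt ℝ (f ∘ cover T) q :=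
  (ContDiffOn.differentiableOn hf (by simp)).differentiableAt
    ((isOpen_cover_preimage hU).mem_nhds hq)

theorem SmoothOn.mono {f : Cyl T → E} {U V : Set (Cyl T)} (hf : SmoothOn f U) (h : V ⊆ U) :
    SmoothOn f V :=
  ContDiffOn.mono hf (preimage_mono h)

theorem SmoothOn.pderiv {f : Cyl T → E} {U : Set (Cyl T)} (hf : SmoothOn f U)
    (hU : IsOpen U) (i : Fin 2) : SmoothOn (GrushinCylinder.pderiv i f) U := by
  have h : ContDiffOn ℝ ∞ (fun q => fderiv ℝ (f ∘ cover T) q (dir i)) (cover T ⁻¹' U) :=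
    (ContDiffOn.fderiv_of_isOpen hf (isOpen_cover_preimage hU) (m := ∞) (by simp)).clm_apply
      contDiffOn_const
  refine h.congr fun q hq => ?_
  rw [Function.comp_apply, pderiv_cover]
  exact (hf.differentiableAt hU hq).lineDeriv_eq_fderiv

theorem SmoothOn.add {f h : Cyl T → E} {U : Set (Cyl T)} (hf : SmoothOn f U) (hh : SmoothOn h U) :
    SmoothOn (fun p => f p + h p) U :=
  ContDiffOn.add hf hh

theorem SmoothOn.smul {a : Cyl T → ℝ} {f : Cyl T → E} {U : Set (Cyl T)} (ha : SmoothOn a U)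
    (hf : SmoothOn f U) : SmoothOn (fun p => a p • f p) U :=
  ContDiffOn.smul ha hf

theorem pderiv_add {f h : Cyl T → E} {U : Set (Cyl T)} (hf : SmoothOn f U) (hh : SmoothOn h U)
    (hU : IsOpen U) (i : Fin 2) {p : Cyl T} (hp : p ∈ U) :
    pderiv i (fun p => f p + h p) p = pderiv i f p + pderiv i h p := by
  obtain ⟨q, rfl⟩ := (isOpenQuotientMap_cover T).surjective p
  have h1 := hf.differentiableAt hU hp
  have h2 := hh.differentiableAt hU hp
  rw [pderiv_cover, pderiv_cover, pderiv_cover, h1.lineDeriv_eq_fderiv, h2.lineDeriv_eq_fderiv,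
    show (fun p => f p + h p) ∘ cover T = (f ∘ cover T) + (h ∘ cover T) from rfl,
    (h1.add h2).lineDeriv_eq_fderiv, fderiv_add h1 h2]
  rfl

theorem pderiv_const_smul {f : Cyl T → ℂ} (c : ℂ) (i : Fin 2) (p : Cyl T) :
    pderiv i (fun p => c • f p) p = c • pderiv i f p := by
  simp only [pderiv, smul_eq_mul]
  exact deriv_const_mul_field c

theorem pderiv_congr {f h : Cyl T → E} {i : Fin 2} {p : Cyl T} (hfh : f =ᶠ[𝓝 p] h) :
    pderiv i f p = pderiv i h p := by
  obtain ⟨q, rfl⟩ := (isOpenQuotientMap_cover T).surjective p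
  rw [pderiv_cover, pderiv_cover]
  exact Filter.EventuallyEq.lineDeriv_eq
    ((isOpenQuotientMap_cover T).continuous.continuousAt.eventually hfh)

theorem pderiv_zero (i : Fin 2) (p : Cyl T) : pderiv i (fun _ : Cyl T => (0 : E)) p = 0 := by
  simp [pderiv]

end Calculus

/-! ### Riemannian metrics in the coordinates `(x, y)` and the Laplace–Beltrami operator -/

/-- `g = (g_{ij})` is a (smooth) Riemannian metric on `U`. -/
structure IsRiemannianMetricOn {T : ℝ} (g : Cyl T → Matrix (Fin 2) (Fin 2) ℝ)
    (U : Set (Cyl T)) : Prop where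
  smooth : ∀ i j, SmoothOn (fun p => g p i j) U
  posDef : ∀ p ∈ U, (g p).PosDef

/-- The density `ω = √(det g)` of the Riemannian area with respect to `dx dy`. -/
def areaDensity {T : ℝ} (g : Cyl T → Matrix (Fin 2) (Fin 2) ℝ) (p : Cyl T) : ℝ :=
  √((g p).det)

/-- The Riemannian area `dω = √(det g) dx dy` on `U`, as a measure on the cylinder carried
by `U`. -/
def areaMeasure {T : ℝ} [Fact (0 < T)] (g : Cyl T → Matrix (Fin 2) (Fin 2) ℝ)
    (U : Set (Cyl T)) : Measure (Cyl T) :=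
  ((volume : Measure (Cyl T)).restrict U).withDensity
    fun p => ENNReal.ofReal (areaDensity g p)

/-- The Laplace–Beltrami operator `Δ u = ω⁻¹ ∑_{i,j} ∂_i (ω g^{ij} ∂_j u)`. -/
def laplaceBeltrami {T : ℝ} (g : Cyl T → Matrix (Fin 2) (Fin 2) ℝ) (u : Cyl T → ℂ)
    (p : Cyl T) : ℂ :=
  (areaDensity g p)⁻¹ • ∑ i, ∑ j,
    pderiv i (fun q => (areaDensity g q * (g q)⁻¹ i j) • pderiv j u q) p

/-- `C_0^∞(U)`, each function being extended by zero to the whole cylinder. -/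
def testFunctions {T : ℝ} (U : Set (Cyl T)) : Submodule ℂ (Cyl T → ℂ) where
  carrier := {f | SmoothOn f univ ∧ HasCompactSupport f ∧ tsupport f ⊆ U}
  zero_mem' := by
    refine ⟨contDiffOn_const, HasCompactSupport.zero, ?_⟩
    simp [tsupport]
  add_mem' := by
    rintro f h ⟨hf, hf', hf''⟩ ⟨hh, hh', hh''⟩
    exact ⟨hf.add hh, hf'.add hh', (tsupport_add f h).trans (union_subset hf'' hh'')⟩
  smul_mem' := by
    rintro c f ⟨hf, hf', hf''⟩
    refine ⟨ContDiffOn.const_smul c hf, hf'.smul_left, ?_⟩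
    exact (closure_mono (Function.support_const_smul_subset c f)).trans hf''

section Operator

variable {T : ℝ} {g : Cyl T → Matrix (Fin 2) (Fin 2) ℝ} {U : Set (Cyl T)}

theorem IsRiemannianMetricOn.mono (hg : IsRiemannianMetricOn g U) {V : Set (Cyl T)} (h : V ⊆ U) :
    IsRiemannianMetricOn g V :=
  ⟨fun i j => (hg.smooth i j).mono h, fun p hp => hg.posDef p (h hp)⟩

theorem areaDensity_pos (hg : IsRiemannianMetricOn g U) {p : Cyl T} (hp : p ∈ U) :
    0 < areaDensity g p :=
  Real.sqrt_pos.2 (hg.posDef p hp).det_pos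

theorem smoothOn_det (hg : IsRiemannianMetricOn g U) : SmoothOn (fun p => (g p).det) U := by
  have h := ((hg.smooth 0 0).smul (hg.smooth 1 1)).add
    ((hg.smooth 0 1).smul ((hg.smooth 1 0).smul
      (show SmoothOn (fun _ : Cyl T => (-1 : ℝ)) U from contDiffOn_const)))
  refine ContDiffOn.congr h fun _ _ => ?_
  simp only [Function.comp, Matrix.det_fin_two, smul_eq_mul]
  ring

theorem smoothOn_areaDensity (hg : IsRiemannianMetricOn g U) : SmoothOn (areaDensity g) U :=
  ContDiffOn.sqrt (smoothOn_det hg) fun _ hq => (hg.posDef _ hq).det_pos.ne'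

theorem smoothOn_areaDensity_inv (hg : IsRiemannianMetricOn g U) :
    SmoothOn (fun p => (areaDensity g p)⁻¹) U :=
  ContDiffOn.inv (smoothOn_areaDensity hg) fun _ hq => (areaDensity_pos hg hq).ne'

theorem smoothOn_inv (hg : IsRiemannianMetricOn g U) (i j : Fin 2) :
    SmoothOn (fun p => (g p)⁻¹ i j) U := by
  have h1 : SmoothOn (fun p => ((g p).det)⁻¹) U :=
    ContDiffOn.inv (smoothOn_det hg) fun q hq => (hg.posDef _ hq).det_pos.ne'
  have h2 : ∀ i j, SmoothOn (fun p => -(g p i j)) U := fun i j => ContDiffOn.neg (hg.smooth i j)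
  have h3 : SmoothOn (fun p => (g p).adjugate i j) U := by
    simp only [Matrix.adjugate_fin_two]
    fin_cases i <;> fin_cases j
    · exact hg.smooth 1 1
    · exact h2 0 1
    · exact h2 1 0
    · exact hg.smooth 0 0
  simpa [Matrix.inv_def] using h1.smul h3

theorem smoothOn_flux (hg : IsRiemannianMetricOn g U) (hU : IsOpen U) {u : Cyl T → ℂ}
    (hu : SmoothOn u U) (i j : Fin 2) :
    SmoothOn (fun q => (areaDensity g q * (g q)⁻¹ i j) • pderiv j u q) U :=
  ((smoothOn_areaDensity hg).smul (smoothOn_inv hg i j)).smul (hu.pderiv hU j)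

theorem smoothOn_laplaceBeltrami (hg : IsRiemannianMetricOn g U) (hU : IsOpen U) {u : Cyl T → ℂ}
    (hu : SmoothOn u U) : SmoothOn (laplaceBeltrami g u) U := by
  have h := fun i j => (smoothOn_flux hg hU hu i j).pderiv hU i
  have := (smoothOn_areaDensity_inv hg).smul (((h 0 0).add (h 0 1)).add ((h 1 0).add (h 1 1)))
  refine ContDiffOn.congr this fun q _ => ?_
  simp only [Function.comp, laplaceBeltrami, Fin.sum_univ_two]

theorem laplaceBeltrami_eq_zero {u : Cyl T → ℂ} {p : Cyl T} (hp : p ∉ tsupport u) :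
    laplaceBeltrami g u p = 0 := by
  have h0 : ∀ j, ∀ᶠ q in 𝓝 p, pderiv j u q = 0 := by
    intro j
    have := (notMem_tsupport_iff_eventuallyEq.1 hp).eventuallyEq_nhds
    filter_upwards [this] with q hq
    rw [pderiv_congr (h := fun _ => (0 : ℂ)) hq, pderiv_zero]
  have h1 : ∀ i j, pderiv i (fun q => (areaDensity g q * (g q)⁻¹ i j) • pderiv j u q) p = 0 := by
    intro i j
    rw [pderiv_congr (h := fun _ => (0 : ℂ)), pderiv_zero]
    filter_upwards [h0 j] with q hq
    rw [hq, smul_zero]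
  simp only [laplaceBeltrami, h1, Finset.sum_const_zero, smul_zero]

theorem tsupport_laplaceBeltrami_subset (u : Cyl T → ℂ) :
    tsupport (laplaceBeltrami g u) ⊆ tsupport u :=
  closure_minimal (fun _ hp => by_contra fun h => hp (laplaceBeltrami_eq_zero h))
    (isClosed_tsupport u)

theorem testFunctions_continuous {f : Cyl T → ℂ} (hf : f ∈ testFunctions U) : Continuous f :=
  continuousOn_univ.1 (hf.1.continuousOn isOpen_univ)

/-- `Δ` maps `C_0^∞(U)` into itself. -/
theorem laplaceBeltrami_mem (hg : IsRiemannianMetricOn g U) (hU : IsOpen U) {u : Cyl T → ℂ}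
    (hu : u ∈ testFunctions U) : laplaceBeltrami g u ∈ testFunctions U := by
  have hs : tsupport (laplaceBeltrami g u) ⊆ tsupport u := tsupport_laplaceBeltrami_subset u
  refine ⟨?_, HasCompactSupport.of_support_subset_isCompact hu.2.1
    ((subset_tsupport _).trans hs), hs.trans hu.2.2⟩
  have h1 : ContDiffOn ℝ ∞ (laplaceBeltrami g u ∘ cover T) (cover T ⁻¹' U) :=
    smoothOn_laplaceBeltrami hg hU (hu.1.mono (subset_univ _))
  intro q _
  refine ContDiffAt.contDiffWithinAt ?_
  by_cases hq : cover T q ∈ U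
  · exact h1.contDiffAt ((isOpen_cover_preimage hU).mem_nhds hq)
  · have hq' : cover T q ∈ (tsupport u)ᶜ := fun h => hq (hu.2.2 h)
    have hev : (laplaceBeltrami g u ∘ cover T) =ᶠ[𝓝 q] fun _ => 0 := by
      filter_upwards [(isOpen_cover_preimage (isClosed_tsupport u).isOpen_compl).mem_nhds hq']
        with r hr
      exact laplaceBeltrami_eq_zero hr
    exact contDiffAt_const.congr_of_eventuallyEq hev

theorem laplaceBeltrami_add (hg : IsRiemannianMetricOn g U) (hU : IsOpen U) {u v : Cyl T → ℂ}
    (hu : u ∈ testFunctions U) (hv : v ∈ testFunctions U) :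
    laplaceBeltrami g (u + v) = laplaceBeltrami g u + laplaceBeltrami g v := by
  funext p
  by_cases hp : p ∈ U
  · have hu' := hu.1.mono (subset_univ U)
    have hv' := hv.1.mono (subset_univ U)
    have key : ∀ i j, pderiv i (fun q => (areaDensity g q * (g q)⁻¹ i j) • pderiv j (u + v) q) p
        = pderiv i (fun q => (areaDensity g q * (g q)⁻¹ i j) • pderiv j u q) p
          + pderiv i (fun q => (areaDensity g q * (g q)⁻¹ i j) • pderiv j v q) p := by
      intro i j
      rw [← pderiv_add (smoothOn_flux hg hU hu' i j) (smoothOn_flux hg hU hv' i j) hU i hp]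
      refine pderiv_congr ?_
      filter_upwards [hU.mem_nhds hp] with q hq
      rw [show u + v = fun p => u p + v p from rfl, pderiv_add hu' hv' hU j hq, smul_add]
    simp only [laplaceBeltrami, Pi.add_apply, key, Finset.sum_add_distrib, smul_add]
  · rw [Pi.add_apply, laplaceBeltrami_eq_zero fun h => hp (hu.2.2 h),
      laplaceBeltrami_eq_zero fun h => hp (hv.2.2 h),
      laplaceBeltrami_eq_zero fun h => hp (((testFunctions U).add_mem hu hv).2.2 h), add_zero]

theorem laplaceBeltrami_smul (c : ℂ) (u : Cyl T → ℂ) :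
    laplaceBeltrami g (c • u) = c • laplaceBeltrami g u := by
  funext p
  have key : ∀ i j, pderiv i (fun q => (areaDensity g q * (g q)⁻¹ i j) • pderiv j (c • u) q) p
      = c • pderiv i (fun q => (areaDensity g q * (g q)⁻¹ i j) • pderiv j u q) p := by
    intro i j
    rw [← pderiv_const_smul]
    congr 1
    funext q
    rw [show c • u = fun p => c • u p from rfl, pderiv_const_smul, smul_comm]
  simp only [laplaceBeltrami, Pi.smul_apply, key, ← Finset.smul_sum]
  rw [smul_comm]

variable [Fact (0 < T)]

/-- Test functions on `U` are square integrable for the Riemannian area. -/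
theorem memLp_of_mem_testFunctions (hg : IsRiemannianMetricOn g U) (hU : IsOpen U)
    {f : Cyl T → ℂ} (hf : f ∈ testFunctions U) : MemLp f 2 (areaMeasure g U) := by
  have hfc := testFunctions_continuous hf
  have hK : IsCompact (tsupport f) := hf.2.1
  have hKm : MeasurableSet (tsupport f) := (isClosed_tsupport f).measurableSet
  have hfin : areaMeasure g U (tsupport f) < ⊤ := by
    obtain ⟨C, hC⟩ := hK.exists_bound_of_continuousOn
      (((smoothOn_areaDensity hg).continuousOn hU).mono hf.2.2)
    rw [areaMeasure, withDensity_apply _ hKm]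
    calc ∫⁻ p in tsupport f, ENNReal.ofReal (areaDensity g p)
            ∂((volume : Measure (Cyl T)).restrict U)
        ≤ ∫⁻ _ in tsupport f, ENNReal.ofReal C ∂((volume : Measure (Cyl T)).restrict U) :=
          setLIntegral_mono measurable_const fun p hp =>
            ENNReal.ofReal_le_ofReal ((le_abs_self _).trans (hC p hp))
      _ = ENNReal.ofReal C * ((volume : Measure (Cyl T)).restrict U) (tsupport f) := by
          rw [setLIntegral_const]
      _ < ⊤ := ENNReal.mul_lt_top ENNReal.ofReal_lt_top
          ((Measure.restrict_apply_le _ _).trans_lt hK.measure_lt_top)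
  have hind : (tsupport f).indicator f = f :=
    indicator_eq_self.2 (subset_tsupport f)
  rw [← hind, memLp_indicator_iff_restrict hKm]
  obtain ⟨C, hC⟩ := hK.exists_bound_of_continuousOn hfc.continuousOn
  have : IsFiniteMeasure ((areaMeasure g U).restrict (tsupport f)) :=
    ⟨by rwa [Measure.restrict_apply_univ]⟩
  exact MemLp.of_bound hfc.aestronglyMeasurable C ((ae_restrict_iff' hKm).2 (ae_of_all _ hC))

/-- The inclusion of `C_0^∞(U)` into `L²(U, dω)`. -/
def testToL2 (hg : IsRiemannianMetricOn g U) (hU : IsOpen U) :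
    testFunctions U →ₗ[ℂ] Lp ℂ 2 (areaMeasure g U) where
  toFun f := (memLp_of_mem_testFunctions hg hU f.2).toLp f.1
  map_add' _ _ := rfl
  map_smul' _ _ := rfl

theorem testToL2_injective (hg : IsRiemannianMetricOn g U) (hU : IsOpen U) :
    Function.Injective (testToL2 hg hU) := by
  intro f h hfh
  have h1 : f.1 =ᵐ[areaMeasure g U] h.1 := (MemLp.toLp_eq_toLp_iff (memLp_of_mem_testFunctions hg hU f.2)
    (memLp_of_mem_testFunctions hg hU h.2)).1 hfh
  have hac : (volume : Measure (Cyl T)).restrict U ≪ areaMeasure g U := by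
    refine withDensity_absolutelyContinuous' ?_ ?_
    · exact (((smoothOn_areaDensity hg).continuousOn hU).aemeasurable
        hU.measurableSet).ennreal_ofReal
    · refine (ae_restrict_iff' hU.measurableSet).2 (ae_of_all _ fun p hp => ?_)
      exact (ENNReal.ofReal_pos.2 (areaDensity_pos hg hp)).ne'
  have h2 : f.1 =ᵐ[(volume : Measure (Cyl T)).restrict U] h.1 := hac.ae_le h1
  have h3 : EqOn f.1 h.1 U := Measure.eqOn_open_of_ae_eq h2 hU
    (testFunctions_continuous f.2).continuousOn (testFunctions_continuous h.2).continuousOn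
  refine Subtype.ext (funext fun p => ?_)
  by_cases hp : p ∈ U
  · exact h3 hp
  · rw [image_eq_zero_of_notMem_tsupport fun h' => hp (f.2.2.2 h'),
      image_eq_zero_of_notMem_tsupport fun h' => hp (h.2.2.2 h')]

/-- The Laplace–Beltrami operator as a linear map `C_0^∞(U) → C_0^∞(U)`. -/
def laplaceBeltramiTest (hg : IsRiemannianMetricOn g U) (hU : IsOpen U) :
    testFunctions U →ₗ[ℂ] testFunctions U where
  toFun u := ⟨laplaceBeltrami g u.1, laplaceBeltrami_mem hg hU u.2⟩
  map_add' u v := Subtype.ext (laplaceBeltrami_add hg hU u.2 v.2)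
  map_smul' c u := Subtype.ext (laplaceBeltrami_smul c u.1)

/-- The Laplace–Beltrami operator of the metric `g` on `U` as an unbounded operator on
`L²(U, dω)` with domain `C_0^∞(U)`. -/
def laplaceBeltramiOperator (g : Cyl T → Matrix (Fin 2) (Fin 2) ℝ) (U : Set (Cyl T))
    (hg : IsRiemannianMetricOn g U) (hU : IsOpen U) :
    Lp ℂ 2 (areaMeasure g U) →ₗ.[ℂ] Lp ℂ 2 (areaMeasure g U) where
  domain := LinearMap.range (testToL2 hg hU)
  toFun := testToL2 hg hU ∘ₗ laplaceBeltramiTest hg hU ∘ₗ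
    (LinearEquiv.ofInjective (testToL2 hg hU) (testToL2_injective hg hU)).symm.toLinearMap

/-- The operator sends the class of a test function `u` to the class of `Δ u`. -/
theorem laplaceBeltramiOperator_apply (hg : IsRiemannianMetricOn g U) (hU : IsOpen U)
    (u : testFunctions U) :
    laplaceBeltramiOperator g U hg hU ⟨testToL2 hg hU u, LinearMap.mem_range_self _ u⟩ =
      testToL2 hg hU (laplaceBeltramiTest hg hU u) := by
  have h : (LinearEquiv.ofInjective (testToL2 hg hU) (testToL2_injective hg hU)).symm
      ⟨testToL2 hg hU u, LinearMap.mem_range_self _ u⟩ = u :=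
    (LinearEquiv.symm_apply_eq _).2 rfl
  exact congrArg (fun v => testToL2 hg hU (laplaceBeltramiTest hg hU v)) h

end Operator

/-- A densely defined symmetric operator whose closure is self-adjoint. -/
def IsEssentiallySelfAdjoint {H : Type*} [NormedAddCommGroup H] [InnerProductSpace ℂ H]
    [CompleteSpace H] (A : H →ₗ.[ℂ] H) : Prop :=
  Dense (A.domain : Set H) ∧ A.IsFormalAdjoint A ∧ IsSelfAdjoint A.closure

/-! ### The almost-Riemannian metric `diag(1, x⁻² e^{-2Φ})` -/

/-- The metric `diag(1, x⁻² e^{-2Φ(x,y)})`. -/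
def grushinMetric {T : ℝ} (Φ : Cyl T → ℝ) (p : Cyl T) : Matrix (Fin 2) (Fin 2) ℝ :=
  Matrix.diagonal ![1, (p.1 ^ 2)⁻¹ * Real.exp (-2 * Φ p)]

/-- `Ω = {x ≠ 0}`. -/
def Omega (T : ℝ) : Set (Cyl T) := {p | p.1 ≠ 0}

/-- `Ω₊ = {x > 0}`. -/
def OmegaPlus (T : ℝ) : Set (Cyl T) := {p | 0 < p.1}

/-- `Ω₋ = {x < 0}`. -/
def OmegaMinus (T : ℝ) : Set (Cyl T) := {p | p.1 < 0}

theorem isOpen_Omega (T : ℝ) : IsOpen (Omega T) := isOpen_ne_fun continuous_fst continuous_const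

theorem isOpen_OmegaPlus (T : ℝ) : IsOpen (OmegaPlus T) :=
  isOpen_lt continuous_const continuous_fst

theorem isOpen_OmegaMinus (T : ℝ) : IsOpen (OmegaMinus T) :=
  isOpen_lt continuous_fst continuous_const

theorem OmegaPlus_subset (T : ℝ) : OmegaPlus T ⊆ Omega T := fun _ hp => ne_of_gt hp

theorem OmegaMinus_subset (T : ℝ) : OmegaMinus T ⊆ Omega T := fun _ hp => ne_of_lt hp

/-- For `Φ` smooth on the whole cylinder, `diag(1, x⁻² e^{-2Φ})` is a Riemannian metric on `Ω`. -/
theorem grushinMetric_isRiemannianMetricOn {T : ℝ} {Φ : Cyl T → ℝ} (hΦ : SmoothOn Φ univ) :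
    IsRiemannianMetricOn (grushinMetric Φ) (Omega T) := by
  have hΦ' : ContDiffOn ℝ ∞ (Φ ∘ cover T) (cover T ⁻¹' Omega T) := hΦ.mono (subset_univ _)
  constructor
  · intro i j
    have h11 : SmoothOn (fun p : Cyl T => (p.1 ^ 2)⁻¹ * Real.exp (-2 * Φ p)) (Omega T) := by
      refine ContDiffOn.mul (ContDiffOn.inv (contDiffOn_fst.pow 2) fun q hq => ?_)
        (ContDiffOn.exp (contDiffOn_const.mul hΦ'))
      exact pow_ne_zero 2 hq
    have hc : ∀ c : ℝ, SmoothOn (fun _ : Cyl T => c) (Omega T) := fun c => contDiffOn_const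
    fin_cases i <;> fin_cases j
    · simpa [grushinMetric] using hc 1
    · simpa [grushinMetric] using hc 0
    · simpa [grushinMetric] using hc 0
    · simpa [grushinMetric] using h11
  · intro p hp
    refine Matrix.PosDef.diagonal fun i => ?_
    have : 0 < (p.1 ^ 2)⁻¹ := inv_pos.2 (sq_pos_iff.2 hp)
    fin_cases i
    · simp
    · simpa using mul_pos this (Real.exp_pos _)

end GrushinCylinder

end

/-!
# Essential self-adjointness of the Laplace–Beltrami operator of `diag(1, x⁻² e^{-2Φ})`

Let `ρ = |x|⁻¹ e^{-Φ}` be the area density, so that `ρ Δ = ∑ ∂_i (ρ gⁱⁱ ∂_i)` is in divergence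
form with `g⁰⁰ = 1`. Green's formula makes `Δ` symmetric and nonpositive, hence it suffices that
`Δ - c` has dense range for a single real `c > 0`
(`isEssentiallySelfAdjoint_of_nonpos`): a real `u ∈ L²(dω)` with `Δ u = c u` weakly on `U` has to
vanish. Since the equation has real coefficients, real and imaginary parts are treated separately.

For a smooth solution, testing with `χ² u`, where `χ` depends on `x` only and has compact support
away from `x = 0`, gives `∫ |∇(χ u)|² dω + c ∫ χ² u² dω = ∫ χ'² u² dω`. Expanding
`∫ ρ (∂_x f - f / x)² ≥ 0` with `∂_x ρ = -ρ (1/x + ∂_x Φ)` gives the Hardy inequality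
`∫ (1/x² + ∂_x Φ / x) f² dω ≤ ∫ (∂_x f)² dω` (`hardy_inequality`), and with `f = χ u` the Agmon
inequality
`∫ ((1/x² + ∂_x Φ / x + c) χ² - χ'²) u² dω ≤ 0`.
No regularity of `u` is needed: elliptic regularity is replaced by testing the weak equation with
`J (χ² J u)` for a mollification `J`, the error being a Friedrichs commutator which tends to zero
(`IsMollifier.abs_commutator_le`, `agmon_inequality`).

As `Φ` is constant for large `|x|`, there is `k` with `|∂_x Φ| ≤ 2 k`. On the half-cylinder `x > 0`
the weight `G = x e^{-kx}` satisfies `G'² = (1/x - k)² G² = (1/x² - 2 k / x + k²) G²`, so for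
`c = k² + 1` the integrand of the Agmon inequality is at least `G² u²`. This is the borderline case
of the Hardy inequality: `G` is bounded, but it vanishes only to first order at `x = 0` and has to
be cut off on a logarithmic scale, `χ = b(log x / n) G` with a bump function `b`, which costs an
error `O(1/n) ∫ u² dω` (`sq_logCutoff_le`). In the limit `∫ G² u² dω = 0`, that is `u = 0`
(`ae_eq_zero_of_weak_solution`); the half-cylinder `x < 0` is its mirror image. The argument takes
place on each half-cylinder separately, so it covers `Ω`, `Ω₊` and `Ω₋` alike. Density of the domain
follows from the same mollifications (`ae_eq_zero_of_integral_mul_test_eq_zero`).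
-/

noncomputable section

namespace GrushinCylinder

/-! ### A criterion for essential self-adjointness -/

section Criterion

variable {H : Type*} [NormedAddCommGroup H] [InnerProductSpace ℂ H]

/-- A symmetric operator `A ≤ 0` is coercive after a positive shift. -/
theorem norm_le_of_inner_nonpos {A : H →ₗ.[ℂ] H}
    (hneg : ∀ x : A.domain, (inner ℂ (A x) (x : H)).re ≤ 0)
    (c : ℝ) (x : A.domain) : c * ‖(x : H)‖ ≤ ‖A x - (c : ℂ) • (x : H)‖ := by
  rcases eq_or_ne ‖(x : H)‖ 0 with h0 | h0
  · rw [h0, mul_zero]; exact norm_nonneg _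
  have hpos : 0 < ‖(x : H)‖ := lt_of_le_of_ne (norm_nonneg _) h0.symm
  have h1 : (inner ℂ (A x - (c : ℂ) • (x : H)) (x : H)).re ≤ -(c * ‖(x : H)‖ ^ 2) := by
    rw [inner_sub_left, inner_smul_left, inner_self_eq_norm_sq_to_K, Complex.sub_re]
    have : ((starRingEnd ℂ) (c : ℂ) * ((‖(x : H)‖ : ℝ) : ℂ) ^ 2).re = c * ‖(x : H)‖ ^ 2 := by
      rw [Complex.conj_ofReal, ← Complex.ofReal_pow, ← Complex.ofReal_mul, Complex.ofReal_re]
    have h2 := hneg x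
    simp only [Complex.coe_algebraMap] at this ⊢
    linarith
  have h2 : -(‖A x - (c : ℂ) • (x : H)‖ * ‖(x : H)‖) ≤
      (inner ℂ (A x - (c : ℂ) • (x : H)) (x : H)).re := by
    have := norm_inner_le_norm (𝕜 := ℂ) (A x - (c : ℂ) • (x : H)) (x : H)
    have h3 := (abs_le.1 (Complex.abs_re_le_norm (inner ℂ (A x - (c : ℂ) • (x : H)) (x : H)))).1
    linarith
  have h3 : c * ‖(x : H)‖ * ‖(x : H)‖ ≤ ‖A x - (c : ℂ) • (x : H)‖ * ‖(x : H)‖ := by nlinarith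
  exact le_of_mul_le_mul_right h3 hpos

variable [CompleteSpace H]

/-- A densely defined symmetric operator `A ≤ 0` such that the range of `A - c` has trivial
orthogonal complement for a single `c > 0` is essentially self-adjoint. -/
theorem isEssentiallySelfAdjoint_of_nonpos {A : H →ₗ.[ℂ] H} (hd : Dense (A.domain : Set H))
    (hs : A.IsFormalAdjoint A) (hneg : ∀ x : A.domain, (inner ℂ (A x) (x : H)).re ≤ 0)
    {c : ℝ} (hc : 0 < c)
    (hr : ∀ u : H, (∀ x : A.domain, inner ℂ u (A x - (c : ℂ) • (x : H)) = 0) → u = 0) :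
    IsEssentiallySelfAdjoint A := by
  refine ⟨hd, hs, ?_⟩
  have hAadj : A ≤ A.adjoint := hs.le_adjoint hd
  have hcl : A.IsClosable := (LinearPMap.adjoint_isClosed hd).isClosable.leIsClosable hAadj
  have hgr := hcl.graph_closure_eq_closure_graph
  set B := A.closure with hB
  have hAB : A ≤ B := A.le_closure
  have hBd : Dense (B.domain : Set H) := hd.mono hAB.1
  have hBA : B ≤ A.adjoint := by
    refine LinearPMap.le_of_le_graph ?_
    rw [← hgr]
    exact Submodule.topologicalClosure_minimal _ (LinearPMap.le_graph_of_le hAadj)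
      (LinearPMap.adjoint_isClosed hd)
  -- for `y` in the domain of `A†` solve `(B - c) x₀ = (A† - c) y`; then `y - x₀` is orthogonal to
  -- the range of `A - c`
  have hAB' : A.adjoint ≤ B := by
    refine LinearPMap.le_of_le_graph ?_
    rintro ⟨y, w⟩ hyw
    rw [LinearPMap.mem_graph_iff] at hyw
    obtain ⟨y, rfl, rfl⟩ := hyw
    rw [← hgr]
    set z : H := A.adjoint y - (c : ℂ) • (y : H) with hz
    let R : A.domain →ₗ[ℂ] H := A.toFun - (c : ℂ) • A.domain.subtype
    have hR : ∀ x, R x = A x - (c : ℂ) • (x : H) := fun x => rfl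
    have htop : (LinearMap.range R).topologicalClosure = ⊤ := by
      rw [Submodule.topologicalClosure_eq_top_iff, Submodule.eq_bot_iff]
      intro u hu
      refine hr u fun x => ?_
      rw [← hR]
      exact (Submodule.mem_orthogonal' _ _).1 hu _ (LinearMap.mem_range_self R x)
    have hzc : z ∈ closure (LinearMap.range R : Set H) := by
      rw [← Submodule.topologicalClosure_coe, htop]; trivial
    obtain ⟨s, hsR, hsz⟩ := mem_closure_iff_seq_limit.1 hzc
    choose x hx using hsR
    -- coercivity turns convergence of `(A - c) x n` into convergence of `x n`
    have hcau : CauchySeq fun n => ((x n : A.domain) : H) := by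
      rw [Metric.cauchySeq_iff']
      intro ε hε
      obtain ⟨N, hN⟩ := Metric.cauchySeq_iff'.1 hsz.cauchySeq (c * ε) (mul_pos hc hε)
      refine ⟨N, fun n hn => ?_⟩
      have h1 := norm_le_of_inner_nonpos hneg c (x n - x N)
      rw [← hR, map_sub, hx, hx, ← dist_eq_norm, Submodule.coe_sub, ← dist_eq_norm] at h1
      exact lt_of_mul_lt_mul_left (h1.trans_lt (hN n hn)) hc.le
    obtain ⟨x₀, hx₀⟩ := cauchySeq_tendsto_of_complete hcau
    have hAx : Tendsto (fun n => A (x n)) atTop (𝓝 (z + (c : ℂ) • x₀)) := by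
      refine (hsz.add (hx₀.const_smul (c : ℂ))).congr fun n => ?_
      rw [← hx, hR]; abel
    have hmem : (x₀, z + (c : ℂ) • x₀) ∈ A.graph.topologicalClosure :=
      mem_closure_of_tendsto (hx₀.prodMk_nhds hAx)
        (Eventually.of_forall fun n => A.mem_graph (x n))
    have hmem' : (x₀, z + (c : ℂ) • x₀) ∈ A.adjoint.graph := by
      rw [hgr] at hmem
      exact LinearPMap.le_graph_of_le hBA hmem
    obtain ⟨x₁, hx₁, hx₁'⟩ := (LinearPMap.mem_graph_iff _).1 hmem'
    simp only at hx₁ hx₁'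
    have hadj := LinearPMap.adjoint_isFormalAdjoint hd
    have hzero : (y : H) - x₀ = 0 := by
      refine hr _ fun d => ?_
      have e1 := hadj y d
      have e2 := hadj x₁ d
      rw [hx₁, hx₁'] at e2
      have e3 : (inner ℂ (A.adjoint y) (d : H)) =
          inner ℂ z (d : H) + inner ℂ ((c : ℂ) • (y : H)) (d : H) := by
        rw [← inner_add_left, hz]; congr 1; abel
      rw [inner_sub_left, inner_sub_right, inner_sub_right, ← e1, ← e2, e3, inner_add_left,
        inner_smul_left, inner_smul_left, inner_smul_right, inner_smul_right, Complex.conj_ofReal]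
      ring
    have hyx : (y : H) = x₀ := sub_eq_zero.1 hzero
    have : A.adjoint y = z + (c : ℂ) • x₀ := by rw [hz, hyx]; abel
    rw [hyx, this]
    exact hmem
  have hBeq : B = A.adjoint := le_antisymm hBA hAB'
  have hform : A.adjoint.IsFormalAdjoint B := by
    intro y b
    let S : Submodule ℂ (H × H) :=
      LinearMap.ker ((innerSL ℂ (A.adjoint y)).comp (ContinuousLinearMap.fst ℂ H H) -
        (innerSL ℂ (y : H)).comp (ContinuousLinearMap.snd ℂ H H)).toLinearMap
    have hS : B.graph ≤ S := by
      rw [← hgr]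
      refine Submodule.topologicalClosure_minimal _ ?_ (ContinuousLinearMap.isClosed_ker _)
      rintro ⟨a, a'⟩ ha
      obtain ⟨a, rfl, rfl⟩ := (LinearPMap.mem_graph_iff _).1 ha
      have := LinearPMap.adjoint_isFormalAdjoint hd y a
      simpa [S, sub_eq_zero] using this
    have := hS (B.mem_graph b)
    simpa [S, sub_eq_zero] using this
  rw [LinearPMap.isSelfAdjoint_def]
  refine le_antisymm ?_ ?_
  · rw [hBeq]
    refine LinearPMap.IsFormalAdjoint.le_adjoint hd ?_
    rw [← hBeq]
    intro a b
    have h1 := LinearPMap.adjoint_isFormalAdjoint hBd b ⟨a, hAB.1 a.2⟩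
    have h2 : B ⟨a, hAB.1 a.2⟩ = A a := (hAB.2 (x := a) (y := ⟨a, hAB.1 a.2⟩) rfl).symm
    rw [h2] at h1
    rw [← inner_conj_symm, ← h1, inner_conj_symm]
  · have := LinearPMap.IsFormalAdjoint.le_adjoint hBd hform.symm
    rwa [← hBeq] at this

end Criterion

/-! ### Calculus on the cylinder -/

section CylinderCalculus

variable {T : ℝ} {E : Type*} [NormedAddCommGroup E] [NormedSpace ℝ E]

theorem continuous_cover (T : ℝ) : Continuous (cover T) :=
  (isOpenQuotientMap_cover T).continuous

theorem cover_zero (T : ℝ) : cover T 0 = 0 := by simp [cover]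

theorem cover_neg (T : ℝ) (h : ℝ × ℝ) : cover T (-h) = -cover T h := by simp [cover]

theorem cover_sub (T : ℝ) (a b : ℝ × ℝ) : cover T (a - b) = cover T a - cover T b := by
  simp [cover]

theorem smoothOn_univ_iff {f : Cyl T → E} : SmoothOn f univ ↔ ContDiff ℝ ∞ (f ∘ cover T) := by
  rw [SmoothOn, preimage_univ, contDiffOn_univ]

theorem SmoothOn.continuous {f : Cyl T → E} (hf : SmoothOn f univ) : Continuous f :=
  continuousOn_univ.1 (hf.continuousOn isOpen_univ)

/-- A smooth function is differentiable along the coordinate lines, with derivative `pderiv`. -/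
theorem SmoothOn.hasDerivAt {f : Cyl T → E} {U : Set (Cyl T)} (hf : SmoothOn f U)
    (hU : IsOpen U) (i : Fin 2) {p : Cyl T} (hp : p ∈ U) :
    HasDerivAt (fun s : ℝ => f (p + cover T (s • dir i))) (GrushinCylinder.pderiv i f p) 0 := by
  obtain ⟨q, rfl⟩ := (isOpenQuotientMap_cover T).surjective p
  have h := (hf.differentiableAt hU hp).hasFDerivAt.hasLineDerivAt (dir i)
  have h2 : (fun s : ℝ => f (cover T q + cover T (s • dir i))) =
      fun s : ℝ => (f ∘ cover T) (q + s • dir i) := by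
    funext s; rw [Function.comp_apply, cover_add]
  rw [pderiv_cover, (hf.differentiableAt hU hp).lineDeriv_eq_fderiv, h2]
  exact h

theorem SmoothOn.hasDerivAt_translate {f : Cyl T → E} (hf : SmoothOn f univ) (i : Fin 2)
    (p : Cyl T) (s : ℝ) :
    HasDerivAt (fun s : ℝ => f (p + cover T (s • dir i)))
      (GrushinCylinder.pderiv i f (p + cover T (s • dir i))) s := by
  have h := hf.hasDerivAt isOpen_univ i (mem_univ (p + cover T (s • dir i)))
  have h2 := HasDerivAt.comp_sub_const s s (by simpa using h)
  refine h2.congr_of_eventuallyEq (Eventually.of_forall fun t => ?_)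
  simp only [add_assoc, ← cover_add, ← add_smul]
  congr 4
  ring

theorem pderiv_eq_zero_of_notMem_tsupport {f : Cyl T → E} {i : Fin 2} {p : Cyl T}
    (hp : p ∉ tsupport f) : pderiv i f p = 0 := by
  rw [pderiv_congr (h := fun _ => (0 : E)) (notMem_tsupport_iff_eventuallyEq.1 hp), pderiv_zero]

theorem tsupport_pderiv_subset (i : Fin 2) (f : Cyl T → E) :
    tsupport (pderiv i f) ⊆ tsupport f :=
  closure_minimal (fun _ hp => by_contra fun h => hp (pderiv_eq_zero_of_notMem_tsupport h))
    (isClosed_tsupport f)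

theorem hasCompactSupport_pderiv {f : Cyl T → E} (hf : HasCompactSupport f) (i : Fin 2) :
    HasCompactSupport (pderiv i f) :=
  HasCompactSupport.of_support_subset_isCompact hf
    ((subset_tsupport _).trans (tsupport_pderiv_subset i f))

theorem pderiv_mul {f h : Cyl T → ℝ} {U : Set (Cyl T)} (hf : SmoothOn f U) (hh : SmoothOn h U)
    (hU : IsOpen U) (i : Fin 2) {p : Cyl T} (hp : p ∈ U) :
    pderiv i (fun p => f p * h p) p = pderiv i f p * h p + f p * pderiv i h p := by
  have := ((hf.hasDerivAt hU i hp).fun_mul (hh.hasDerivAt hU i hp)).deriv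
  simpa [pderiv, cover_zero] using this

theorem SmoothOn.mul {f h : Cyl T → ℝ} {U : Set (Cyl T)} (hf : SmoothOn f U)
    (hh : SmoothOn h U) : SmoothOn (fun p => f p * h p) U :=
  ContDiffOn.mul hf hh

/-- A function of `x` alone, as a function on the cylinder. -/
theorem smoothOn_comp_fst {f : ℝ → ℝ} (hf : ContDiff ℝ ∞ f) (U : Set (Cyl T)) :
    SmoothOn (fun p : Cyl T => f p.1) U :=
  (hf.comp contDiff_fst).contDiffOn

theorem pderiv_zero_comp_fst (f : ℝ → ℝ) (p : Cyl T) :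
    pderiv 0 (fun p : Cyl T => f p.1) p = deriv f p.1 := by
  have : (fun s : ℝ => f (p + cover T (s • dir 0)).1) = fun s => f (p.1 + s) := by
    funext s; simp [cover, dir]
  rw [pderiv, this, deriv_comp_const_add, add_zero]

theorem pderiv_one_comp_fst (f : ℝ → ℝ) (p : Cyl T) :
    pderiv 1 (fun p : Cyl T => f p.1) p = 0 := by
  have : (fun s : ℝ => f (p + cover T (s • dir 1)).1) = fun s => f p.1 := by
    funext s; simp [cover, dir]
  rw [pderiv, this, deriv_const]

/-- A function which is smooth on `U` and whose support is contained in `U` is smooth everywhere. -/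
theorem SmoothOn.of_tsupport_subset {f : Cyl T → E} {U : Set (Cyl T)} (hf : SmoothOn f U)
    (hU : IsOpen U) (hfU : tsupport f ⊆ U) : SmoothOn f univ := by
  intro q _
  refine ContDiffAt.contDiffWithinAt ?_
  by_cases hq : cover T q ∈ U
  · exact ContDiffOn.contDiffAt hf ((isOpen_cover_preimage hU).mem_nhds hq)
  · have hq' : cover T q ∈ (tsupport f)ᶜ := fun h => hq (hfU h)
    have hev : (f ∘ cover T) =ᶠ[𝓝 q] fun _ => 0 := by
      filter_upwards [(isOpen_cover_preimage (isClosed_tsupport f).isOpen_compl).mem_nhds hq']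
        with r hr
      exact image_eq_zero_of_notMem_tsupport (f := f) hr
    exact contDiffAt_const.congr_of_eventuallyEq hev

/-- A smooth function on `U`, multiplied by a cutoff supported in `U`, is smooth everywhere. -/
theorem SmoothOn.mul_of_tsupport_subset {z f : Cyl T → ℝ} {U : Set (Cyl T)} (hf : SmoothOn f U)
    (hU : IsOpen U) (hz : SmoothOn z univ) (hzU : tsupport z ⊆ U) :
    SmoothOn (fun p => z p * f p) univ :=
  ((hz.mono (subset_univ U)).mul hf).of_tsupport_subset hU (tsupport_mul_subset_left.trans hzU)

instance : SecondCountableTopology (AddCircle T) :=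
  (QuotientAddGroup.isOpenQuotientMap_mk (G := ℝ)
    (N := AddSubgroup.zmultiples T)).isQuotientMap.secondCountableTopology
      QuotientAddGroup.isOpenMap_coe

variable [Fact (0 < T)]

instance : (volume : Measure (Cyl T)).IsAddLeftInvariant :=
  Measure.prod.instIsAddLeftInvariant

instance : (volume : Measure (Cyl T)).IsAddRightInvariant := inferInstance

/-- The integral of a derivative vanishes: `∫ f (p + s e_i) dp` does not depend on `s`. -/
theorem integral_pderiv_eq_zero [CompleteSpace E] {f : Cyl T → E} (hf : SmoothOn f univ)
    (hc : HasCompactSupport f) (i : Fin 2) : ∫ p, pderiv i f p = 0 := by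
  have hd : Continuous (pderiv i f) := (hf.pderiv isOpen_univ i).continuous
  have hdc := hasCompactSupport_pderiv hc i
  obtain ⟨C, hC⟩ := hdc.exists_bound_of_continuous hd
  have hcov : Continuous fun s : ℝ => cover T (s • dir i) :=
    (continuous_cover T).comp (continuous_id.smul continuous_const)
  set K : Set (Cyl T) := (fun z : Cyl T × ℝ => z.1 - cover T (z.2 • dir i)) ''
    (tsupport f ×ˢ Icc (-1) 1) with hK
  have hKc : IsCompact K := (hc.isCompact.prod isCompact_Icc).image
    (continuous_fst.sub (hcov.comp continuous_snd))
  have key := hasDerivAt_integral_of_dominated_loc_of_deriv_le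
    (μ := (volume : Measure (Cyl T))) (F := fun s p => f (p + cover T (s • dir i)))
    (F' := fun s p => pderiv i f (p + cover T (s • dir i))) (x₀ := (0 : ℝ)) (s := Ioo (-1) 1)
    (bound := K.indicator fun _ => C) (Ioo_mem_nhds (by norm_num) (by norm_num))
    (Eventually.of_forall fun s =>
      (hf.continuous.comp (continuous_id.add continuous_const)).aestronglyMeasurable)
    (by simpa [cover_zero] using hf.continuous.integrable_of_hasCompactSupport hc)
    ((hd.comp (continuous_id.add continuous_const)).aestronglyMeasurable)
    (Eventually.of_forall fun p s hs => by
      by_cases hp : p ∈ K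
      · rw [indicator_of_mem hp]; exact hC _
      · rw [indicator_of_notMem hp, pderiv_eq_zero_of_notMem_tsupport, norm_zero]
        intro hps
        exact hp ⟨(_, s), ⟨hps, Ioo_subset_Icc_self hs⟩, add_sub_cancel_right _ _⟩)
    ((integrable_indicator_iff hKc.measurableSet).2
      (integrableOn_const hKc.measure_lt_top.ne))
    (Eventually.of_forall fun p s _ => hf.hasDerivAt_translate i p s)
  have hconst : (fun s : ℝ => ∫ p, f (p + cover T (s • dir i))) = fun _ => ∫ p, f p := by
    funext s
    exact integral_add_right_eq_self f _
  have h2 := key.2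
  rw [hconst] at h2
  simpa [cover_zero] using h2.unique (hasDerivAt_const (0 : ℝ) _)

end CylinderCalculus

/-! ### Square integrable functions with compact support and their translates -/

section Translates

variable {T : ℝ}

theorem measurable_translate {v : Cyl T → ℝ} (hv : Measurable v) :
    Measurable fun z : Cyl T × (ℝ × ℝ) => v (z.1 - cover T z.2) :=
  hv.comp (measurable_fst.sub ((continuous_cover T).measurable.comp measurable_snd))

variable [Fact (0 < T)]

/-- Real square integrable functions with compact support on the cylinder, as honest (measurable)
functions. -/
structure IsCompactL2 (v : Cyl T → ℝ) : Prop where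
  measurable : Measurable v
  compact : HasCompactSupport v
  sq : Integrable (fun p => v p ^ 2)

theorem IsCompactL2.of_continuous {v : Cyl T → ℝ} (hv : Continuous v) (hc : HasCompactSupport v) :
    IsCompactL2 v := by
  refine ⟨hv.measurable, hc, ?_⟩
  have h2 : HasCompactSupport fun p => v p ^ 2 := by
    simp only [pow_two]
    exact hc.mul_left
  exact (hv.pow 2).integrable_of_hasCompactSupport h2

theorem IsCompactL2.integrable {v : Cyl T → ℝ} (hv : IsCompactL2 v) : Integrable v := by
  have h1 : Integrable ((tsupport v).indicator fun _ => (1 : ℝ)) :=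
    (integrable_indicator_iff (isClosed_tsupport v).measurableSet).2
      (integrableOn_const hv.compact.isCompact.measure_lt_top.ne)
  refine (h1.add hv.sq).mono' hv.measurable.aestronglyMeasurable (Eventually.of_forall fun p => ?_)
  rw [Pi.add_apply]
  by_cases hp : p ∈ tsupport v
  · rw [indicator_of_mem hp, Real.norm_eq_abs, abs_le]
    constructor <;> nlinarith [sq_nonneg (v p - 1), sq_nonneg (v p + 1)]
  · rw [image_eq_zero_of_notMem_tsupport hp, indicator_of_notMem hp]
    simp

theorem IsCompactL2.mul_continuous {v a : Cyl T → ℝ} (hv : IsCompactL2 v) (ha : Continuous a) :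
    IsCompactL2 (fun p => v p * a p) := by
  obtain ⟨C, hC⟩ := hv.compact.isCompact.exists_bound_of_continuousOn ha.continuousOn
  refine ⟨hv.measurable.mul ha.measurable, hv.compact.mul_right, ?_⟩
  refine (hv.sq.mul_const (C ^ 2)).mono'
    ((hv.measurable.mul ha.measurable).pow_const 2).aestronglyMeasurable
    (Eventually.of_forall fun p => ?_)
  rw [Real.norm_eq_abs, abs_of_nonneg (sq_nonneg _), mul_pow]
  by_cases hp : p ∈ tsupport v
  · have h1 := hC p hp
    rw [Real.norm_eq_abs] at h1
    exact mul_le_mul_of_nonneg_left (sq_le_sq' (by linarith [(abs_le.1 h1).1]) (abs_le.1 h1).2)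
      (sq_nonneg _)
  · simp [image_eq_zero_of_notMem_tsupport hp]

theorem IsCompactL2.integrable_mul {u v : Cyl T → ℝ} (hu : IsCompactL2 u) (hv : IsCompactL2 v) :
    Integrable (fun p => u p * v p) := by
  refine (hu.sq.add hv.sq).mono' (hu.measurable.mul hv.measurable).aestronglyMeasurable
    (Eventually.of_forall fun p => ?_)
  rw [Pi.add_apply, Real.norm_eq_abs, abs_le]
  constructor <;> nlinarith [sq_nonneg (u p + v p), sq_nonneg (u p - v p)]

theorem IsCompactL2.sub {u v : Cyl T → ℝ} (hu : IsCompactL2 u) (hv : IsCompactL2 v) :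
    IsCompactL2 (fun p => u p - v p) := by
  refine ⟨hu.measurable.sub hv.measurable, hu.compact.sub hv.compact, ?_⟩
  refine ((hu.sq.add hv.sq).sub ((hu.integrable_mul hv).const_mul 2)).congr
    (Eventually.of_forall fun p => ?_)
  simp only [Pi.add_apply, Pi.sub_apply]
  ring

theorem IsCompactL2.translate {v : Cyl T → ℝ} (hv : IsCompactL2 v) (c : Cyl T) :
    IsCompactL2 (fun p => v (p - c)) :=
  ⟨hv.measurable.comp (measurable_id.sub_const c),
    hv.compact.comp_homeomorph (Homeomorph.subRight c),
    hv.sq.comp_sub_right c⟩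

theorem IsCompactL2.memLp {v : Cyl T → ℝ} (hv : IsCompactL2 v) : MemLp v 2 volume :=
  (memLp_two_iff_integrable_sq hv.measurable.aestronglyMeasurable).2 hv.sq

/-- Translations act continuously on `L²`. -/
theorem IsCompactL2.exists_translate_le {v : Cyl T → ℝ} (hv : IsCompactL2 v) {D : ℝ} (hD : 0 < D) :
    ∃ ε > 0, ∀ h : ℝ × ℝ, ‖h‖ ≤ ε → ∫ p, (v (p - cover T h) - v p) ^ 2 ≤ D := by
  let G : C(ℝ × ℝ, C(Cyl T, Cyl T)) :=
    (ContinuousMap.mk (fun z : (ℝ × ℝ) × Cyl T => z.2 - cover T z.1)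
      (continuous_snd.sub ((continuous_cover T).comp continuous_fst))).curry
  have hG : ∀ h, MeasurePreserving (G h) (volume : Measure (Cyl T)) volume := fun h =>
    measurePreserving_sub_right volume (cover T h)
  let V : Lp ℝ 2 (volume : Measure (Cyl T)) := hv.memLp.toLp v
  have hcont : Continuous fun h => Lp.compMeasurePreserving (G h) (hG h) V :=
    Continuous.compMeasurePreservingLp continuous_const G.continuous hG (by simp)
  have h0 : ∀ h, ‖Lp.compMeasurePreserving (G h) (hG h) V - Lp.compMeasurePreserving (G 0) (hG 0) V‖
      ^ 2 = ∫ p, (v (p - cover T h) - v p) ^ 2 := by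
    intro h
    rw [Lp.toLp_compMeasurePreserving, Lp.toLp_compMeasurePreserving, ← MemLp.toLp_sub,
      ← @real_inner_self_eq_norm_sq, L2.inner_def]
    refine integral_congr_ae ?_
    filter_upwards [MemLp.coeFn_toLp ((hv.memLp.comp_measurePreserving (hG h)).sub
      (hv.memLp.comp_measurePreserving (hG 0)))] with p hp
    rw [hp]
    simp [G, cover_zero, pow_two]
  have hlim := (tendsto_iff_norm_sub_tendsto_zero.1 (hcont.tendsto 0)).pow 2
  simp only [h0] at hlim
  have hev := hlim.eventually_le_const (show (0 : ℝ) ^ 2 < D by simpa using hD)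
  obtain ⟨ε, hε, hball⟩ := Metric.eventually_nhds_iff.1 hev
  refine ⟨ε / 2, half_pos hε, fun h hh => ?_⟩
  exact hball (by rw [dist_zero_right]; linarith)

theorem integrable_kernel_mul_translate_sq {v : Cyl T → ℝ} (hv : IsCompactL2 v) {m : ℝ × ℝ → ℝ}
    (hm : Integrable m) (hmm : Measurable m) :
    Integrable (fun z : Cyl T × (ℝ × ℝ) => m z.2 * v (z.1 - cover T z.2) ^ 2)
      (volume.prod volume) := by
  refine (integrable_prod_iff' ?_).2 ⟨Eventually.of_forall fun h => ?_, ?_⟩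
  · exact ((hmm.comp measurable_snd).mul
      ((measurable_translate hv.measurable).pow_const 2)).aestronglyMeasurable
  · exact (hv.translate (cover T h)).sq.const_mul (m h)
  · have : (fun h : ℝ × ℝ => ∫ p : Cyl T, ‖m h * v (p - cover T h) ^ 2‖) =
        fun h => ‖m h‖ * ∫ p, v p ^ 2 := by
      funext h
      simp only [norm_mul, norm_pow, Real.norm_eq_abs, sq_abs]
      rw [integral_const_mul, integral_sub_right_eq_self (fun p => v p ^ 2) (cover T h)]
    rw [this]
    exact hm.norm.mul_const _

theorem integrable_kernel_mul_translate {f v : Cyl T → ℝ} (hf : IsCompactL2 f)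
    (hv : IsCompactL2 v) {k : Cyl T × (ℝ × ℝ) → ℝ} (hk : Measurable k) {m : ℝ × ℝ → ℝ}
    (hm : Integrable m) (hmm : Measurable m) (hkm : ∀ z, |k z| ≤ m z.2) :
    Integrable (fun z : Cyl T × (ℝ × ℝ) => k z * (f z.1 * v (z.1 - cover T z.2)))
      (volume.prod volume) := by
  have h1 : Integrable (fun z : Cyl T × (ℝ × ℝ) => f z.1 ^ 2 * m z.2) (volume.prod volume) :=
    hf.sq.mul_prod hm
  refine (h1.add (integrable_kernel_mul_translate_sq hv hm hmm)).mono' ?_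
    (Eventually.of_forall fun z => ?_)
  · exact (hk.mul ((hf.measurable.comp measurable_fst).mul
      (measurable_translate hv.measurable))).aestronglyMeasurable
  · rw [Real.norm_eq_abs, abs_mul, Pi.add_apply]
    have h2 : |f z.1 * v (z.1 - cover T z.2)| ≤ f z.1 ^ 2 + v (z.1 - cover T z.2) ^ 2 := by
      rw [abs_le]
      constructor <;> nlinarith [sq_nonneg (f z.1 + v (z.1 - cover T z.2)),
        sq_nonneg (f z.1 - v (z.1 - cover T z.2))]
    have h3 := mul_le_mul (hkm z) h2 (abs_nonneg _) ((abs_nonneg _).trans (hkm z))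
    linarith

/-- An integral operator whose kernel is dominated by `m (p - q)` and which only sees the increments
of `v` is as small as the translates of `v` are close to `v`. -/
theorem abs_integral_kernel_increment_le {f v : Cyl T → ℝ} (hf : IsCompactL2 f)
    (hv : IsCompactL2 v) {k : Cyl T × (ℝ × ℝ) → ℝ} (hk : Measurable k) {m : ℝ × ℝ → ℝ}
    (hm : Integrable m) (hmm : Measurable m) (hkm : ∀ z, |k z| ≤ m z.2) {D : ℝ}
    (hD : ∀ h, m h ≠ 0 → ∫ p, (v (p - cover T h) - v p) ^ 2 ≤ D) {t : ℝ} (ht : 0 < t) :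
    |∫ p, f p * ∫ h, k (p, h) * (v (p - cover T h) - v p)| ≤
      (∫ h, m h) * ((t * (∫ p, f p ^ 2) + D / t) / 2) := by
  have hm0 : ∀ h, 0 ≤ m h := fun h => (abs_nonneg _).trans (hkm (0, h))
  have hint : Integrable (fun z : Cyl T × (ℝ × ℝ) =>
      k z * (f z.1 * (v (z.1 - cover T z.2) - v z.1))) (volume.prod volume) := by
    have h1 := integrable_kernel_mul_translate hf hv hk hm hmm hkm
    have h2 : Integrable (fun z : Cyl T × (ℝ × ℝ) => k z * (f z.1 * v z.1))
        (volume.prod volume) := by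
      refine ((hf.integrable_mul hv).norm.mul_prod hm).mono' ?_ (Eventually.of_forall fun z => ?_)
      · exact (hk.mul ((hf.measurable.comp measurable_fst).mul
          (hv.measurable.comp measurable_fst))).aestronglyMeasurable
      · rw [norm_mul, mul_comm]
        exact mul_le_mul_of_nonneg_left (hkm z) (norm_nonneg _)
    refine (h1.sub h2).congr (Eventually.of_forall fun z => ?_)
    simp only [Pi.sub_apply]
    ring
  have hswap : ∫ p, f p * ∫ h, k (p, h) * (v (p - cover T h) - v p) =
      ∫ h, ∫ p, k (p, h) * (f p * (v (p - cover T h) - v p)) := by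
    rw [← integral_integral_swap (f := fun p h => k (p, h) * (f p * (v (p - cover T h) - v p)))
      hint]
    refine integral_congr_ae (Eventually.of_forall fun p => ?_)
    simp only
    rw [← integral_const_mul]
    refine integral_congr_ae (Eventually.of_forall fun h => ?_)
    simp only
    ring
  rw [hswap, ← Real.norm_eq_abs, ← integral_mul_const]
  refine norm_integral_le_of_norm_le (hm.mul_const _) (Eventually.of_forall fun h => ?_)
  have hw : IsCompactL2 fun p => v (p - cover T h) - v p := (hv.translate _).sub hv
  have hpt : ∀ p, ‖k (p, h) * (f p * (v (p - cover T h) - v p))‖ ≤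
      m h * ((t * f p ^ 2 + (v (p - cover T h) - v p) ^ 2 / t) / 2) := by
    intro p
    rw [norm_mul]
    refine mul_le_mul (hkm (p, h)) ?_ (norm_nonneg _) (hm0 h)
    set x := f p
    set y := v (p - cover T h) - v p
    have e1 : t * x ^ 2 + y ^ 2 / t = ((t * x) ^ 2 + y ^ 2) / t := by field_simp
    rw [Real.norm_eq_abs, e1, div_div, le_div_iff₀ (by positivity), abs_mul]
    have e2 : (t * x) ^ 2 + y ^ 2 = (t * |x|) ^ 2 + |y| ^ 2 := by rw [mul_pow, mul_pow, sq_abs, sq_abs]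
    nlinarith [sq_nonneg (t * |x| - |y|)]
  have hI : Integrable fun p => m h * ((t * f p ^ 2 + (v (p - cover T h) - v p) ^ 2 / t) / 2) :=
    (((hf.sq.const_mul t).add (hw.sq.div_const t)).div_const 2).const_mul _
  refine (norm_integral_le_of_norm_le hI (Eventually.of_forall hpt)).trans ?_
  rw [integral_const_mul, integral_div, integral_add (hf.sq.const_mul t) (hw.sq.div_const t),
    integral_const_mul, integral_div]
  rcases eq_or_ne (m h) 0 with h0 | h0
  · simp [h0]
  · refine mul_le_mul_of_nonneg_left ?_ (hm0 h)
    have := div_le_div_of_nonneg_right (hD h h0) ht.le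
    linarith

/-- The lift of an integrable function to the universal covering is locally integrable. -/
theorem locallyIntegrable_comp_cover {v : Cyl T → ℝ} (hv : Integrable v) :
    LocallyIntegrable (v ∘ cover T) := by
  have hT : 0 < T := Fact.out
  intro q
  refine ⟨univ ×ˢ Ioc (q.2 - T / 2) (q.2 - T / 2 + T), ?_, ?_⟩
  · exact prod_mem_nhds univ_mem (Ioc_mem_nhds (by linarith) (by linarith))
  · have h1 : MeasurePreserving (cover T)
        ((volume : Measure ℝ).prod (volume.restrict (Ioc (q.2 - T / 2) (q.2 - T / 2 + T))))
        (volume.prod volume) :=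
      (MeasurePreserving.id volume).prod (AddCircle.measurePreserving_mk T (q.2 - T / 2))
    have h2 := h1.integrable_comp_of_integrable (g := v) hv
    rw [IntegrableOn, Measure.volume_eq_prod, ← Measure.prod_restrict, Measure.restrict_univ]
    exact h2

end Translates

/-! ### Mollification on the cylinder -/

section Mollification

variable {T : ℝ}

/-- The convolution `∫ κ(h) v(p - h) dh` of a function on the cylinder with a kernel on the plane,
which acts on the cylinder by translations. -/
def mollify (κ : ℝ × ℝ → ℝ) (v : Cyl T → ℝ) (p : Cyl T) : ℝ :=
  ∫ h, κ h * v (p - cover T h)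

/-- The `i`-th partial derivative of a kernel on the plane. -/
def kernelDeriv (i : Fin 2) (κ : ℝ × ℝ → ℝ) (h : ℝ × ℝ) : ℝ :=
  fderiv ℝ κ h (dir i)

theorem mollify_comp_cover (κ : ℝ × ℝ → ℝ) (v : Cyl T → ℝ) :
    mollify κ v ∘ cover T =
      convolution κ (v ∘ cover T) (ContinuousLinearMap.mul ℝ ℝ) volume := by
  funext q
  simp only [mollify, convolution, Function.comp, cover_sub, ContinuousLinearMap.mul_apply']

theorem continuous_kernelDeriv {κ : ℝ × ℝ → ℝ} (hκ : ContDiff ℝ ∞ κ) (i : Fin 2) :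
    Continuous (kernelDeriv i κ) :=
  (hκ.continuous_fderiv (by simp)).clm_apply continuous_const

theorem hasCompactSupport_kernelDeriv {κ : ℝ × ℝ → ℝ} (hc : HasCompactSupport κ) (i : Fin 2) :
    HasCompactSupport (kernelDeriv i κ) :=
  hc.fderiv_apply ℝ (dir i)

theorem kernelDeriv_neg {κ : ℝ × ℝ → ℝ} (hκ : ContDiff ℝ ∞ κ) (heven : ∀ h, κ (-h) = κ h)
    (i : Fin 2) (h : ℝ × ℝ) : kernelDeriv i κ (-h) = -kernelDeriv i κ h := by
  have h1 : HasFDerivAt (fun x => κ (-x)) ((fderiv ℝ κ (-h)).comp (-ContinuousLinearMap.id ℝ _)) h :=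
    ((hκ.differentiable (by simp)).differentiableAt.hasFDerivAt).comp h (hasFDerivAt_id h).neg
  simp only [heven] at h1
  simp [kernelDeriv, h1.fderiv]

theorem tsupport_mollify_subset {κ : ℝ × ℝ → ℝ} {v : Cyl T → ℝ} (hc : HasCompactSupport κ)
    (hv : HasCompactSupport v) : tsupport (mollify κ v) ⊆
      (fun z : Cyl T × (ℝ × ℝ) => z.1 + cover T z.2) '' (tsupport v ×ˢ tsupport κ) := by
  have hK := (hv.isCompact.prod hc.isCompact).image (f := fun z : Cyl T × (ℝ × ℝ) =>
    z.1 + cover T z.2) (continuous_fst.add ((continuous_cover T).comp continuous_snd))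
  refine closure_minimal (fun p hp => ?_) hK.isClosed
  by_contra hpK
  refine hp (integral_eq_zero_of_ae (Eventually.of_forall fun h => ?_))
  by_contra hne
  exact hpK ⟨(p - cover T h, h), ⟨subset_tsupport _ (right_ne_zero_of_mul hne),
    subset_tsupport _ (left_ne_zero_of_mul hne)⟩, sub_add_cancel _ _⟩

theorem hasCompactSupport_mollify {κ : ℝ × ℝ → ℝ} {v : Cyl T → ℝ} (hc : HasCompactSupport κ)
    (hv : HasCompactSupport v) : HasCompactSupport (mollify κ v) :=
  HasCompactSupport.of_support_subset_isCompact
    ((hv.isCompact.prod hc.isCompact).image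
      (continuous_fst.add ((continuous_cover T).comp continuous_snd)))
    ((subset_tsupport _).trans (tsupport_mollify_subset hc hv))

/-- `J (∂_i f) = (∂_i κ) * f`: a derivative of the function can be moved to the kernel. -/
theorem mollify_pderiv {κ : ℝ × ℝ → ℝ} (hκ : ContDiff ℝ ∞ κ) (hc : HasCompactSupport κ)
    {f : Cyl T → ℝ} (hf : SmoothOn f univ) (i : Fin 2) :
    mollify κ (pderiv i f) = mollify (kernelDeriv i κ) f := by
  funext p
  obtain ⟨q, rfl⟩ := (isOpenQuotientMap_cover T).surjective p
  have hsm := smoothOn_univ_iff.1 hf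
  have hg : ContDiff ℝ ∞ fun h : ℝ × ℝ => (f ∘ cover T) (q - h) :=
    hsm.comp (contDiff_const.sub contDiff_id)
  have hfd : ∀ h, fderiv ℝ (fun h : ℝ × ℝ => (f ∘ cover T) (q - h)) h (dir i) =
      -pderiv i f (cover T q - cover T h) := by
    intro h
    have h1 : HasFDerivAt (fun h : ℝ × ℝ => (f ∘ cover T) (q - h))
        ((fderiv ℝ (f ∘ cover T) (q - h)).comp (-ContinuousLinearMap.id ℝ _)) h :=
      ((hsm.differentiable (by simp)).differentiableAt.hasFDerivAt).comp h
        ((hasFDerivAt_id h).const_sub q)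
    rw [← cover_sub, pderiv_cover,
      (hsm.differentiable (by simp)).differentiableAt.lineDeriv_eq_fderiv, h1.fderiv]
    simp
  have hpc : Continuous (pderiv i f) := (hf.pderiv isOpen_univ i).continuous
  have hsub : Continuous fun h : ℝ × ℝ => cover T q - cover T h :=
    continuous_const.sub (continuous_cover T)
  have key := integral_mul_fderiv_eq_neg_fderiv_mul_of_integrable
    (μ := (volume : Measure (ℝ × ℝ))) (𝕜 := ℝ)
    (f := fun h : ℝ × ℝ => (f ∘ cover T) (q - h)) (g := κ) (v := dir i)
    (by
      simp only [hfd]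
      exact ((hpc.comp hsub).neg.mul hκ.continuous).integrable_of_hasCompactSupport hc.mul_left)
    ((hg.continuous.mul (continuous_kernelDeriv hκ i)).integrable_of_hasCompactSupport
      (hasCompactSupport_kernelDeriv hc i).mul_left)
    ((hg.continuous.mul hκ.continuous).integrable_of_hasCompactSupport hc.mul_left)
    (fun x _ => (hg.differentiable (by simp)).differentiableAt)
    (fun x _ => (hκ.differentiable (by simp)).differentiableAt)
  simp only [hfd, neg_mul, integral_neg, neg_neg] at key
  simp only [mollify]
  rw [← integral_congr_ae (Eventually.of_forall fun h => mul_comm _ _), ← key]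
  refine integral_congr_ae (Eventually.of_forall fun h => ?_)
  simp only [kernelDeriv, Function.comp, cover_sub]
  ring

variable [Fact (0 < T)]

theorem integrable_mollify_integrand {κ : ℝ × ℝ → ℝ} (hκ : Continuous κ)
    (hc : HasCompactSupport κ) {v : Cyl T → ℝ} (hv : Integrable v) (p : Cyl T) :
    Integrable fun h => κ h * v (p - cover T h) := by
  obtain ⟨q, rfl⟩ := (isOpenQuotientMap_cover T).surjective p
  have := hc.convolutionExists_left (ContinuousLinearMap.mul ℝ ℝ) hκ
    (locallyIntegrable_comp_cover hv) q
  simpa only [ConvolutionExistsAt, ContinuousLinearMap.mul_apply', Function.comp, cover_sub]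
    using this

theorem smoothOn_mollify {κ : ℝ × ℝ → ℝ} (hκ : ContDiff ℝ ∞ κ) (hc : HasCompactSupport κ)
    {v : Cyl T → ℝ} (hv : Integrable v) : SmoothOn (mollify κ v) univ := by
  rw [smoothOn_univ_iff, mollify_comp_cover]
  exact hc.contDiff_convolution_left _ hκ (locallyIntegrable_comp_cover hv)

/-- `∂_i (J v) = (∂_i κ) * v`. -/
theorem pderiv_mollify {κ : ℝ × ℝ → ℝ} (hκ : ContDiff ℝ ∞ κ) (hc : HasCompactSupport κ)
    {v : Cyl T → ℝ} (hv : Integrable v) (i : Fin 2) :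
    pderiv i (mollify κ v) = mollify (kernelDeriv i κ) v := by
  funext p
  obtain ⟨q, rfl⟩ := (isOpenQuotientMap_cover T).surjective p
  have hl := locallyIntegrable_comp_cover hv
  have h1 := hc.hasFDerivAt_convolution_left (ContinuousLinearMap.mul ℝ ℝ)
    (hκ.of_le (by simp)) hl q
  have h2 := (hc.fderiv ℝ).convolutionExists_left
    ((ContinuousLinearMap.mul ℝ ℝ).precompL (ℝ × ℝ)) (hκ.continuous_fderiv (by simp)) hl q
  rw [pderiv_cover, mollify_comp_cover, h1.differentiableAt.lineDeriv_eq_fderiv, h1.fderiv,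
    convolution_def, ContinuousLinearMap.integral_apply h2]
  refine integral_congr_ae (Eventually.of_forall fun h => ?_)
  simp [kernelDeriv, cover_sub]

theorem IsCompactL2.mollify {κ : ℝ × ℝ → ℝ} (hκ : ContDiff ℝ ∞ κ) (hc : HasCompactSupport κ)
    {v : Cyl T → ℝ} (hv : IsCompactL2 v) : IsCompactL2 (mollify κ v) :=
  .of_continuous (smoothOn_mollify hκ hc hv.integrable).continuous
    (hasCompactSupport_mollify hc hv.compact)

/-- The adjoint of the convolution with `κ` is the convolution with `κ(-h)`. -/
theorem integral_mul_mollify {κ : ℝ × ℝ → ℝ} (hκ : Continuous κ) (hc : HasCompactSupport κ)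
    {u f : Cyl T → ℝ} (hu : IsCompactL2 u) (hf : IsCompactL2 f) :
    ∫ p, u p * mollify κ f p = ∫ p, f p * mollify (fun h => κ (-h)) u p := by
  have aux : ∀ (κ : ℝ × ℝ → ℝ), Continuous κ → HasCompactSupport κ → ∀ (u f : Cyl T → ℝ),
      IsCompactL2 u → IsCompactL2 f → ∫ p, u p * mollify κ f p =
        ∫ h, ∫ p, κ h * (u p * f (p - cover T h)) := by
    intro κ hκ hc u f hu hf
    rw [← integral_integral_swap (f := fun p h => κ h * (u p * f (p - cover T h)))]
    · refine integral_congr_ae (Eventually.of_forall fun p => ?_)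
      simp only [GrushinCylinder.mollify]
      rw [← integral_const_mul]
      refine integral_congr_ae (Eventually.of_forall fun h => ?_)
      simp only
      ring
    · exact integrable_kernel_mul_translate hu hf (k := fun z => κ z.2) (m := fun h => |κ h|)
        (hκ.measurable.comp measurable_snd)
        (hκ.integrable_of_hasCompactSupport hc).abs hκ.abs.measurable fun z => le_rfl
  rw [aux κ hκ hc u f hu hf, aux (fun h => κ (-h)) (hκ.comp continuous_neg)
    (hc.comp_homeomorph (Homeomorph.neg _)) f u hf hu,
    ← integral_neg_eq_self (fun h => ∫ p, κ h * (u p * f (p - cover T h)))]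
  refine integral_congr_ae (Eventually.of_forall fun h => ?_)
  simp only [integral_const_mul]
  congr 1
  rw [← integral_sub_right_eq_self (fun p => u p * f (p - cover T (-h))) (cover T h)]
  refine integral_congr_ae (Eventually.of_forall fun p => ?_)
  simp only [cover_neg, sub_neg_eq_add, sub_add_cancel]
  ring

end Mollification

/-! ### Approximate identities and the Friedrichs commutator -/

section Friedrichs

/-- Smooth, even, nonnegative kernels of mass one supported in the ball of radius `ε`. The scale
invariant quantity `∫ ‖h‖ |∂_i κ(h)| dh` is bounded by `M`. -/
structure IsMollifier (κ : ℝ × ℝ → ℝ) (M ε : ℝ) : Prop where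
  smooth : ContDiff ℝ ∞ κ
  compact : HasCompactSupport κ
  tsupport_subset : tsupport κ ⊆ Metric.closedBall 0 ε
  even : ∀ h, κ (-h) = κ h
  nonneg : ∀ h, 0 ≤ κ h
  integral_eq : ∫ h, κ h = 1
  moment_le : ∀ i, ∫ h, ‖h‖ * |kernelDeriv i κ h| ≤ M

/-- Rescaling a fixed bump function gives mollifiers of any radius with the same `M`. -/
theorem exists_isMollifier : ∃ M : ℝ, 0 ≤ M ∧ ∀ ε > 0, ∃ κ, IsMollifier κ M ε := by
  let b : ContDiffBump (0 : ℝ × ℝ) := ⟨1 / 2, 1, by norm_num, by norm_num⟩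
  set β : ℝ × ℝ → ℝ := b.normed volume with hβ
  have hβs : ContDiff ℝ ∞ β := b.contDiff_normed
  have hβc : HasCompactSupport β := b.hasCompactSupport_normed
  set m : Fin 2 → ℝ := fun i => ∫ h, ‖h‖ * |kernelDeriv i β h| with hm
  have hm0 : ∀ i, 0 ≤ m i := fun i =>
    integral_nonneg fun h => mul_nonneg (norm_nonneg _) (abs_nonneg _)
  refine ⟨m 0 + m 1, add_nonneg (hm0 0) (hm0 1), fun ε hε => ?_⟩
  have hε' : ε⁻¹ ≠ 0 := (inv_pos.2 hε).ne'
  set κ : ℝ × ℝ → ℝ := fun h => (ε ^ 2)⁻¹ * β (ε⁻¹ • h) with hκ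
  have hdim : Module.finrank ℝ (ℝ × ℝ) = 2 := by simp
  have hscale : ∀ F : ℝ × ℝ → ℝ, ∫ h, F (ε⁻¹ • h) = ε ^ 2 * ∫ h, F h := by
    intro F
    rw [Measure.integral_comp_inv_smul, hdim, abs_of_pos (pow_pos hε 2), smul_eq_mul]
  have hder : ∀ i h, kernelDeriv i κ h = (ε ^ 2)⁻¹ * (ε⁻¹ * kernelDeriv i β (ε⁻¹ • h)) := by
    intro i h
    have h1 : HasFDerivAt (fun h : ℝ × ℝ => β (ε⁻¹ • h))
        ((fderiv ℝ β (ε⁻¹ • h)).comp (ε⁻¹ • ContinuousLinearMap.id ℝ _)) h :=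
      ((hβs.differentiable (by simp)).differentiableAt.hasFDerivAt).comp h
        ((hasFDerivAt_id h).const_smul ε⁻¹)
    have h2 := h1.const_mul ((ε ^ 2)⁻¹)
    simp [kernelDeriv, hκ, h2.fderiv]
  have hsupp : Function.support κ ⊆ Metric.closedBall 0 ε := by
    intro h hh
    have h1 : β (ε⁻¹ • h) ≠ 0 := right_ne_zero_of_mul hh
    have h2 : ε⁻¹ • h ∈ Function.support β := h1
    rw [hβ, b.support_normed_eq, mem_ball_zero_iff, norm_smul, norm_inv, Real.norm_eq_abs,
      abs_of_pos hε] at h2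
    have h3 : ε⁻¹ * ‖h‖ < 1 := h2
    rw [mem_closedBall_zero_iff]
    rw [inv_mul_lt_iff₀ hε, mul_one] at h3
    exact h3.le
  refine ⟨κ, ⟨contDiff_const.mul (hβs.comp (contDiff_const_smul _)), ?_, ?_, ?_, ?_, ?_, ?_⟩⟩
  · exact HasCompactSupport.of_support_subset_isCompact (isCompact_closedBall 0 ε) hsupp
  · exact closure_minimal hsupp Metric.isClosed_closedBall
  · intro h
    simp only [hκ, smul_neg, hβ, b.normed_neg]
  · exact fun h => mul_nonneg (by positivity) (b.nonneg_normed _)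
  · simp only [hκ]
    rw [integral_const_mul, hscale, hβ, b.integral_normed]
    field_simp
  · intro i
    have h1 : ∀ h, ‖h‖ * |kernelDeriv i κ h| =
        (ε ^ 2)⁻¹ * (‖ε⁻¹ • h‖ * |kernelDeriv i β (ε⁻¹ • h)|) := by
      intro h
      rw [hder, abs_mul, abs_mul, norm_smul, norm_inv, Real.norm_eq_abs, abs_of_pos hε,
        abs_of_pos (inv_pos.2 hε), abs_of_pos (inv_pos.2 (pow_pos hε 2))]
      ring
    simp only [h1]
    rw [integral_const_mul, hscale (fun h => ‖h‖ * |kernelDeriv i β h|)]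
    have h2 : (ε ^ 2)⁻¹ * (ε ^ 2 * m i) = m i := by field_simp
    have h3 : m i ≤ m 0 + m 1 := by
      fin_cases i
      · exact le_add_of_nonneg_right (hm0 1)
      · exact le_add_of_nonneg_left (hm0 0)
    exact h2.le.trans h3

variable {T : ℝ}

/-- Smooth functions with compact support are Lipschitz along the translations. -/
theorem exists_abs_sub_translate_le {a : Cyl T → ℝ} (ha : SmoothOn a univ)
    (hc : HasCompactSupport a) :
    ∃ L : ℝ, 0 ≤ L ∧ ∀ p h, |a p - a (p - cover T h)| ≤ L * ‖h‖ := by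
  have hb : ∀ i, ∃ C, ∀ p, ‖pderiv i a p‖ ≤ C := fun i =>
    (hasCompactSupport_pderiv hc i).exists_bound_of_continuous
      (ha.pderiv isOpen_univ i).continuous
  choose C hC using hb
  have hC0 : ∀ i, 0 ≤ C i := fun i => (norm_nonneg _).trans (hC i 0)
  have hs := smoothOn_univ_iff.1 ha
  have hd : ∀ q, DifferentiableAt ℝ (a ∘ cover T) q := fun q =>
    (hs.differentiable (by simp)).differentiableAt
  have hbound : ∀ q, ‖fderiv ℝ (a ∘ cover T) q‖ ≤ C 0 + C 1 := by
    intro q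
    refine ContinuousLinearMap.opNorm_le_bound _ (add_nonneg (hC0 0) (hC0 1)) fun h => ?_
    have hh : h = h.1 • dir 0 + h.2 • dir 1 := by
      ext <;> simp [dir]
    have h0 := hC 0 (cover T q)
    have h1 := hC 1 (cover T q)
    rw [pderiv_cover, (hd q).lineDeriv_eq_fderiv] at h0 h1
    conv_lhs => rw [hh]
    rw [map_add, map_smul, map_smul]
    refine (norm_add_le _ _).trans ?_
    rw [norm_smul, norm_smul, add_mul]
    refine add_le_add ?_ ?_
    · rw [mul_comm]
      exact mul_le_mul h0 (norm_fst_le h) (norm_nonneg _) (hC0 0)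
    · rw [mul_comm]
      exact mul_le_mul h1 (norm_snd_le h) (norm_nonneg _) (hC0 1)
  refine ⟨C 0 + C 1, add_nonneg (hC0 0) (hC0 1), fun p h => ?_⟩
  obtain ⟨q, rfl⟩ := (isOpenQuotientMap_cover T).surjective p
  have := convex_univ.norm_image_sub_le_of_norm_fderiv_le (𝕜 := ℝ) (f := a ∘ cover T)
    (fun q _ => hd q) (fun q _ => hbound q) (mem_univ (q - h)) (mem_univ q)
  simpa [cover_sub] using this

variable [Fact (0 < T)] {κ : ℝ × ℝ → ℝ} {M ε : ℝ}

/-- `J v` is as close to `v` in `L²` as the small translates of `v` are. -/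
theorem IsMollifier.integral_sq_mollify_sub_le (hκ : IsMollifier κ M ε) {v : Cyl T → ℝ}
    (hv : IsCompactL2 v) {D : ℝ}
    (hD : ∀ h : ℝ × ℝ, ‖h‖ ≤ ε → ∫ p, (v (p - cover T h) - v p) ^ 2 ≤ D) :
    ∫ p, (mollify κ v p - v p) ^ 2 ≤ D := by
  have hg : IsCompactL2 fun p => mollify κ v p - v p :=
    (hv.mollify hκ.smooth hκ.compact).sub hv
  have hκi : Integrable κ := hκ.smooth.continuous.integrable_of_hasCompactSupport hκ.compact
  have hpt : ∀ p, mollify κ v p - v p = ∫ h, κ h * (v (p - cover T h) - v p) := by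
    intro p
    have h1 := integrable_mollify_integrand hκ.smooth.continuous hκ.compact hv.integrable p
    have h2 : ∫ h, κ h * v p = v p := by rw [integral_mul_const, hκ.integral_eq, one_mul]
    calc mollify κ v p - v p = ∫ h, (κ h * v (p - cover T h) - κ h * v p) := by
          rw [integral_sub h1 (hκi.mul_const _), h2, mollify]
      _ = _ := by simp only [mul_sub]
  have key := abs_integral_kernel_increment_le hg hv (k := fun z => κ z.2) (m := κ)
    (hκ.smooth.continuous.measurable.comp measurable_snd) hκi hκ.smooth.continuous.measurable
    (fun z => (abs_of_nonneg (hκ.nonneg _)).le) (D := D)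
    (fun h hh => hD h (mem_closedBall_zero_iff.1 (hκ.tsupport_subset (subset_tsupport _ hh))))
    one_pos
  simp only [← hpt, ← pow_two] at key
  rw [hκ.integral_eq, abs_of_nonneg (integral_nonneg fun p => sq_nonneg _)] at key
  linarith

/-- Convolution with a mollifier is almost the identity in the weak sense. -/
theorem IsMollifier.abs_integral_mul_mollify_sub_le (hκ : IsMollifier κ M ε) {u f : Cyl T → ℝ}
    (hu : IsCompactL2 u) (hf : IsCompactL2 f) {D : ℝ}
    (hD : ∀ h : ℝ × ℝ, ‖h‖ ≤ ε → ∫ p, (u (p - cover T h) - u p) ^ 2 ≤ D) {t : ℝ} (ht : 0 < t) :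
    |(∫ p, u p * mollify κ f p) - ∫ p, u p * f p| ≤ (t * (∫ p, f p ^ 2) + D / t) / 2 := by
  have hJ := hu.mollify hκ.smooth hκ.compact
  have h1 := hκ.integral_sq_mollify_sub_le hu hD
  have h2 : (∫ p, u p * mollify κ f p) - ∫ p, u p * f p =
      ∫ p, f p * (mollify κ u p - u p) := by
    rw [integral_mul_mollify hκ.smooth.continuous hκ.compact hu hf]
    simp only [hκ.even]
    rw [← integral_sub (hf.integrable_mul hJ) (hu.integrable_mul hf)]
    refine integral_congr_ae (Eventually.of_forall fun p => ?_)
    simp only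
    ring
  have hg := hJ.sub hu
  rw [h2, ← Real.norm_eq_abs]
  have hI : Integrable fun p => (t * f p ^ 2 + (mollify κ u p - u p) ^ 2 / t) / 2 :=
    ((hf.sq.const_mul t).add (hg.sq.div_const t)).div_const 2
  refine (norm_integral_le_of_norm_le hI (Eventually.of_forall fun p => ?_)).trans ?_
  · set x := f p
    set y := mollify κ u p - u p
    have e1 : t * x ^ 2 + y ^ 2 / t = ((t * x) ^ 2 + y ^ 2) / t := by field_simp
    have e2 : (t * x) ^ 2 + y ^ 2 = (t * |x|) ^ 2 + |y| ^ 2 := by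
      rw [mul_pow, mul_pow, sq_abs, sq_abs]
    rw [Real.norm_eq_abs, e1, div_div, le_div_iff₀ (by positivity), abs_mul]
    nlinarith [sq_nonneg (t * |x| - |y|)]
  · rw [integral_div, integral_add (hf.sq.const_mul t) (hg.sq.div_const t), integral_const_mul,
      integral_div]
    have := div_le_div_of_nonneg_right h1 ht.le
    linarith

/-- The Friedrichs commutator estimate. Formally the left-hand side is `∫ v [D, J] f` for the
operator `D f = ∂_i (a f)` and the convolution `J` with `κ`. After moving all operators to `v`, the
kernel becomes `κ(h) ∂_i a(p - h) + ∂_i κ(h) (a(p) - a(p - h))`. It is dominated by an integrable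
function of `h` with integral at most `A + L M` and has vanishing integral in `h`; hence it only
sees the increments of `v`. -/
theorem IsMollifier.abs_commutator_le (hκ : IsMollifier κ M ε) {a v f : Cyl T → ℝ}
    (ha : SmoothOn a univ) (i : Fin 2) {A L : ℝ} (hA : ∀ p, |pderiv i a p| ≤ A) (hL0 : 0 ≤ L)
    (hL : ∀ p h, |a p - a (p - cover T h)| ≤ L * ‖h‖) (hv : IsCompactL2 v) (hf : IsCompactL2 f)
    {D : ℝ} (hD : ∀ h : ℝ × ℝ, ‖h‖ ≤ ε → ∫ p, (v (p - cover T h) - v p) ^ 2 ≤ D)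
    {t : ℝ} (ht : 0 < t) (hD0 : 0 ≤ D) :
    |(∫ p, v p * (pderiv i a p * mollify κ f p + a p * mollify (kernelDeriv i κ) f p)) +
        ∫ p, a p * mollify (kernelDeriv i κ) v p * f p| ≤
      (A + L * M) * ((t * (∫ p, f p ^ 2) + D / t) / 2) := by
  have hκc := hκ.smooth.continuous
  have hκi : Integrable κ := hκc.integrable_of_hasCompactSupport hκ.compact
  have hd := continuous_kernelDeriv hκ.smooth i
  have hdc := hasCompactSupport_kernelDeriv hκ.compact i
  have hac := ha.continuous
  have hda : Continuous (pderiv i a) := (ha.pderiv isOpen_univ i).continuous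
  have hA0 : 0 ≤ A := (abs_nonneg _).trans (hA 0)
  set k : Cyl T × (ℝ × ℝ) → ℝ := fun z => κ z.2 * pderiv i a (z.1 - cover T z.2) +
    kernelDeriv i κ z.2 * (a z.1 - a (z.1 - cover T z.2)) with hk
  set m : ℝ × ℝ → ℝ := fun h => A * κ h + L * (‖h‖ * |kernelDeriv i κ h|) with hm
  have hsub : Continuous fun z : Cyl T × (ℝ × ℝ) => z.1 - cover T z.2 :=
    continuous_fst.sub ((continuous_cover T).comp continuous_snd)
  have hkm : Continuous k :=
    ((hκc.comp continuous_snd).mul (hda.comp hsub)).add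
      ((hd.comp continuous_snd).mul ((hac.comp continuous_fst).sub (hac.comp hsub)))
  have hmi2 : Integrable fun h : ℝ × ℝ => ‖h‖ * |kernelDeriv i κ h| :=
    (continuous_norm.mul hd.abs).integrable_of_hasCompactSupport
      (HasCompactSupport.mul_left hdc.norm)
  have hmi : Integrable m := (hκi.const_mul A).add (hmi2.const_mul L)
  have hmc : Continuous m :=
    (continuous_const.mul hκc).add (continuous_const.mul (continuous_norm.mul hd.abs))
  have hkle : ∀ z, |k z| ≤ m z.2 := by
    intro z
    refine (abs_add_le _ _).trans (add_le_add ?_ ?_)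
    · rw [abs_mul, abs_of_nonneg (hκ.nonneg _), mul_comm]
      exact mul_le_mul_of_nonneg_right (hA _) (hκ.nonneg _)
    · rw [abs_mul, mul_comm, ← mul_assoc]
      exact mul_le_mul_of_nonneg_right (hL _ _) (abs_nonneg _)
  have hmD : ∀ h, m h ≠ 0 → ∫ p, (v (p - cover T h) - v p) ^ 2 ≤ D := by
    intro h hh
    refine hD h (mem_closedBall_zero_iff.1 (hκ.tsupport_subset ?_))
    by_contra hnot
    refine hh ?_
    have h1 : κ h = 0 := image_eq_zero_of_notMem_tsupport hnot
    have h2 : kernelDeriv i κ h = 0 := by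
      rw [kernelDeriv, fderiv_of_notMem_tsupport ℝ hnot]; rfl
    simp [hm, h1, h2]
  have hkz : ∀ p, ∫ h, k (p, h) = 0 := by
    intro p
    have e1 : ∫ h, κ h * pderiv i a (p - cover T h) =
        ∫ h, kernelDeriv i κ h * a (p - cover T h) :=
      congrFun (mollify_pderiv hκ.smooth hκ.compact ha i) p
    have e2 : ∫ h, kernelDeriv i κ h = 0 := by
      have := congrFun (mollify_pderiv (T := T) hκ.smooth hκ.compact
        (f := fun _ => 1) contDiffOn_const i) p
      simpa [mollify, pderiv] using this.symm
    have hc1 : Continuous fun h : ℝ × ℝ => p - cover T h :=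
      continuous_const.sub (continuous_cover T)
    have i1 : Integrable fun h => κ h * pderiv i a (p - cover T h) :=
      (hκc.mul (hda.comp hc1)).integrable_of_hasCompactSupport hκ.compact.mul_right
    have i2 : Integrable fun h => kernelDeriv i κ h * a (p - cover T h) :=
      (hd.mul (hac.comp hc1)).integrable_of_hasCompactSupport hdc.mul_right
    have i3 : Integrable fun h => kernelDeriv i κ h * a p :=
      (hd.integrable_of_hasCompactSupport hdc).mul_const _
    have i4 : Integrable fun h =>
        kernelDeriv i κ h * a p - kernelDeriv i κ h * a (p - cover T h) := i3.sub i2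
    simp only [hk, mul_sub]
    rw [integral_add i1 i4, integral_sub i3 i2, e1, integral_mul_const, e2]
    ring
  have hva := hv.mul_continuous hac
  have hvda := hv.mul_continuous hda
  have hJf := hf.mollify hκ.smooth hκ.compact
  -- the same conclusions for the kernel `∂_i κ`, which is smooth as well
  have hds : ContDiff ℝ ∞ (kernelDeriv i κ) :=
    (hκ.smooth.fderiv_right (m := ∞) (by simp)).clm_apply contDiff_const
  have hJf' := hf.mollify hds hdc
  have hJv' := hv.mollify hds hdc
  have s1 : ∫ p, v p * (pderiv i a p * mollify κ f p + a p * mollify (kernelDeriv i κ) f p) =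
      (∫ p, f p * mollify κ (fun p => v p * pderiv i a p) p) -
        ∫ p, f p * mollify (kernelDeriv i κ) (fun p => v p * a p) p := by
    have e1 := integral_mul_mollify hκc hκ.compact hvda hf
    have e2 := integral_mul_mollify hd hdc hva hf
    simp only [hκ.even] at e1
    have e3 : ∀ u : Cyl T → ℝ, ∀ p, mollify (fun h => kernelDeriv i κ (-h)) u p =
        -mollify (kernelDeriv i κ) u p := by
      intro u p
      simp only [mollify, kernelDeriv_neg hκ.smooth hκ.even, neg_mul, integral_neg]
    simp only [e3, mul_neg, integral_neg] at e2
    rw [← e1, sub_eq_add_neg, ← e2, ← integral_add (hvda.integrable_mul hJf)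
      (hva.integrable_mul hJf')]
    refine integral_congr_ae (Eventually.of_forall fun p => ?_)
    simp only
    ring
  have s2 : (∫ p, v p * (pderiv i a p * mollify κ f p + a p * mollify (kernelDeriv i κ) f p)) +
        ∫ p, a p * mollify (kernelDeriv i κ) v p * f p =
      ∫ p, f p * ∫ h, k (p, h) * (v (p - cover T h) - v p) := by
    have hJvda := hvda.mollify hκ.smooth hκ.compact
    have hJva := hva.mollify hds hdc
    have i4 : Integrable fun p => a p * mollify (kernelDeriv i κ) v p * f p :=
      ((hJv'.mul_continuous hac).integrable_mul hf).congr
        (Eventually.of_forall fun p => by simp only; ring)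
    have i5 : Integrable fun p => f p * mollify κ (fun p => v p * pderiv i a p) p -
        f p * mollify (kernelDeriv i κ) (fun p => v p * a p) p :=
      (hf.integrable_mul hJvda).sub (hf.integrable_mul hJva)
    rw [s1, ← integral_sub (hf.integrable_mul hJvda) (hf.integrable_mul hJva),
      ← integral_add i5 i4]
    refine integral_congr_ae (Eventually.of_forall fun p => ?_)
    simp only
    have j1 := integrable_mollify_integrand hκc hκ.compact hvda.integrable p
    have j2 := integrable_mollify_integrand hd hdc hva.integrable p
    have j3 := integrable_mollify_integrand hd hdc hv.integrable p
    have e4 : ∫ h, k (p, h) * v (p - cover T h) =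
        mollify κ (fun p => v p * pderiv i a p) p -
          mollify (kernelDeriv i κ) (fun p => v p * a p) p +
          a p * mollify (kernelDeriv i κ) v p := by
      have j12 : Integrable fun h => κ h * (v (p - cover T h) * pderiv i a (p - cover T h)) -
          kernelDeriv i κ h * (v (p - cover T h) * a (p - cover T h)) := j1.sub j2
      simp only [mollify]
      rw [← integral_const_mul, ← integral_sub j1 j2, ← integral_add j12 (j3.const_mul _)]
      refine integral_congr_ae (Eventually.of_forall fun h => ?_)
      simp only [hk]
      ring
    have j4 : Integrable fun h => k (p, h) * v (p - cover T h) := by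
      refine ((j1.sub j2).add (j3.const_mul (a p))).congr (Eventually.of_forall fun h => ?_)
      simp only [hk, Pi.add_apply, Pi.sub_apply]
      ring
    have j5 : Integrable fun h => k (p, h) :=
      hmi.mono' (hkm.comp (Continuous.prodMk_right p)).aestronglyMeasurable
        (Eventually.of_forall fun h => hkle (p, h))
    have e5 : ∫ h, k (p, h) * (v (p - cover T h) - v p) = ∫ h, k (p, h) * v (p - cover T h) := by
      simp only [mul_sub]
      rw [integral_sub j4 (j5.mul_const _), integral_mul_const, hkz, zero_mul, sub_zero]
    rw [e5, e4]
    ring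
  rw [s2]
  refine (abs_integral_kernel_increment_le hf hv hkm.measurable hmi hmc.measurable hkle hmD
    ht).trans ?_
  have hmle : ∫ h, m h ≤ A + L * M := by
    simp only [hm]
    rw [integral_add (hκi.const_mul A) (hmi2.const_mul L), integral_const_mul, integral_const_mul,
      hκ.integral_eq, mul_one]
    linarith [mul_le_mul_of_nonneg_left (hκ.moment_le i) hL0]
  refine mul_le_mul_of_nonneg_right hmle ?_
  have : 0 ≤ ∫ p, f p ^ 2 := integral_nonneg fun p => sq_nonneg (f p)
  positivity

end Friedrichs

/-! ### The Agmon inequality for weak solutions -/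

section Agmon

variable {T : ℝ}

theorem norm_cover_le (h : ℝ × ℝ) : ‖cover T h‖ ≤ ‖h‖ :=
  max_le (norm_fst_le h)
    ((QuotientAddGroup.norm_mk_le_norm (S := AddSubgroup.zmultiples T)).trans (norm_snd_le h))

theorem exists_tsupport_mollify_subset {K O : Set (Cyl T)} (hK : IsCompact K) (hO : IsOpen O)
    (hKO : K ⊆ O) : ∃ ε₀ > 0, ∀ ε ≤ ε₀, ∀ κ M, IsMollifier κ M ε → ∀ f : Cyl T → ℝ,
      tsupport f ⊆ K → tsupport (mollify κ f) ⊆ O := by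
  obtain ⟨δ, hδ, hδO⟩ := hK.exists_cthickening_subset_open hO hKO
  refine ⟨δ, hδ, fun ε hε κ M hκ f hf => ?_⟩
  have hfc : HasCompactSupport f := HasCompactSupport.of_support_subset_isCompact hK
    ((subset_tsupport f).trans hf)
  refine (tsupport_mollify_subset hκ.compact hfc).trans ?_
  rintro _ ⟨⟨p, h⟩, ⟨hp, hh⟩, rfl⟩
  refine hδO (Metric.mem_cthickening_of_dist_le _ p δ K (hf hp) ?_)
  rw [dist_eq_norm]
  simp only [add_sub_cancel_left]
  exact (norm_cover_le h).trans ((mem_closedBall_zero_iff.1 (hκ.tsupport_subset hh)).trans hε)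

variable [Fact (0 < T)]

/-- Together with `IsCompactL2.abs_integral_sq_sub_le`: quadratic expressions with bounded
coefficients are continuous in `L²`. -/
theorem IsCompactL2.abs_integral_mul_sub_le {v z g : Cyl T → ℝ} (hv : IsCompactL2 v)
    (hz : IsCompactL2 z) (hg : Continuous g) {G : ℝ} (hG : ∀ p, |g p| ≤ G) {d : ℝ} (hd : 0 < d)
    (hvz : ∫ p, (z p - v p) ^ 2 ≤ d ^ 2) :
    |(∫ p, v p * g p * z p) - ∫ p, v p * g p * v p| ≤ G * (d * (∫ p, v p ^ 2) + d) := by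
  have hG0 : 0 ≤ G := (abs_nonneg _).trans (hG 0)
  have hdz := hz.sub hv
  have hvg := hv.mul_continuous hg
  have hI : Integrable fun p => G * (d * v p ^ 2 + (z p - v p) ^ 2 / d) :=
    ((hv.sq.const_mul d).add (hdz.sq.div_const d)).const_mul G
  rw [← integral_sub (hvg.integrable_mul hz) (hvg.integrable_mul hv), ← Real.norm_eq_abs]
  refine (norm_integral_le_of_norm_le hI (Eventually.of_forall fun p => ?_)).trans ?_
  · rw [← mul_sub, Real.norm_eq_abs, abs_mul, abs_mul, mul_comm |v p|, mul_assoc]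
    refine mul_le_mul (hG p) ?_ (by positivity) hG0
    set x := v p
    set y := z p - x
    have e1 : d * x ^ 2 + y ^ 2 / d = ((d * x) ^ 2 + y ^ 2) / d := by field_simp
    have e2 : (d * x) ^ 2 + y ^ 2 = (d * |x|) ^ 2 + |y| ^ 2 := by
      rw [mul_pow, mul_pow, sq_abs, sq_abs]
    rw [e1, le_div_iff₀ hd]
    nlinarith [sq_nonneg (d * |x| - |y|), mul_nonneg (mul_nonneg (abs_nonneg x) (abs_nonneg y)) hd.le]
  · rw [integral_const_mul, integral_add (hv.sq.const_mul d) (hdz.sq.div_const d),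
      integral_const_mul, integral_div]
    refine mul_le_mul_of_nonneg_left ?_ hG0
    have h1 : (∫ p, (z p - v p) ^ 2) / d ≤ d := by
      rw [div_le_iff₀ hd]; linarith
    linarith

theorem IsCompactL2.abs_integral_sq_sub_le {v z g : Cyl T → ℝ} (hv : IsCompactL2 v)
    (hz : IsCompactL2 z) (hg : Continuous g) {G : ℝ} (hG : ∀ p, |g p| ≤ G) {d : ℝ} (hd : 0 < d)
    (hvz : ∫ p, (z p - v p) ^ 2 ≤ d ^ 2) :
    |(∫ p, z p * g p * z p) - ∫ p, v p * g p * v p| ≤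
      G * d ^ 2 + 2 * (G * (d * (∫ p, v p ^ 2) + d)) := by
  have hG0 : 0 ≤ G := (abs_nonneg _).trans (hG 0)
  have hdz := hz.sub hv
  have hvg := hv.mul_continuous hg
  have h1 := hv.abs_integral_mul_sub_le hz hg hG hd hvz
  have h2 : (∫ p, z p * g p * z p) - ∫ p, v p * g p * v p =
      (∫ p, (z p - v p) * g p * (z p - v p)) +
        2 * ((∫ p, v p * g p * z p) - ∫ p, v p * g p * v p) := by
    have i1 := (hdz.mul_continuous hg).integrable_mul hdz
    have i2 := (hz.mul_continuous hg).integrable_mul hz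
    have i3 := hvg.integrable_mul hv
    have i4 := hvg.integrable_mul hz
    have i5 : Integrable fun p => 2 * (v p * g p * z p - v p * g p * v p) :=
      (i4.sub i3).const_mul 2
    rw [← integral_sub i4 i3, ← integral_const_mul, ← integral_add i1 i5, ← integral_sub i2 i3]
    refine integral_congr_ae (Eventually.of_forall fun p => ?_)
    simp only
    ring
  have h3 : |∫ p, (z p - v p) * g p * (z p - v p)| ≤ G * d ^ 2 := by
    rw [← Real.norm_eq_abs]
    refine (norm_integral_le_of_norm_le (hdz.sq.const_mul G)
      (Eventually.of_forall fun p => ?_)).trans ?_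
    · rw [Real.norm_eq_abs, abs_mul, abs_mul, mul_comm |z p - v p|, mul_assoc, abs_mul_abs_self,
        ← pow_two]
      exact mul_le_mul_of_nonneg_right (hG p) (sq_nonneg _)
    · rw [integral_const_mul]
      exact mul_le_mul_of_nonneg_left hvz hG0
  rw [h2]
  refine (abs_add_le _ _).trans (add_le_add h3 ?_)
  rw [abs_mul, abs_of_pos two_pos]
  linarith

variable {a : Fin 2 → Cyl T → ℝ} {w q χ v : Cyl T → ℝ}

/-- The energy identity for a single mollification `z = J v` of a weak solution `v`, tested with
`J (χ² z)`. The commutator errors, of size `d`, are absorbed in the energy of `χ z`. -/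
theorem energy_le_of_isMollifier {κ : ℝ × ℝ → ℝ} {M ε : ℝ} (hκ : IsMollifier κ M ε)
    (ha : ∀ i, SmoothOn (a i) univ) (ha0 : ∀ i p, 0 ≤ a i p) (hw : Continuous w)
    (hχ : SmoothOn χ univ) (hχc : HasCompactSupport χ) (hv : IsCompactL2 v)
    {A L C : ℝ} (hA : ∀ i p, |pderiv i (a i) p| ≤ A) (hL0 : 0 ≤ L)
    (hL : ∀ i p h, |a i p - a i (p - cover T h)| ≤ L * ‖h‖)
    (hM : 0 ≤ M)
    (hC1 : ∀ i, ∀ p ∈ tsupport χ, 2 * χ p ^ 2 ≤ C * a i p)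
    (hC2 : ∀ i p, 2 * (χ p * pderiv i χ p) ^ 2 ≤ C) (hC3 : ∀ p, χ p ^ 4 ≤ C)
    (hweak : ∫ p, v p * ((∑ i, pderiv i (fun p => a i p * pderiv i
        (mollify κ (fun p => χ p ^ 2 * mollify κ v p)) p) p) -
          w p * mollify κ (fun p => χ p ^ 2 * mollify κ v p) p) = 0)
    {d : ℝ} (hd : 0 < d)
    (hDv : ∀ h : ℝ × ℝ, ‖h‖ ≤ ε → ∫ p, (v (p - cover T h) - v p) ^ 2 ≤ d ^ 2)
    (hDw : ∀ h : ℝ × ℝ, ‖h‖ ≤ ε →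
      ∫ p, (v (p - cover T h) * w (p - cover T h) - v p * w p) ^ 2 ≤ d ^ 2) :
    (∑ i, ∫ p, a i p * pderiv i (fun p => χ p * mollify κ v p) p ^ 2) -
        (∑ i, ∫ p, mollify κ v p * (a i p * pderiv i χ p ^ 2) * mollify κ v p) +
        ∫ p, v p * (w p * χ p ^ 2) * mollify κ v p ≤
      (A + L * M + 1) * d * (C * (∑ i, ∫ p, a i p * pderiv i (fun p => χ p * mollify κ v p) p ^ 2) +
        3 * C * (∫ p, mollify κ v p ^ 2) + 3) := by
  have hA0 : 0 ≤ A := (abs_nonneg _).trans (hA 0 0)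
  have hC0 : 0 ≤ C := (pow_nonneg (sq_nonneg (χ 0)) 2).trans
    (le_of_eq_of_le (by ring) (hC3 0))
  set z := mollify κ v with hz
  have hzs : SmoothOn z univ := smoothOn_mollify hκ.smooth hκ.compact hv.integrable
  have hzL := hv.mollify hκ.smooth hκ.compact
  have hzc : HasCompactSupport z := hzL.compact
  have hχ2 : SmoothOn (fun p => χ p ^ 2) univ := by
    simp only [pow_two]; exact hχ.mul hχ
  set y : Cyl T → ℝ := fun p => χ p * z p with hy
  have hys : SmoothOn y univ := hχ.mul hzs
  have hyc : HasCompactSupport y := hχc.mul_right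
  set ψ : Cyl T → ℝ := fun p => χ p ^ 2 * z p with hψ
  have hψs : SmoothOn ψ univ := hχ2.mul hzs
  have hψc : HasCompactSupport ψ := hzc.mul_left
  have hψL : IsCompactL2 ψ := .of_continuous hψs.continuous hψc
  have hψd : ∀ i, SmoothOn (pderiv i ψ) univ := fun i => hψs.pderiv isOpen_univ i
  have hψdc : ∀ i, HasCompactSupport (pderiv i ψ) := fun i => hasCompactSupport_pderiv hψc i
  have hψdL : ∀ i, IsCompactL2 (pderiv i ψ) := fun i =>
    .of_continuous (hψd i).continuous (hψdc i)
  have hds : ∀ i, ContDiff ℝ ∞ (kernelDeriv i κ) := fun i =>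
    (hκ.smooth.fderiv_right (m := ∞) (by simp)).clm_apply contDiff_const
  have hdc := fun i => hasCompactSupport_kernelDeriv hκ.compact i
  -- the test function `J ψ` turns the derivatives into convolutions
  have hφ : ∀ i, pderiv i (mollify κ ψ) = mollify κ (pderiv i ψ) := fun i => by
    rw [pderiv_mollify hκ.smooth hκ.compact hψL.integrable,
      mollify_pderiv hκ.smooth hκ.compact hψs]
  have hflux : ∀ i p, pderiv i (fun p => a i p * pderiv i (mollify κ ψ) p) p =
      pderiv i (a i) p * mollify κ (pderiv i ψ) p +
        a i p * mollify (kernelDeriv i κ) (pderiv i ψ) p := by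
    intro i p
    rw [hφ, pderiv_mul (ha i) (smoothOn_mollify hκ.smooth hκ.compact (hψdL i).integrable)
      isOpen_univ i (mem_univ p), pderiv_mollify hκ.smooth hκ.compact (hψdL i).integrable]
  have hJψ := hψL.mollify hκ.smooth hκ.compact
  have hCi : ∀ i, Integrable fun p => v p * (pderiv i (a i) p * mollify κ (pderiv i ψ) p +
        a i p * mollify (kernelDeriv i κ) (pderiv i ψ) p) := by
    intro i
    have j1 := (hv.mul_continuous ((ha i).pderiv isOpen_univ i).continuous).integrable_mul
      ((hψdL i).mollify hκ.smooth hκ.compact)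
    have j2 := (hv.mul_continuous (ha i).continuous).integrable_mul
      ((hψdL i).mollify (hds i) (hdc i))
    refine (j1.add j2).congr (Eventually.of_forall fun p => ?_)
    simp only [Pi.add_apply]
    ring
  have hvw := hv.mul_continuous hw
  have hweak' : (∑ i, ∫ p, v p * (pderiv i (a i) p * mollify κ (pderiv i ψ) p +
        a i p * mollify (kernelDeriv i κ) (pderiv i ψ) p)) -
        ∫ p, v p * w p * mollify κ ψ p = 0 := by
    rw [← integral_finsetSum _ fun i _ => hCi i, ← integral_sub
      (integrable_finsetSum _ fun i _ => hCi i) (hvw.integrable_mul hJψ), ← hweak]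
    refine integral_congr_ae (Eventually.of_forall fun p => ?_)
    simp only [hflux, Fin.sum_univ_two]
    ring
  have hcomm : ∀ i, -(∫ p, v p * (pderiv i (a i) p * mollify κ (pderiv i ψ) p +
        a i p * mollify (kernelDeriv i κ) (pderiv i ψ) p)) ≥
      (∫ p, a i p * pderiv i z p * pderiv i ψ p) -
        (A + L * M) * ((d * (∫ p, pderiv i ψ p ^ 2) + d) / 2) := by
    intro i
    have h1 := hκ.abs_commutator_le (ha i) i (hA i) hL0 (hL i) hv (hψdL i) hDv hd (sq_nonneg d)
    rw [← pderiv_mollify hκ.smooth hκ.compact hv.integrable, ← hz] at h1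
    have h2 : d ^ 2 / d = d := by field_simp
    rw [h2] at h1
    linarith [(abs_le.1 h1).2]
  have hmass : (∫ p, v p * w p * mollify κ ψ p) ≥
      (∫ p, v p * (w p * χ p ^ 2) * z p) - (d * (∫ p, ψ p ^ 2) + d) / 2 := by
    have h1 := hκ.abs_integral_mul_mollify_sub_le hvw hψL hDw hd
    have h2 : d ^ 2 / d = d := by field_simp
    have h3 : ∫ p, v p * w p * ψ p = ∫ p, v p * (w p * χ p ^ 2) * z p := by
      refine integral_congr_ae (Eventually.of_forall fun p => ?_)
      simp only [hψ]
      ring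
    rw [h2, h3] at h1
    linarith [(abs_le.1 h1).1]
  have hac := fun i => (ha i).continuous
  have hyd : ∀ i p, pderiv i y p = pderiv i χ p * z p + χ p * pderiv i z p := fun i p =>
    pderiv_mul hχ hzs isOpen_univ i (mem_univ p)
  have hψdy : ∀ i p, pderiv i ψ p = χ p * pderiv i y p + χ p * pderiv i χ p * z p := by
    intro i p
    have h1 : ψ = fun p => χ p * y p := by
      funext p; simp only [hψ, hy]; ring
    rw [h1, pderiv_mul hχ hys isOpen_univ i (mem_univ p)]
    simp only [hy]
    ring
  have hX : ∀ i, Integrable fun p => a i p * pderiv i y p ^ 2 := fun i =>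
    ((hac i).mul ((hys.pderiv isOpen_univ i).continuous.pow 2)).integrable_of_hasCompactSupport
      (by simp only [pow_two]; exact (hasCompactSupport_pderiv hyc i).mul_left.mul_left)
  have hχd := fun i => (hχ.pderiv isOpen_univ i).continuous
  have hquad : ∀ i, ∫ p, a i p * pderiv i z p * pderiv i ψ p =
      (∫ p, a i p * pderiv i y p ^ 2) - ∫ p, z p * (a i p * pderiv i χ p ^ 2) * z p := by
    intro i
    have hcont : Continuous fun p => a i p * pderiv i χ p ^ 2 := (hac i).mul ((hχd i).pow 2)
    rw [← integral_sub (hX i) ((hzL.mul_continuous hcont).integrable_mul hzL)]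
    refine integral_congr_ae (Eventually.of_forall fun p => ?_)
    simp only [hψdy, hyd]
    ring
  have hf2 : ∀ i, ∫ p, pderiv i ψ p ^ 2 ≤
      C * (∫ p, a i p * pderiv i y p ^ 2) + C * ∫ p, z p ^ 2 := by
    intro i
    rw [← integral_const_mul, ← integral_const_mul,
      ← integral_add ((hX i).const_mul C) (hzL.sq.const_mul C)]
    refine integral_mono (hψdL i).sq (((hX i).const_mul C).add (hzL.sq.const_mul C)) fun p => ?_
    have h1 : 2 * χ p ^ 2 * pderiv i y p ^ 2 ≤ C * (a i p * pderiv i y p ^ 2) := by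
      by_cases hp : p ∈ tsupport χ
      · rw [← mul_assoc]
        exact mul_le_mul_of_nonneg_right (hC1 i p hp) (sq_nonneg _)
      · rw [image_eq_zero_of_notMem_tsupport hp]
        have := mul_nonneg hC0 (mul_nonneg (ha0 i p) (sq_nonneg (pderiv i y p)))
        linarith
    have h2 := mul_le_mul_of_nonneg_right (hC2 i p) (sq_nonneg (z p))
    rw [hψdy]
    nlinarith [sq_nonneg (χ p * pderiv i y p - χ p * pderiv i χ p * z p)]
  have hψ2 : ∫ p, ψ p ^ 2 ≤ C * ∫ p, z p ^ 2 := by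
    rw [← integral_const_mul]
    refine integral_mono hψL.sq (hzL.sq.const_mul C) fun p => ?_
    have := mul_le_mul_of_nonneg_right (hC3 p) (sq_nonneg (z p))
    simp only [hψ]
    linarith
  have hN : 0 ≤ ∫ p, z p ^ 2 := integral_nonneg fun p => sq_nonneg (z p)
  have hXn : ∀ i, 0 ≤ ∫ p, a i p * pderiv i y p ^ 2 := fun i =>
    integral_nonneg fun p => mul_nonneg (ha0 i p) (sq_nonneg _)
  have hK : 0 ≤ A + L * M := add_nonneg hA0 (mul_nonneg hL0 hM)
  have e0 := hcomm 0
  have e1 := hcomm 1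
  rw [hquad] at e0 e1
  simp only [Fin.sum_univ_two] at hweak' ⊢
  set X0 := ∫ p, a 0 p * pderiv 0 y p ^ 2
  set X1 := ∫ p, a 1 p * pderiv 1 y p ^ 2
  set N := ∫ p, z p ^ 2
  have g : ∀ i, (A + L * M) * ((d * (∫ p, pderiv i ψ p ^ 2) + d) / 2) ≤
      (A + L * M) * ((d * (C * (∫ p, a i p * pderiv i y p ^ 2) + C * N) + d) / 2) := fun i =>
    mul_le_mul_of_nonneg_left (by linarith [mul_le_mul_of_nonneg_left (hf2 i) hd.le]) hK
  have g0 := g 0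
  have g1 := g 1
  have g2 := mul_le_mul_of_nonneg_left hψ2 hd.le
  have p0 : 0 ≤ d * (C * X0) := mul_nonneg hd.le (mul_nonneg hC0 (hXn 0))
  have p1 : 0 ≤ d * (C * X1) := mul_nonneg hd.le (mul_nonneg hC0 (hXn 1))
  have p2 : 0 ≤ d * (C * N) := mul_nonneg hd.le (mul_nonneg hC0 hN)
  have k0 := mul_nonneg hK p0
  have k1 := mul_nonneg hK p1
  have k2 := mul_nonneg hK p2
  have k3 := mul_nonneg hK hd.le
  linarith

/-- **Agmon inequality.** Let `v ∈ L²` be a weak solution of `∑ ∂_i (a_i ∂_i v) = w v` near the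
support of `χ`. If the energy form dominates the potential `q`, then
`∫ (q + w) χ² v² ≤ ∫ ∑ a_i (∂_i χ)² v²`. No regularity of `v` is assumed. -/
theorem agmon_inequality (ha : ∀ i, SmoothOn (a i) univ) (hac : ∀ i, HasCompactSupport (a i))
    (ha0 : ∀ i p, 0 ≤ a i p) (hw : Continuous w) (hq : Continuous q)
    (hχ : SmoothOn χ univ) (hχc : HasCompactSupport χ) {c : ℝ} (hc : 0 < c)
    (hca : ∀ i, ∀ p ∈ tsupport χ, c ≤ a i p) {O : Set (Cyl T)} (hO : IsOpen O)
    (hχO : tsupport χ ⊆ O) (hv : IsCompactL2 v)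
    (hweak : ∀ φ : Cyl T → ℝ, SmoothOn φ univ → HasCompactSupport φ → tsupport φ ⊆ O →
      ∫ p, v p * ((∑ i, pderiv i (fun p => a i p * pderiv i φ p) p) - w p * φ p) = 0)
    (hform : ∀ f : Cyl T → ℝ, SmoothOn f univ → HasCompactSupport f → tsupport f ⊆ tsupport χ →
      ∫ p, q p * f p ^ 2 ≤ ∑ i, ∫ p, a i p * pderiv i f p ^ 2) :
    ∫ p, v p * (q p * χ p ^ 2 + w p * χ p ^ 2 - ∑ i, a i p * pderiv i χ p ^ 2) * v p ≤ 0 := by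
  obtain ⟨M, hM, hmol⟩ := exists_isMollifier
  -- bounds independent of the mollifier; ellipticity near the support of `χ` enters through `C`
  have hAex : ∀ i, ∃ C, ∀ p, |pderiv i (a i) p| ≤ C := fun i =>
    (hasCompactSupport_pderiv (hac i) i).exists_bound_of_continuous
      ((ha i).pderiv isOpen_univ i).continuous
  choose A' hA' using hAex
  choose L' hL0' hL' using fun i => exists_abs_sub_translate_le (ha i) (hac i)
  have hA0' : ∀ i, 0 ≤ A' i := fun i => (abs_nonneg _).trans (hA' i 0)
  have hle : ∀ (f : Fin 2 → ℝ), (∀ i, 0 ≤ f i) → ∀ i, f i ≤ f 0 + f 1 := by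
    intro f hf i
    fin_cases i
    · exact le_add_of_nonneg_right (hf 1)
    · exact le_add_of_nonneg_left (hf 0)
  obtain ⟨B0, hB0⟩ := hχc.exists_bound_of_continuous hχ.continuous
  choose B1 hB1 using fun i => (hasCompactSupport_pderiv hχc i).exists_bound_of_continuous
    (hχ.pderiv isOpen_univ i).continuous
  have hsq : ∀ {x B : ℝ}, ‖x‖ ≤ B → x ^ 2 ≤ B ^ 2 := fun {x B} h => by
    rw [← sq_abs]; exact pow_le_pow_left₀ (abs_nonneg _) h 2
  set A := A' 0 + A' 1
  set L := L' 0 + L' 1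
  set C := 2 * B0 ^ 2 / c + (2 * (B0 ^ 2 * B1 0 ^ 2) + 2 * (B0 ^ 2 * B1 1 ^ 2)) + (B0 ^ 2) ^ 2
    with hCdef
  have hCp1 : 0 ≤ 2 * B0 ^ 2 / c := by positivity
  have hCp2 : 0 ≤ 2 * (B0 ^ 2 * B1 0 ^ 2) := by positivity
  have hCp3 : 0 ≤ 2 * (B0 ^ 2 * B1 1 ^ 2) := by positivity
  have hCp4 : 0 ≤ (B0 ^ 2) ^ 2 := by positivity
  have hC0 : 0 ≤ C := by linarith
  have hC1 : ∀ i, ∀ p ∈ tsupport χ, 2 * χ p ^ 2 ≤ C * a i p := by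
    intro i p hp
    have h1 : 2 * B0 ^ 2 / c ≤ C := by linarith
    calc 2 * χ p ^ 2 ≤ 2 * B0 ^ 2 := by linarith [hsq (hB0 p)]
      _ = 2 * B0 ^ 2 / c * c := by field_simp
      _ ≤ C * a i p := mul_le_mul h1 (hca i p hp) hc.le hC0
  have hC2 : ∀ i p, 2 * (χ p * pderiv i χ p) ^ 2 ≤ C := by
    intro i p
    have h1 : 2 * (χ p * pderiv i χ p) ^ 2 ≤ 2 * (B0 ^ 2 * B1 i ^ 2) := by
      rw [mul_pow]
      linarith [mul_le_mul (hsq (hB0 p)) (hsq (hB1 i p)) (sq_nonneg _) (sq_nonneg B0)]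
    have h2 : 2 * (B0 ^ 2 * B1 i ^ 2) ≤ 2 * (B0 ^ 2 * B1 0 ^ 2) + 2 * (B0 ^ 2 * B1 1 ^ 2) :=
      hle (fun i => 2 * (B0 ^ 2 * B1 i ^ 2)) (fun i => by positivity) i
    linarith
  have hC3 : ∀ p, χ p ^ 4 ≤ C := by
    intro p
    have h1 : χ p ^ 4 ≤ (B0 ^ 2) ^ 2 := by
      rw [show χ p ^ 4 = (χ p ^ 2) ^ 2 by ring]
      exact pow_le_pow_left₀ (sq_nonneg _) (hsq (hB0 p)) 2
    linarith
  obtain ⟨ε₀, hε₀, hsupp⟩ := exists_tsupport_mollify_subset hχc.isCompact hO hχO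
  have hvw := hv.mul_continuous hw
  -- a sequence of mollifications with errors `d n → 0`
  set d : ℕ → ℝ := fun n => 1 / ((n : ℝ) + 1) with hd
  have hdpos : ∀ n, 0 < d n := fun n => Nat.one_div_pos_of_nat
  have hdlim : Tendsto d atTop (𝓝 0) := tendsto_one_div_add_atTop_nhds_zero_nat
  have hseq : ∀ n, ∃ z : Cyl T → ℝ, IsCompactL2 z ∧ ∫ p, (z p - v p) ^ 2 ≤ d n ^ 2 ∧
      (∃ X, ∫ p, z p * (q p * χ p ^ 2) * z p ≤ X ∧
      X - (∑ i, ∫ p, z p * (a i p * pderiv i χ p ^ 2) * z p) +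
        ∫ p, v p * (w p * χ p ^ 2) * z p ≤
      (A + L * M + 1) * d n * (C * X + 3 * C * (∫ p, z p * 1 * z p) + 3)) := by
    intro n
    obtain ⟨ε₁, hε₁, hD1⟩ := hv.exists_translate_le (pow_pos (hdpos n) 2)
    obtain ⟨ε₂, hε₂, hD2⟩ := hvw.exists_translate_le (pow_pos (hdpos n) 2)
    set ε := min ε₀ (min ε₁ ε₂)
    obtain ⟨κ, hκ⟩ := hmol ε (lt_min hε₀ (lt_min hε₁ hε₂))
    have hDv : ∀ h : ℝ × ℝ, ‖h‖ ≤ ε → ∫ p, (v (p - cover T h) - v p) ^ 2 ≤ d n ^ 2 :=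
      fun h hh => hD1 h (hh.trans ((min_le_right _ _).trans (min_le_left _ _)))
    have hDw : ∀ h : ℝ × ℝ, ‖h‖ ≤ ε →
        ∫ p, (v (p - cover T h) * w (p - cover T h) - v p * w p) ^ 2 ≤ d n ^ 2 :=
      fun h hh => hD2 h (hh.trans ((min_le_right _ _).trans (min_le_right _ _)))
    have hzs : SmoothOn (mollify κ v) univ := smoothOn_mollify hκ.smooth hκ.compact hv.integrable
    have hχz : SmoothOn (fun p => χ p * mollify κ v p) univ := hχ.mul hzs
    have hψ : SmoothOn (fun p => χ p ^ 2 * mollify κ v p) univ := by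
      have : (fun p => χ p ^ 2 * mollify κ v p) = fun p => χ p * (χ p * mollify κ v p) := by
        funext p; ring
      rw [this]
      exact hχ.mul hχz
    have hψsupp : tsupport (fun p => χ p ^ 2 * mollify κ v p) ⊆ tsupport χ := by
      refine closure_mono fun p hp => ?_
      simp only [Function.mem_support] at hp ⊢
      intro h0
      exact hp (by simp [h0])
    have hψc : HasCompactSupport (fun p => χ p ^ 2 * mollify κ v p) :=
      HasCompactSupport.of_support_subset_isCompact hχc.isCompact
        ((subset_tsupport _).trans hψsupp)
    have hweak' := hweak (mollify κ (fun p => χ p ^ 2 * mollify κ v p))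
      (smoothOn_mollify hκ.smooth hκ.compact
        (hψ.continuous.integrable_of_hasCompactSupport hψc))
      (hasCompactSupport_mollify hκ.compact hψc)
      (hsupp ε (min_le_left _ _) κ M hκ _ hψsupp)
    have henergy := energy_le_of_isMollifier hκ ha ha0 hw hχ hχc hv
      (fun i p => (hA' i p).trans (hle A' hA0' i)) (add_nonneg (hL0' 0) (hL0' 1))
      (fun i p h => (hL' i p h).trans
        (mul_le_mul_of_nonneg_right (hle L' hL0' i) (norm_nonneg _)))
      hM hC1 hC2 hC3 hweak' (hdpos n) hDv hDw
    refine ⟨mollify κ v, hv.mollify hκ.smooth hκ.compact, hκ.integral_sq_mollify_sub_le hv hDv,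
      ∑ i, ∫ p, a i p * pderiv i (fun p => χ p * mollify κ v p) p ^ 2, ?_, ?_⟩
    rotate_left
    · have h1 : ∫ p, mollify κ v p * 1 * mollify κ v p = ∫ p, mollify κ v p ^ 2 := by
        simp only [mul_one, pow_two]
      rw [h1]
      exact henergy
    · have h1 := hform _ hχz hχc.mul_right (tsupport_mul_subset_left)
      refine le_of_eq_of_le (integral_congr_ae (Eventually.of_forall fun p => ?_)) h1
      simp only
      ring
  choose z hzL hzv X hqX hX using hseq
  -- convergence of all quadratic expressions
  have hbd : ∀ {g : Cyl T → ℝ}, Continuous g → HasCompactSupport g → ∃ G, ∀ p, |g p| ≤ G :=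
    fun hg hgc => hgc.exists_bound_of_continuous hg
  have hlim1 : ∀ {g : Cyl T → ℝ}, Continuous g → (∃ G, ∀ p, |g p| ≤ G) →
      Tendsto (fun n => ∫ p, z n p * g p * z n p) atTop (𝓝 (∫ p, v p * g p * v p)) := by
    rintro g hg ⟨G, hG⟩
    rw [tendsto_iff_norm_sub_tendsto_zero]
    refine squeeze_zero (fun n => norm_nonneg _)
      (fun n => hv.abs_integral_sq_sub_le (hzL n) hg hG (hdpos n) (hzv n)) ?_
    have := ((hdlim.pow 2).const_mul G).add
      ((((hdlim.mul_const (∫ p, v p ^ 2)).add hdlim).const_mul G).const_mul 2)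
    simpa using this
  have hlim2 : ∀ {g : Cyl T → ℝ}, Continuous g → (∃ G, ∀ p, |g p| ≤ G) →
      Tendsto (fun n => ∫ p, v p * g p * z n p) atTop (𝓝 (∫ p, v p * g p * v p)) := by
    rintro g hg ⟨G, hG⟩
    rw [tendsto_iff_norm_sub_tendsto_zero]
    refine squeeze_zero (fun n => norm_nonneg _)
      (fun n => hv.abs_integral_mul_sub_le (hzL n) hg hG (hdpos n) (hzv n)) ?_
    have := ((hdlim.mul_const (∫ p, v p ^ 2)).add hdlim).const_mul G
    simpa using this
  have hχ2c : HasCompactSupport fun p => χ p ^ 2 := by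
    simp only [pow_two]; exact hχc.mul_left
  have hcq : Continuous fun p => q p * χ p ^ 2 := hq.mul (hχ.continuous.pow 2)
  have hcw : Continuous fun p => w p * χ p ^ 2 := hw.mul (hχ.continuous.pow 2)
  have hcg : ∀ i, Continuous fun p => a i p * pderiv i χ p ^ 2 := fun i =>
    (ha i).continuous.mul ((hχ.pderiv isOpen_univ i).continuous.pow 2)
  have l1 := hlim1 hcq (hbd hcq hχ2c.mul_left)
  have l2 := tendsto_finsetSum Finset.univ fun i _ =>
    hlim1 (hcg i) (hbd (hcg i) (hac i).mul_right)
  have l3 := hlim2 hcw (hbd hcw hχ2c.mul_left)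
  have l4 := hlim1 (g := fun _ => 1) continuous_const ⟨1, fun _ => by simp⟩
  -- for small errors the energy `X n` can be replaced by the potential term
  have hev : ∀ᶠ n in atTop, (1 - (A + L * M + 1) * d n * C) * (∫ p, z n p * (q p * χ p ^ 2) * z n p)
      ≤ (∑ i, ∫ p, z n p * (a i p * pderiv i χ p ^ 2) * z n p) -
        (∫ p, v p * (w p * χ p ^ 2) * z n p) +
        (A + L * M + 1) * d n * (3 * C * (∫ p, z n p * 1 * z n p) + 3) := by
    have h1 : Tendsto (fun n => (A + L * M + 1) * d n * C) atTop (𝓝 0) := by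
      simpa using (hdlim.const_mul (A + L * M + 1)).mul_const C
    filter_upwards [h1.eventually_le_const one_pos] with n hn
    have h2 := mul_le_mul_of_nonneg_left (hqX n) (sub_nonneg.2 hn)
    linarith [hX n]
  have l5 := ((tendsto_const_nhds (x := (1 : ℝ))).sub
    ((hdlim.const_mul (A + L * M + 1)).mul_const C)).mul l1
  have l6 := (l2.sub l3).add ((hdlim.const_mul (A + L * M + 1)).mul
    ((l4.const_mul (3 * C)).add_const 3))
  have hfin := le_of_tendsto_of_tendsto l5 l6 hev
  have i1 := (hv.mul_continuous hcq).integrable_mul hv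
  have i2 := (hv.mul_continuous hcw).integrable_mul hv
  have i3 := fun i => (hv.mul_continuous (hcg i)).integrable_mul hv
  have i12 : Integrable fun p => v p * (q p * χ p ^ 2) * v p + v p * (w p * χ p ^ 2) * v p :=
    i1.add i2
  have hsplit : ∫ p, v p * (q p * χ p ^ 2 + w p * χ p ^ 2 - ∑ i, a i p * pderiv i χ p ^ 2) * v p =
      (∫ p, v p * (q p * χ p ^ 2) * v p) + (∫ p, v p * (w p * χ p ^ 2) * v p) -
        ∑ i, ∫ p, v p * (a i p * pderiv i χ p ^ 2) * v p := by
    rw [← integral_add i1 i2, ← integral_finsetSum _ fun i _ => i3 i,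
      ← integral_sub i12 (integrable_finsetSum _ fun i _ => i3 i)]
    refine integral_congr_ae (Eventually.of_forall fun p => ?_)
    simp only [Fin.sum_univ_two]
    ring
  rw [hsplit]
  simp only [mul_zero, zero_mul, sub_zero, one_mul, add_zero] at hfin
  linarith

end Agmon

/-! ### The metric `diag(1, x⁻² e^{-2Φ})`: coefficients and the Hardy inequality -/

section GrushinCoefficients

variable {T : ℝ} {Φ : Cyl T → ℝ}

/-- The coefficients `ω g^{ii}` of `ω Δ = ∑ ∂_i (ω g^{ii} ∂_i)` for the metric
`g = diag(1, x⁻² e^{-2Φ})`. -/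
def coeff (Φ : Cyl T → ℝ) (i : Fin 2) (p : Cyl T) : ℝ :=
  areaDensity (grushinMetric Φ) p * (grushinMetric Φ p)⁻¹ i i

theorem areaDensity_grushinMetric (Φ : Cyl T → ℝ) (p : Cyl T) :
    areaDensity (grushinMetric Φ) p = |p.1|⁻¹ * Real.exp (-Φ p) := by
  have h1 : (grushinMetric Φ p).det = (|p.1|⁻¹ * Real.exp (-Φ p)) ^ 2 := by
    rw [grushinMetric, Matrix.det_diagonal, Fin.prod_univ_two, mul_pow, ← Real.exp_nat_mul, inv_pow,
      sq_abs]
    simp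
  rw [areaDensity, h1, Real.sqrt_sq (by positivity)]

theorem areaDensity_grushinMetric_pos (Φ : Cyl T → ℝ) {p : Cyl T} (hp : p.1 ≠ 0) :
    0 < areaDensity (grushinMetric Φ) p := by
  rw [areaDensity_grushinMetric]
  have := abs_pos.2 hp
  positivity

theorem grushinMetric_inv_offDiag (Φ : Cyl T → ℝ) (p : Cyl T) {i j : Fin 2} (hij : i ≠ j) :
    (grushinMetric Φ p)⁻¹ i j = 0 := by
  rw [grushinMetric, Matrix.inv_diagonal, Matrix.diagonal_apply_ne _ hij]

theorem grushinMetric_inv_diag (Φ : Cyl T → ℝ) {p : Cyl T} (hp : p.1 ≠ 0) :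
    (grushinMetric Φ p)⁻¹ 0 0 = 1 ∧ 0 < (grushinMetric Φ p)⁻¹ 1 1 := by
  have h1 : 0 < (p.1 ^ 2)⁻¹ * Real.exp (-2 * Φ p) := by positivity
  constructor
  · simp only [grushinMetric, Matrix.inv_def, Matrix.det_diagonal, Fin.prod_univ_two,
      Matrix.adjugate_fin_two, Ring.inverse_eq_inv']
    have := Real.exp_ne_zero (-(2 * Φ p))
    simp
    field_simp
  · simp only [grushinMetric, Matrix.inv_def, Matrix.det_diagonal, Fin.prod_univ_two,
      Matrix.adjugate_fin_two, Ring.inverse_eq_inv']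
    simp only [Matrix.cons_val_zero, Matrix.cons_val_one, Matrix.smul_apply]
    simp
    positivity

theorem coeff_zero (Φ : Cyl T → ℝ) {p : Cyl T} (hp : p.1 ≠ 0) :
    coeff Φ 0 p = areaDensity (grushinMetric Φ) p := by
  rw [coeff, (grushinMetric_inv_diag Φ hp).1, mul_one]

theorem coeff_pos (Φ : Cyl T → ℝ) (i : Fin 2) {p : Cyl T} (hp : p.1 ≠ 0) : 0 < coeff Φ i p := by
  refine mul_pos (areaDensity_grushinMetric_pos Φ hp) ?_
  fin_cases i
  · exact lt_of_lt_of_eq one_pos (grushinMetric_inv_diag Φ hp).1.symm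
  · exact (grushinMetric_inv_diag Φ hp).2

theorem smoothOn_coeff (hΦ : SmoothOn Φ univ) (i : Fin 2) : SmoothOn (coeff Φ i) (Omega T) :=
  (smoothOn_areaDensity (grushinMetric_isRiemannianMetricOn hΦ)).mul
    (smoothOn_inv (grushinMetric_isRiemannianMetricOn hΦ) i i)

theorem laplaceBeltrami_grushinMetric (Φ : Cyl T → ℝ) (u : Cyl T → ℂ) (p : Cyl T) :
    laplaceBeltrami (grushinMetric Φ) u p = (areaDensity (grushinMetric Φ) p)⁻¹ •
      ∑ i, pderiv i (fun q => coeff Φ i q • pderiv i u q) p := by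
  rw [laplaceBeltrami]
  simp only [Fin.sum_univ_two, grushinMetric_inv_offDiag Φ _ (zero_ne_one : (0 : Fin 2) ≠ 1),
    grushinMetric_inv_offDiag Φ _ (one_ne_zero : (1 : Fin 2) ≠ 0), mul_zero, zero_smul, pderiv_zero,
    add_zero, zero_add, coeff]

/-- `∂_x ω = -ω (1/x + ∂_x Φ)`. -/
theorem hasDerivAt_areaDensity (hΦ : SmoothOn Φ univ) {p : Cyl T} (hp : p.1 ≠ 0) :
    HasDerivAt (fun s : ℝ => areaDensity (grushinMetric Φ) (p + cover T (s • dir 0)))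
      (-areaDensity (grushinMetric Φ) p * (p.1⁻¹ + pderiv 0 Φ p)) 0 := by
  have h1 : HasDerivAt (fun s : ℝ => p.1 + s) 1 0 := (hasDerivAt_id 0).const_add _
  have hp0 : p.1 + 0 ≠ 0 := by rwa [add_zero]
  have h2 := ((hasDerivAt_abs hp0).comp 0 h1).fun_inv (by simpa using hp)
  have h3 := (hΦ.hasDerivAt isOpen_univ 0 (mem_univ p)).fun_neg.exp
  have h4 := h2.fun_mul h3
  have e : (fun s : ℝ => areaDensity (grushinMetric Φ) (p + cover T (s • dir 0))) =
      fun s => (((fun x => |x|) ∘ fun s => p.1 + s) s)⁻¹ *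
        Real.exp (-Φ (p + cover T (s • dir 0))) := by
    funext s
    rw [areaDensity_grushinMetric]
    simp [cover, dir]
  rw [e]
  convert! h4 using 1
  have ha : |p.1| ≠ 0 := abs_ne_zero.2 hp
  simp only [Function.comp, add_zero, zero_smul, cover_zero, areaDensity_grushinMetric, mul_one]
  have hs : (SignType.sign p.1 : ℝ) = |p.1| / p.1 := by
    rw [eq_div_iff hp, sign_mul_self]
  rw [hs]
  field_simp
  ring

variable [Fact (0 < T)]

/-- **Hardy inequality** with weight `1/x² + ∂_x Φ / x`: expand `∫ ω (∂_x f - f/x)² ≥ 0` and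
integrate by parts. -/
theorem hardy_inequality (hΦ : SmoothOn Φ univ) {f : Cyl T → ℝ} (hf : SmoothOn f univ)
    (hc : HasCompactSupport f) (hfO : tsupport f ⊆ Omega T) :
    ∫ p, areaDensity (grushinMetric Φ) p * ((p.1 ^ 2)⁻¹ + pderiv 0 Φ p * p.1⁻¹) * f p ^ 2 ≤
      ∫ p, areaDensity (grushinMetric Φ) p * pderiv 0 f p ^ 2 := by
  have hO := isOpen_Omega T
  set ρ := areaDensity (grushinMetric Φ) with hρ
  have hρs : SmoothOn ρ (Omega T) := smoothOn_areaDensity (grushinMetric_isRiemannianMetricOn hΦ)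
  have hx : SmoothOn (fun p : Cyl T => p.1⁻¹) (Omega T) :=
    ContDiffOn.inv contDiffOn_fst fun q hq => hq
  have hΦx := (hΦ.pderiv isOpen_univ 0).mono (subset_univ (Omega T))
  have hfx := hf.pderiv isOpen_univ 0
  have hfxO : tsupport (pderiv 0 f) ⊆ Omega T := (tsupport_pderiv_subset 0 f).trans hfO
  -- the total derivative to be integrated
  have hG : SmoothOn (fun p => f p * (f p * (ρ p * p.1⁻¹))) univ :=
    ((hf.mono (subset_univ _)).mul (hρs.mul hx)).mul_of_tsupport_subset hO hf hfO
  have hGc : HasCompactSupport (fun p => f p * (f p * (ρ p * p.1⁻¹))) := hc.mul_right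
  have hG0 := integral_pderiv_eq_zero hG hGc 0
  have hGd : ∀ p, pderiv 0 (fun p => f p * (f p * (ρ p * p.1⁻¹))) p =
      2 * (ρ p * p.1⁻¹ * f p * pderiv 0 f p) -
        ρ p * (2 * (p.1 ^ 2)⁻¹ + pderiv 0 Φ p * p.1⁻¹) * f p ^ 2 := by
    intro p
    by_cases hp : p ∈ tsupport f
    · have hp0 : p.1 ≠ 0 := hfO hp
      have d1 := hf.hasDerivAt isOpen_univ 0 (mem_univ p)
      have d2 := hasDerivAt_areaDensity hΦ hp0
      have h1 : HasDerivAt (fun s : ℝ => (p + cover T (s • dir 0)).1) 1 0 := by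
        have : (fun s : ℝ => (p + cover T (s • dir 0)).1) = fun s => p.1 + s := by
          funext s; simp [cover, dir]
        rw [this]
        exact (hasDerivAt_id 0).const_add _
      have d3 := h1.fun_inv (by simpa [cover_zero] using hp0)
      have := (d1.fun_mul (d1.fun_mul (d2.fun_mul d3))).deriv
      rw [pderiv, this]
      simp only [zero_smul, cover_zero, add_zero, ← hρ]
      field_simp
      ring
    · have h1 : p ∉ tsupport (fun p => f p * (f p * (ρ p * p.1⁻¹))) :=
        fun h => hp (tsupport_mul_subset_left h)
      rw [pderiv_eq_zero_of_notMem_tsupport h1, pderiv_eq_zero_of_notMem_tsupport hp,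
        image_eq_zero_of_notMem_tsupport hp]
      ring
  have hint : ∀ {k l b : Cyl T → ℝ}, SmoothOn k univ → HasCompactSupport k →
      tsupport k ⊆ Omega T → Continuous l → SmoothOn b (Omega T) →
      Integrable fun p => k p * b p * l p := by
    intro k l b hk hkc hkO hl hb
    exact ((hb.mul_of_tsupport_subset hO hk hkO).continuous.mul hl).integrable_of_hasCompactSupport
      hkc.mul_right.mul_right
  have i1 : Integrable fun p => ρ p * pderiv 0 f p ^ 2 :=
    (hint hfx (hasCompactSupport_pderiv hc 0) hfxO hfx.continuous hρs).congr
      (Eventually.of_forall fun p => by simp only; ring)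
  have i2 : Integrable fun p => ρ p * ((p.1 ^ 2)⁻¹ + pderiv 0 Φ p * p.1⁻¹) * f p ^ 2 :=
    (hint hf hc hfO hf.continuous (hρs.mul ((hx.mul hx).add (hΦx.mul hx)))).congr
      (Eventually.of_forall fun p => by simp only; rw [pow_two p.1, mul_inv]; ring)
  have i3 : Integrable fun p => pderiv 0 (fun p => f p * (f p * (ρ p * p.1⁻¹))) p :=
    (hG.pderiv isOpen_univ 0).continuous.integrable_of_hasCompactSupport
      (hasCompactSupport_pderiv hGc 0)
  have hsq : 0 ≤ ∫ p, ρ p * (pderiv 0 f p - p.1⁻¹ * f p) ^ 2 :=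
    integral_nonneg fun p => mul_nonneg (Real.sqrt_nonneg _) (sq_nonneg _)
  have i12 : Integrable fun p => ρ p * pderiv 0 f p ^ 2 -
      ρ p * ((p.1 ^ 2)⁻¹ + pderiv 0 Φ p * p.1⁻¹) * f p ^ 2 := i1.sub i2
  have hexp : ∫ p, ρ p * (pderiv 0 f p - p.1⁻¹ * f p) ^ 2 =
      (∫ p, ρ p * pderiv 0 f p ^ 2) -
        (∫ p, ρ p * ((p.1 ^ 2)⁻¹ + pderiv 0 Φ p * p.1⁻¹) * f p ^ 2) -
        ∫ p, pderiv 0 (fun p => f p * (f p * (ρ p * p.1⁻¹))) p := by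
    rw [← integral_sub i1 i2, ← integral_sub i12 i3]
    refine integral_congr_ae (Eventually.of_forall fun p => ?_)
    simp only [hGd]
    rw [pow_two p.1, mul_inv]
    ring
  rw [hG0] at hexp
  linarith

end GrushinCoefficients

/-! ### Uniqueness of weak solutions -/

section Strips

/-- A smooth cutoff around a compact subset of an open subset of the line. -/
theorem exists_cutoff {S I : Set ℝ} (hS : IsCompact S) (hI : IsOpen I) (hSI : S ⊆ I) :
    ∃ (K : Set ℝ) (z : ℝ → ℝ), IsCompact K ∧ S ⊆ interior K ∧ K ⊆ I ∧ ContDiff ℝ ∞ z ∧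
      HasCompactSupport z ∧ tsupport z ⊆ I ∧ (∀ x ∈ K, z x = 1) ∧ ∀ x, 0 ≤ z x := by
  obtain ⟨K, hK, hSK, hKI⟩ := exists_compact_between hS hI hSI
  obtain ⟨K', hK', hKK', hK'I⟩ := exists_compact_between hK hI hKI
  obtain ⟨f, hf0, hf1, hf⟩ := exists_contMDiffMap_zero_one_of_isClosed (n := ⊤)
    (modelWithCornersSelf ℝ ℝ) (isOpen_interior (s := K')).isClosed_compl hK.isClosed
    (disjoint_compl_left_iff_subset.2 hKK')
  have hsupp : Function.support f ⊆ K' := fun x hx => by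
    by_contra h
    exact hx (hf0 fun h' => h (interior_subset h'))
  have hts : tsupport f ⊆ K' := closure_minimal hsupp hK'.isClosed
  exact ⟨K, f, hK, hSK, hKI, f.contMDiff.contDiff, HasCompactSupport.of_support_subset_isCompact hK'
    hsupp, hts.trans hK'I, fun x hx => hf1 hx, fun x => (hf x).1⟩

variable {T : ℝ}

theorem tsupport_comp_fst_subset (X : ℝ → ℝ) :
    tsupport (fun p : Cyl T => X p.1) ⊆ {p | p.1 ∈ tsupport X} :=
  closure_minimal (fun _ hp => subset_tsupport X hp)
    ((isClosed_tsupport X).preimage continuous_fst)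

variable [Fact (0 < T)]

theorem isCompact_strip {K : Set ℝ} (hK : IsCompact K) : IsCompact {p : Cyl T | p.1 ∈ K} := by
  have : {p : Cyl T | p.1 ∈ K} = K ×ˢ univ := by ext; simp
  rw [this]
  exact hK.prod isCompact_univ

theorem hasCompactSupport_comp_fst {X : ℝ → ℝ} (hX : HasCompactSupport X) :
    HasCompactSupport (fun p : Cyl T => X p.1) :=
  HasCompactSupport.of_support_subset_isCompact (isCompact_strip hX.isCompact)
    ((subset_tsupport _).trans (tsupport_comp_fst_subset X))

variable {Φ : Cyl T → ℝ}

/-- A function which is square integrable for the Riemannian area is square integrable for `dx dy`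
on compact strips. -/
theorem isCompactL2_indicator (hΦ : SmoothOn Φ univ) {I K : Set ℝ}
    (h0 : (0 : ℝ) ∉ I) (hK : IsCompact K) (hKI : K ⊆ I) {u : Cyl T → ℝ} (hum : Measurable u)
    (hu : IntegrableOn (fun p => u p ^ 2 * areaDensity (grushinMetric Φ) p) {p | p.1 ∈ I}) :
    IsCompactL2 ({p : Cyl T | p.1 ∈ K}.indicator u) := by
  have hKs : IsCompact {p : Cyl T | p.1 ∈ K} := isCompact_strip hK
  have hKm := hKs.isClosed.measurableSet
  have hIOmega : {p : Cyl T | p.1 ∈ K} ⊆ Omega T := fun p hp h => h0 (by rw [← h]; exact hKI hp)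
  have hcont : ContinuousOn (fun p => (areaDensity (grushinMetric Φ) p)⁻¹)
      {p : Cyl T | p.1 ∈ K} :=
    ((smoothOn_areaDensity_inv (grushinMetric_isRiemannianMetricOn hΦ)).continuousOn
      (isOpen_Omega T)).mono hIOmega
  obtain ⟨C, hC⟩ := hKs.exists_bound_of_continuousOn hcont
  refine ⟨hum.indicator hKm, HasCompactSupport.of_support_subset_isCompact hKs
    Set.support_indicator_subset, ?_⟩
  have h1 : Integrable ({p : Cyl T | p.1 ∈ K}.indicator fun p =>
      C * (u p ^ 2 * areaDensity (grushinMetric Φ) p)) :=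
    (integrable_indicator_iff hKm).2 ((hu.mono_set fun p hp => hKI hp).const_mul C)
  refine h1.mono' ((hum.indicator hKm).pow_const 2).aestronglyMeasurable
    (Eventually.of_forall fun p => ?_)
  by_cases hp : p ∈ {p : Cyl T | p.1 ∈ K}
  · rw [indicator_of_mem hp, indicator_of_mem hp, Real.norm_eq_abs, abs_of_nonneg (sq_nonneg _)]
    have hpos := areaDensity_grushinMetric_pos Φ (hIOmega hp)
    have h2 := hC p hp
    rw [Real.norm_eq_abs, abs_of_pos (inv_pos.2 hpos)] at h2
    have h3 : 1 ≤ C * areaDensity (grushinMetric Φ) p := by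
      rwa [inv_le_iff_one_le_mul₀ hpos] at h2
    nlinarith [mul_le_mul_of_nonneg_left h3 (sq_nonneg (u p))]
  · simp [indicator_of_notMem hp]

/-- The Agmon inequality for `L²` solutions `u` of `Δ u = c u` and weights depending on `x` only. -/
theorem agmon_inequality_grushin (hΦ : SmoothOn Φ univ) {I : Set ℝ} (hI : IsOpen I)
    (h0 : (0 : ℝ) ∉ I) {u : Cyl T → ℝ} (hum : Measurable u)
    (hu : IntegrableOn (fun p => u p ^ 2 * areaDensity (grushinMetric Φ) p) {p | p.1 ∈ I}) {c : ℝ}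
    (hweak : ∀ φ : Cyl T → ℝ, SmoothOn φ univ → HasCompactSupport φ →
      tsupport φ ⊆ {p | p.1 ∈ I} → ∫ p in {p | p.1 ∈ I}, u p *
        ((∑ i, pderiv i (fun p => coeff Φ i p * pderiv i φ p) p) -
          c * areaDensity (grushinMetric Φ) p * φ p) = 0)
    {X : ℝ → ℝ} (hX : ContDiff ℝ ∞ X) (hXc : HasCompactSupport X) (hXI : tsupport X ⊆ I) :
    ∫ p in {p | p.1 ∈ I}, u p ^ 2 * areaDensity (grushinMetric Φ) p *
      (((p.1 ^ 2)⁻¹ + pderiv 0 Φ p * p.1⁻¹ + c) * X p.1 ^ 2 - deriv X p.1 ^ 2) ≤ 0 := by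
  obtain ⟨K, ζ, hK, hXK, hKI, hζ, hζc, hζI, hζ1, hζ0⟩ := exists_cutoff hXc.isCompact hI hXI
  set ρ := areaDensity (grushinMetric Φ) with hρ
  have hIm : MeasurableSet {p : Cyl T | p.1 ∈ I} := (hI.preimage continuous_fst).measurableSet
  have hIOmega : {p : Cyl T | p.1 ∈ I} ⊆ Omega T := fun p hp h => h0 (by rw [← h]; exact hp)
  set O : Set (Cyl T) := {p | p.1 ∈ interior K} with hOdef
  have hO : IsOpen O := isOpen_interior.preimage continuous_fst
  have hOK : ∀ p ∈ O, p.1 ∈ K := fun p hp => interior_subset hp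
  -- compactly supported coefficients which agree with the given ones on `O`
  have hcut : ∀ {b : Cyl T → ℝ}, SmoothOn b (Omega T) → SmoothOn (fun p => ζ p.1 * b p) univ :=
    fun hb => hb.mul_of_tsupport_subset (isOpen_Omega T) (smoothOn_comp_fst hζ _)
      ((tsupport_comp_fst_subset ζ).trans fun p hp => hIOmega (hζI hp))
  have hcutc : ∀ b : Cyl T → ℝ, HasCompactSupport (fun p => ζ p.1 * b p) := fun b =>
    (hasCompactSupport_comp_fst hζc).mul_right
  set a : Fin 2 → Cyl T → ℝ := fun i p => ζ p.1 * coeff Φ i p with ha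
  set χ : Cyl T → ℝ := fun p => X p.1 with hχ
  have hχs : tsupport χ ⊆ {p | p.1 ∈ tsupport X} := tsupport_comp_fst_subset X
  have hχO : tsupport χ ⊆ O := hχs.trans fun p hp => hXK hp
  have hχc : HasCompactSupport χ := hasCompactSupport_comp_fst hXc
  have hρs : SmoothOn ρ (Omega T) := smoothOn_areaDensity (grushinMetric_isRiemannianMetricOn hΦ)
  have hxs : SmoothOn (fun p : Cyl T => p.1⁻¹) (Omega T) :=
    ContDiffOn.inv contDiffOn_fst fun q hq => hq
  have hx2 : SmoothOn (fun p : Cyl T => (p.1 ^ 2)⁻¹) (Omega T) :=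
    ContDiffOn.inv (contDiffOn_fst.pow 2) fun q hq => pow_ne_zero 2 hq
  have hΦx := (hΦ.pderiv isOpen_univ 0).mono (subset_univ (Omega T))
  have hcpos : ∃ c > 0, ∀ i, ∀ p ∈ tsupport χ, c ≤ a i p := by
    have : ∀ i, ∃ c > 0, ∀ p ∈ tsupport χ, c ≤ a i p := by
      intro i
      rcases (tsupport χ).eq_empty_or_nonempty with he | hne
      · exact ⟨1, one_pos, by simp [he]⟩
      · obtain ⟨p₀, hp₀, hmin⟩ := hχc.isCompact.exists_isMinOn hne
          (hcut (smoothOn_coeff hΦ i)).continuous.continuousOn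
        refine ⟨a i p₀, ?_, fun p hp => hmin hp⟩
        have h1 := hOK _ (hχO hp₀)
        simp only [ha, hζ1 _ h1, one_mul]
        exact coeff_pos Φ i (hIOmega (hKI h1))
    choose c hc hcp using this
    refine ⟨min (c 0) (c 1), lt_min (hc 0) (hc 1), fun i p hp => ?_⟩
    fin_cases i
    · exact (min_le_left _ _).trans (hcp 0 p hp)
    · exact (min_le_right _ _).trans (hcp 1 p hp)
  obtain ⟨c₀, hc₀, hc₀a⟩ := hcpos
  have ha0 : ∀ i p, 0 ≤ a i p := fun i p =>
    mul_nonneg (hζ0 _) (by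
      by_cases hp : p.1 = 0
      · simp [coeff, areaDensity_grushinMetric, hp]
      · exact (coeff_pos Φ i hp).le)
  set v : Cyl T → ℝ := {p : Cyl T | p.1 ∈ K}.indicator u with hv
  have hvL : IsCompactL2 v := isCompactL2_indicator hΦ h0 hK hKI hum hu
  set q : Cyl T → ℝ := fun p => ζ p.1 * (ρ p * ((p.1 ^ 2)⁻¹ + pderiv 0 Φ p * p.1⁻¹)) with hq
  set w : Cyl T → ℝ := fun p => c * (ζ p.1 * ρ p) with hw
  have key := agmon_inequality (a := a) (w := w) (q := q) (χ := χ) (v := v) (O := O)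
    (fun i => hcut (smoothOn_coeff hΦ i)) (fun i => hcutc _) ha0
    (continuous_const.mul (hcut hρs).continuous)
    (hcut (hρs.mul (hx2.add (hΦx.mul hxs)))).continuous
    (smoothOn_comp_fst hX _) hχc hc₀ hc₀a hO hχO hvL ?_ ?_
  · refine le_of_eq_of_le ?_ key
    rw [← integral_indicator hIm]
    refine integral_congr_ae (Eventually.of_forall fun p => ?_)
    simp only [Fin.sum_univ_two, hχ, pderiv_zero_comp_fst, pderiv_one_comp_fst]
    by_cases hp : p.1 ∈ K
    · rw [indicator_of_mem (show p ∈ {p : Cyl T | p.1 ∈ I} from hKI hp), hv,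
        indicator_of_mem (show p ∈ {p : Cyl T | p.1 ∈ K} from hp)]
      simp only [hq, hw, ha, hζ1 _ hp, coeff_zero Φ (hIOmega (hKI hp)), ← hρ]
      ring
    · have hp' : p.1 ∉ tsupport X := fun h => hp (interior_subset (hXK h))
      have e1 : X p.1 = 0 := image_eq_zero_of_notMem_tsupport hp'
      have e2 : deriv X p.1 = 0 :=
        image_eq_zero_of_notMem_tsupport fun h => hp' (tsupport_deriv_subset h)
      rw [hv, indicator_of_notMem (show p ∉ {p : Cyl T | p.1 ∈ K} from hp)]
      classical rw [indicator_apply]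
      split_ifs <;> simp [e1, e2]
  · intro φ hφ hφc hφO
    rw [← hweak φ hφ hφc (hφO.trans fun p hp => hKI (hOK p hp)), ← integral_indicator hIm]
    refine integral_congr_ae (Eventually.of_forall fun p => ?_)
    simp only
    by_cases hp : p ∈ O
    · rw [indicator_of_mem (show p ∈ {p : Cyl T | p.1 ∈ I} from hKI (hOK p hp)), hv,
        indicator_of_mem (show p ∈ {p : Cyl T | p.1 ∈ K} from hOK p hp)]
      have e1 : ∀ i, pderiv i (fun p => a i p * pderiv i φ p) p =
          pderiv i (fun p => coeff Φ i p * pderiv i φ p) p := by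
        intro i
        refine pderiv_congr ?_
        filter_upwards [hO.mem_nhds hp] with r hr
        simp only [ha, hζ1 _ (hOK r hr), one_mul]
      simp only [e1, hw, hζ1 _ (hOK p hp)]
      ring
    · have hp' : p ∉ tsupport φ := fun h => hp (hφO h)
      have e1 : ∀ (b : Cyl T → ℝ) i, pderiv i (fun p => b p * pderiv i φ p) p = 0 := fun b i =>
        pderiv_eq_zero_of_notMem_tsupport fun h =>
          hp' (tsupport_pderiv_subset i φ (tsupport_mul_subset_right h))
      classical rw [indicator_apply]
      simp [e1, image_eq_zero_of_notMem_tsupport hp']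
  · intro f hf hfc hfs
    have hfO : tsupport f ⊆ O := hfs.trans hχO
    have hH := hardy_inequality hΦ hf hfc (hfO.trans fun p hp => hIOmega (hKI (hOK p hp)))
    have e1 : ∫ p, q p * f p ^ 2 =
        ∫ p, ρ p * ((p.1 ^ 2)⁻¹ + pderiv 0 Φ p * p.1⁻¹) * f p ^ 2 := by
      refine integral_congr_ae (Eventually.of_forall fun p => ?_)
      simp only
      by_cases hp : p ∈ tsupport f
      · simp only [hq, hζ1 _ (hOK p (hfO hp)), one_mul]
      · simp [image_eq_zero_of_notMem_tsupport hp]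
    have e2 : ∫ p, ρ p * pderiv 0 f p ^ 2 = ∫ p, a 0 p * pderiv 0 f p ^ 2 := by
      refine integral_congr_ae (Eventually.of_forall fun p => ?_)
      simp only
      by_cases hp : p ∈ tsupport f
      · have hpK := hOK p (hfO hp)
        simp only [ha, hζ1 _ hpK, one_mul, coeff_zero Φ (hIOmega (hKI hpK)), ← hρ]
      · simp [pderiv_eq_zero_of_notMem_tsupport hp]
    rw [e1, Fin.sum_univ_two, ← e2]
    have e3 : 0 ≤ ∫ p, a 1 p * pderiv 1 f p ^ 2 :=
      integral_nonneg fun p => mul_nonneg (ha0 1 p) (sq_nonneg _)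
    linarith

end Strips

section Uniqueness

/-- A bump function on the line, equal to `1` on `[-1, 1]` and supported in `[-2, 2]`. -/
def lineBump : ContDiffBump (0 : ℝ) := ⟨1, 2, one_pos, one_lt_two⟩

/-- The weight `t e^{-kt}` on the half-line, cut off on the logarithmic scale `|log t| ~ n`. -/
def logCutoff (k : ℝ) (n : ℕ) (t : ℝ) : ℝ :=
  if 0 < t then lineBump (Real.log t / n) * (t * Real.exp (-(k * t))) else 0

theorem lineBump_eq_zero {x : ℝ} (hx : 2 ≤ |x|) : lineBump x = 0 :=
  lineBump.zero_of_le_dist (by rwa [dist_zero_right, Real.norm_eq_abs])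

theorem exists_abs_deriv_lineBump_le : ∃ C : ℝ, 0 ≤ C ∧ ∀ x, |deriv lineBump x| ≤ C := by
  have h : ContDiff ℝ ∞ lineBump := lineBump.contDiff
  obtain ⟨C, hC⟩ := lineBump.hasCompactSupport.deriv.exists_bound_of_continuous
    (h.continuous_deriv (by simp))
  exact ⟨C, (norm_nonneg _).trans (hC 0), hC⟩

variable {k : ℝ} {n : ℕ}

theorem logCutoff_of_nonpos {t : ℝ} (ht : t ≤ 0) : logCutoff k n t = 0 :=
  if_neg ht.not_gt

theorem support_logCutoff_subset (hn : 0 < n) :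
    Function.support (logCutoff k n) ⊆ Icc (Real.exp (-(2 * n))) (Real.exp (2 * n)) := by
  intro t ht
  by_cases h0 : 0 < t
  · rw [Function.mem_support, logCutoff, if_pos h0] at ht
    have h1 : |Real.log t / n| < 2 := by
      by_contra h
      exact ht (by rw [lineBump_eq_zero (not_lt.1 h), zero_mul])
    have hn' : (0 : ℝ) < n := Nat.cast_pos.2 hn
    rw [abs_div, abs_of_pos hn', div_lt_iff₀ hn', abs_lt] at h1
    exact ⟨((Real.le_log_iff_exp_le h0).1 (by linarith [h1.1])),
      ((Real.log_le_iff_le_exp h0).1 h1.2.le)⟩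
  · exact absurd (logCutoff_of_nonpos (not_lt.1 h0)) ht

theorem tsupport_logCutoff_subset (hn : 0 < n) :
    tsupport (logCutoff k n) ⊆ Icc (Real.exp (-(2 * n))) (Real.exp (2 * n)) :=
  closure_minimal (support_logCutoff_subset hn) isClosed_Icc

theorem contDiff_logCutoff (hn : 0 < n) : ContDiff ℝ ∞ (logCutoff k n) := by
  rw [contDiff_iff_contDiffAt]
  intro t
  by_cases h0 : 0 < t
  · have h1 : logCutoff k n =ᶠ[𝓝 t]
        fun t => lineBump (Real.log t / n) * (t * Real.exp (-(k * t))) := by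
      filter_upwards [Ioi_mem_nhds h0] with r hr
      exact if_pos hr
    refine ContDiffAt.congr_of_eventuallyEq ?_ h1
    have h2 : ContDiffAt ℝ ∞ (fun t => Real.log t / n) t :=
      (Real.contDiffAt_log.2 h0.ne').div_const _
    have hb : ContDiff ℝ ∞ lineBump := lineBump.contDiff
    have h3 : ContDiffAt ℝ ∞ (fun t => lineBump (Real.log t / n)) t :=
      ContDiffAt.comp (g := lineBump) t hb.contDiffAt h2
    exact h3.mul (contDiffAt_id.mul (contDiffAt_const.mul contDiffAt_id).neg.exp)
  · have h1 : t ∉ tsupport (logCutoff k n) := fun h =>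
      h0 ((Real.exp_pos _).trans_le (tsupport_logCutoff_subset hn h).1)
    exact contDiffAt_const.congr_of_eventuallyEq (notMem_tsupport_iff_eventuallyEq.1 h1)

theorem hasDerivAt_logCutoff {t : ℝ} (ht : 0 < t) :
    HasDerivAt (logCutoff k n) (Real.exp (-(k * t)) *
      (deriv lineBump (Real.log t / n) / n + lineBump (Real.log t / n) * (1 - k * t))) t := by
  have h1 : logCutoff k n =ᶠ[𝓝 t]
      fun t => lineBump (Real.log t / n) * (t * Real.exp (-(k * t))) := by
    filter_upwards [Ioi_mem_nhds ht] with r hr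
    exact if_pos hr
  refine HasDerivAt.congr_of_eventuallyEq ?_ h1
  have h : ContDiff ℝ ∞ lineBump := lineBump.contDiff
  have d1 := (Real.hasDerivAt_log ht.ne').div_const (n : ℝ)
  have d2 : HasDerivAt lineBump (deriv lineBump (Real.log t / n)) (Real.log t / n) :=
    (h.differentiable (by simp)).differentiableAt.hasDerivAt
  have d3 : HasDerivAt (fun t => Real.exp (-(k * t))) (Real.exp (-(k * t)) * -(k * 1)) t :=
    ((hasDerivAt_id t).const_mul k).fun_neg.exp
  convert! (d2.comp t d1).fun_mul ((hasDerivAt_id t).fun_mul d3) using 1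
  simp only [Function.comp, id]
  field_simp
  ring

theorem logCutoff_of_abs_log_le {t : ℝ} (ht : 0 < t) (hn : 0 < n) (h : |Real.log t| ≤ n) :
    logCutoff k n t = t * Real.exp (-(k * t)) := by
  have hn' : (0 : ℝ) < n := Nat.cast_pos.2 hn
  have h1 : lineBump (Real.log t / n) = 1 := by
    refine lineBump.one_of_mem_closedBall ?_
    rw [mem_closedBall_zero_iff, Real.norm_eq_abs, abs_div, abs_of_pos hn', div_le_iff₀ hn']
    simpa [lineBump] using h
  rw [logCutoff, if_pos ht, h1, one_mul]

/-- `G = t e^{-kt}` satisfies `G'² = (1/t - k)² G²`, so that the potential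
`1/t² - 2k/t + k² + 1` beats `G'²` by `G²`; the logarithmic cutoff costs an error `O(1/n)`. -/
theorem sq_logCutoff_le (hk : 0 ≤ k) {C : ℝ} (hC : ∀ x, |deriv lineBump x| ≤ C) {t : ℝ}
    (ht : 0 < t) :
    logCutoff k n t ^ 2 - ((C / n) ^ 2 + 2 * (C / n)) ≤
      ((t ^ 2)⁻¹ - 2 * k * t⁻¹ + (k ^ 2 + 1)) * logCutoff k n t ^ 2 -
        deriv (logCutoff k n) t ^ 2 := by
  rw [(hasDerivAt_logCutoff ht).deriv, logCutoff, if_pos ht]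
  set e := Real.exp (-(k * t))
  set b := lineBump (Real.log t / n)
  set E := deriv lineBump (Real.log t / n) / n
  have hb0 : 0 ≤ b := lineBump.nonneg
  have hb1 : b ≤ 1 := lineBump.le_one
  have he0 : 0 < e := Real.exp_pos _
  have hkt : 0 ≤ k * t := mul_nonneg hk ht.le
  have he1 : e ≤ 1 := Real.exp_le_one_iff.2 (by linarith)
  have hE : |E| ≤ C / n := by
    rw [abs_div, Nat.abs_cast]
    exact div_le_div_of_nonneg_right (hC _) (Nat.cast_nonneg n)
  have hke : |(1 - k * t) * e| ≤ 1 := by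
    have h1 : k * t * e ≤ 1 := by
      have h2 : k * t ≤ Real.exp (k * t) := by linarith [Real.add_one_le_exp (k * t)]
      have h3 : Real.exp (k * t) * e = 1 := by rw [← Real.exp_add]; simp
      calc k * t * e ≤ Real.exp (k * t) * e := mul_le_mul_of_nonneg_right h2 he0.le
        _ = 1 := h3
    have h4 : 0 ≤ k * t * e := mul_nonneg hkt he0.le
    rw [abs_le]
    constructor <;> nlinarith
  have hEe : (e * E) ^ 2 ≤ (C / n) ^ 2 := by
    have : |e * E| ≤ C / n := by
      rw [abs_mul, abs_of_pos he0]
      nlinarith [abs_nonneg E]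
    rw [← sq_abs]
    exact pow_le_pow_left₀ (abs_nonneg _) this 2
  have hmix : (e * E) * (b * ((1 - k * t) * e)) ≤ C / n := by
    refine (le_abs_self _).trans ?_
    rw [abs_mul, abs_mul, abs_mul b, abs_of_pos he0, abs_of_nonneg hb0]
    have h1 : e * |E| ≤ C / n := by nlinarith [abs_nonneg E]
    have h2 : b * |(1 - k * t) * e| ≤ 1 := mul_le_one₀ hb1 (abs_nonneg _) hke
    have h3 : 0 ≤ e * |E| := mul_nonneg he0.le (abs_nonneg _)
    nlinarith
  have hid : ((t ^ 2)⁻¹ - 2 * k * t⁻¹ + (k ^ 2 + 1)) * (b * (t * e)) ^ 2 -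
      (e * (E + b * (1 - k * t))) ^ 2 =
      (b * (t * e)) ^ 2 - (e * E) ^ 2 - 2 * ((e * E) * (b * ((1 - k * t) * e))) := by
    field_simp
    ring
  rw [hid]
  linarith

variable {T : ℝ} [Fact (0 < T)] {Φ : Cyl T → ℝ}

/-- `L²` solutions of `Δ u = c u` on a half-cylinder vanish for large `c`. -/
theorem ae_eq_zero_of_weak_solution (hΦ : SmoothOn Φ univ) (hk : 0 ≤ k)
    (hΦk : ∀ p, |pderiv 0 Φ p| ≤ 2 * k) {I : Set ℝ} (hI : IsOpen I)
    (h0 : (0 : ℝ) ∉ I) {s : ℝ} (hs : s * s = 1) (hsI : ∀ t, 0 < s * t → t ∈ I) {u : Cyl T → ℝ}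
    (hum : Measurable u)
    (hu : IntegrableOn (fun p => u p ^ 2 * areaDensity (grushinMetric Φ) p) {p | p.1 ∈ I})
    (hweak : ∀ φ : Cyl T → ℝ, SmoothOn φ univ → HasCompactSupport φ →
      tsupport φ ⊆ {p | p.1 ∈ I} → ∫ p in {p | p.1 ∈ I}, u p *
        ((∑ i, pderiv i (fun p => coeff Φ i p * pderiv i φ p) p) -
          (k ^ 2 + 1) * areaDensity (grushinMetric Φ) p * φ p) = 0) :
    ∀ᵐ p : Cyl T, 0 < s * p.1 → u p = 0 := by
  obtain ⟨C, hC0, hC⟩ := exists_abs_deriv_lineBump_le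
  set ρ := areaDensity (grushinMetric Φ) with hρ
  set N := ∫ p in {p : Cyl T | p.1 ∈ I}, u p ^ 2 * ρ p with hN
  have hs0 : s ≠ 0 := fun h => by simp [h] at hs
  have hIm : MeasurableSet {p : Cyl T | p.1 ∈ I} := (hI.preimage continuous_fst).measurableSet
  have hIOmega : {p : Cyl T | p.1 ∈ I} ⊆ Omega T := fun p hp h => h0 (by rw [← h]; exact hp)
  have hρ0 : ∀ p, 0 ≤ ρ p := fun p => Real.sqrt_nonneg _
  -- the Agmon inequality with the weight `G` cut off at scale `n`
  have hn : ∀ n : ℕ, 0 < n → IntegrableOn (fun p => u p ^ 2 * ρ p * logCutoff k n (s * p.1) ^ 2)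
        {p | p.1 ∈ I} ∧
      ∫ p in {p : Cyl T | p.1 ∈ I}, u p ^ 2 * ρ p * logCutoff k n (s * p.1) ^ 2 ≤
        ((C / n) ^ 2 + 2 * (C / n)) * N := by
    intro n hn
    set X : ℝ → ℝ := fun x => logCutoff k n (s * x) with hX
    have hXs : ContDiff ℝ ∞ X := (contDiff_logCutoff hn).comp (contDiff_const.mul contDiff_id)
    have hXd : ∀ x, deriv X x = s * deriv (logCutoff k n) (s * x) := fun x => by
      simpa using deriv_comp_mul_left s (logCutoff k n) x
    set S : Set ℝ := (fun t => s * t) '' Icc (Real.exp (-(2 * n))) (Real.exp (2 * n)) with hS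
    have hSc : IsCompact S := isCompact_Icc.image (continuous_const.mul continuous_id)
    have hXS : Function.support X ⊆ S := fun x hx =>
      ⟨s * x, support_logCutoff_subset hn hx, by simp only; rw [← mul_assoc, hs, one_mul]⟩
    have hXc : HasCompactSupport X := HasCompactSupport.of_support_subset_isCompact hSc hXS
    have hXI : tsupport X ⊆ I := by
      refine (closure_minimal hXS hSc.isClosed).trans ?_
      rintro _ ⟨t, ht, rfl⟩
      refine hsI _ ?_
      rw [← mul_assoc, hs, one_mul]
      exact (Real.exp_pos _).trans_le ht.1
    have key := agmon_inequality_grushin hΦ hI h0 hum hu hweak hXs hXc hXI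
    set χ : Cyl T → ℝ := fun p => X p.1 with hχ
    have hχs : SmoothOn χ univ := smoothOn_comp_fst hXs _
    have hχc : HasCompactSupport χ := hasCompactSupport_comp_fst hXc
    have hχO : tsupport χ ⊆ Omega T := (tsupport_comp_fst_subset X).trans fun p hp => hIOmega (hXI hp)
    have hbd : ∀ {f : Cyl T → ℝ}, Continuous f → HasCompactSupport f →
        IntegrableOn (fun p => u p ^ 2 * ρ p * f p) {p | p.1 ∈ I} := by
      intro f hf hfc
      obtain ⟨B, hB⟩ := hfc.exists_bound_of_continuous hf
      exact hu.mul_bdd (c := B) hf.aestronglyMeasurable (Eventually.of_forall hB)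
    have hcont : SmoothOn (fun p => χ p * (χ p * ((p.1 ^ 2)⁻¹ + pderiv 0 Φ p * p.1⁻¹ +
        (k ^ 2 + 1)))) univ := by
      have hxs : SmoothOn (fun p : Cyl T => p.1⁻¹) (Omega T) :=
        ContDiffOn.inv contDiffOn_fst fun q hq => hq
      have hx2 : SmoothOn (fun p : Cyl T => (p.1 ^ 2)⁻¹) (Omega T) :=
        ContDiffOn.inv (contDiffOn_fst.pow 2) fun q hq => pow_ne_zero 2 hq
      have hΦx := (hΦ.pderiv isOpen_univ 0).mono (subset_univ (Omega T))
      have hcs : SmoothOn (fun _ : Cyl T => k ^ 2 + 1) (Omega T) := contDiffOn_const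
      exact ((hχs.mono (subset_univ _)).mul
        ((hx2.add (hΦx.mul hxs)).add hcs)).mul_of_tsupport_subset (isOpen_Omega T) hχs hχO
    have i1 := hbd hcont.continuous hχc.mul_right
    have hdX : Continuous fun p : Cyl T => deriv X p.1 ^ 2 :=
      ((hXs.continuous_deriv (by simp)).comp continuous_fst).pow 2
    have hdXc : HasCompactSupport fun p : Cyl T => deriv X p.1 ^ 2 := by
      simp only [pow_two]
      exact (hasCompactSupport_comp_fst (T := T) hXc.deriv).mul_left
    have i2 := hbd hdX hdXc
    have i3 : IntegrableOn (fun p => u p ^ 2 * ρ p * X p.1 ^ 2) {p : Cyl T | p.1 ∈ I} :=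
      hbd (hχs.continuous.pow 2) (by simp only [pow_two]; exact hχc.mul_left)
    refine ⟨i3, ?_⟩
    have i4 : IntegrableOn (fun p => u p ^ 2 * ρ p *
        (((p.1 ^ 2)⁻¹ + pderiv 0 Φ p * p.1⁻¹ + (k ^ 2 + 1)) * X p.1 ^ 2 - deriv X p.1 ^ 2))
        {p | p.1 ∈ I} := by
      refine (i1.sub i2).congr (Eventually.of_forall fun p => ?_)
      simp only [Pi.sub_apply, hχ]
      ring
    have i5 : IntegrableOn (fun p => u p ^ 2 * ρ p * X p.1 ^ 2 -
        ((C / n) ^ 2 + 2 * (C / n)) * (u p ^ 2 * ρ p)) {p : Cyl T | p.1 ∈ I} :=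
      i3.sub (hu.const_mul _)
    have hmono := setIntegral_mono_on i5 i4 hIm fun p hp => by
      have hp0 : p.1 ≠ 0 := hIOmega hp
      have hw : 0 ≤ u p ^ 2 * ρ p := mul_nonneg (sq_nonneg _) (hρ0 p)
      have h1 : X p.1 ^ 2 - ((C / n) ^ 2 + 2 * (C / n)) ≤
          ((p.1 ^ 2)⁻¹ + pderiv 0 Φ p * p.1⁻¹ + (k ^ 2 + 1)) * X p.1 ^ 2 - deriv X p.1 ^ 2 := by
        have hCn : 0 ≤ (C / n) ^ 2 + 2 * (C / n) := by positivity
        rcases lt_or_gt_of_ne (mul_ne_zero hs0 hp0) with hneg | hpos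
        · have e1 : X p.1 = 0 := logCutoff_of_nonpos hneg.le
          have e2 : deriv X p.1 = 0 := by
            refine image_eq_zero_of_notMem_tsupport fun h => ?_
            obtain ⟨t, ht, hte⟩ := closure_minimal hXS hSc.isClosed (tsupport_deriv_subset h)
            have : s * p.1 = t := by rw [← hte]; simp only; rw [← mul_assoc, hs, one_mul]
            exact absurd ((Real.exp_pos _).trans_le ht.1) (by rw [← this]; exact hneg.not_gt)
          rw [e1, e2]
          linarith
        · have h2 := sq_logCutoff_le (n := n) hk hC hpos
          have e1 : (s * p.1) ^ 2 = p.1 ^ 2 := by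
            rw [mul_pow, pow_two s, hs, one_mul]
          have e2 : deriv X p.1 ^ 2 = deriv (logCutoff k n) (s * p.1) ^ 2 := by
            rw [hXd, mul_pow, pow_two s, hs, one_mul]
          have e3 : -(2 * k * (s * p.1)⁻¹) ≤ pderiv 0 Φ p * p.1⁻¹ := by
            have h3 : p.1⁻¹ = s * (s * p.1)⁻¹ := by
              field_simp
            have h4 : |pderiv 0 Φ p * p.1⁻¹| ≤ 2 * k * (s * p.1)⁻¹ := by
              have hsa : |s| = 1 := by
                rcases mul_self_eq_one_iff.1 hs with h | h <;> simp [h]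
              rw [h3, abs_mul, abs_mul, hsa, one_mul, abs_of_pos (inv_pos.2 hpos)]
              exact mul_le_mul_of_nonneg_right (hΦk p) (inv_pos.2 hpos).le
            exact (abs_le.1 h4).1
          rw [e2]
          rw [e1] at h2
          have h5 := mul_le_mul_of_nonneg_right e3 (sq_nonneg (X p.1))
          simp only [hX] at h5 ⊢
          nlinarith
      have h2 := mul_le_mul_of_nonneg_left h1 hw
      linarith
    have hmono' := hmono.trans key
    rw [integral_sub i3 (hu.const_mul _), integral_const_mul] at hmono'
    linarith
  -- letting `n → ∞` for fixed `m`
  have hm : ∀ m : ℕ, ∀ᵐ p : Cyl T, 0 < s * p.1 ∧ |Real.log (s * p.1)| ≤ m → u p = 0 := by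
    intro m
    set Sm : Set (Cyl T) := {p | 0 < s * p.1 ∧ |Real.log (s * p.1)| ≤ m} with hSm
    have hSmI : Sm ⊆ {p | p.1 ∈ I} := fun p hp => hsI _ hp.1
    have hSmm : MeasurableSet Sm := by
      have h1 : Measurable fun p : Cyl T => s * p.1 := measurable_fst.const_mul s
      exact (measurableSet_lt measurable_const h1).inter
        (measurableSet_le (Real.measurable_log.comp h1).abs measurable_const)
    set F : Cyl T → ℝ := fun p => u p ^ 2 * ρ p * (s * p.1 * Real.exp (-(k * (s * p.1)))) ^ 2
      with hF
    have hle : ∀ n : ℕ, 0 < n → m ≤ n → IntegrableOn F Sm ∧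
        ∫ p in Sm, F p ≤ ((C / n) ^ 2 + 2 * (C / n)) * N := by
      intro n hn0 hmn
      obtain ⟨i1, h1⟩ := hn n hn0
      have heq : EqOn (fun p => u p ^ 2 * ρ p * logCutoff k n (s * p.1) ^ 2) F Sm := by
        intro p hp
        simp only [hF]
        rw [logCutoff_of_abs_log_le hp.1 hn0 (hp.2.trans (Nat.cast_le.2 hmn))]
      refine ⟨(i1.mono_set hSmI).congr_fun heq hSmm, ?_⟩
      rw [← setIntegral_congr_fun hSmm heq]
      exact (setIntegral_mono_set i1 (Eventually.of_forall fun p =>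
        mul_nonneg (mul_nonneg (sq_nonneg _) (hρ0 p)) (sq_nonneg _))
        hSmI.eventuallyLE).trans h1
    have hF0 : ∀ p, 0 ≤ F p := fun p => mul_nonneg (mul_nonneg (sq_nonneg _) (hρ0 p)) (sq_nonneg _)
    have hlim : Tendsto (fun n : ℕ => ((C / n) ^ 2 + 2 * (C / n)) * N) atTop (𝓝 0) := by
      have h1 : Tendsto (fun n : ℕ => C / (n : ℝ)) atTop (𝓝 0) :=
        tendsto_const_div_atTop_nhds_zero_nat C
      simpa using ((h1.pow 2).add (h1.const_mul 2)).mul_const N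
    have hzero : ∫ p in Sm, F p = 0 := by
      refine le_antisymm (ge_of_tendsto hlim ?_) (integral_nonneg hF0)
      filter_upwards [eventually_ge_atTop (m + 1)] with n hn1
      exact (hle n (by omega) (by omega)).2
    have hi : IntegrableOn F Sm := (hle (m + 1) (by omega) (by omega)).1
    have hae := (setIntegral_eq_zero_iff_of_nonneg_ae (Eventually.of_forall hF0) hi).1 hzero
    rw [EventuallyEq, ae_restrict_iff' hSmm] at hae
    filter_upwards [hae] with p hp hpS
    have h1 := hp hpS
    simp only [hF, Pi.zero_apply] at h1
    have h2 : ρ p ≠ 0 := (areaDensity_grushinMetric_pos Φ (hIOmega (hSmI hpS))).ne'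
    have h3 : s * p.1 * Real.exp (-(k * (s * p.1))) ≠ 0 :=
      mul_ne_zero hpS.1.ne' (Real.exp_ne_zero _)
    have h4 := (mul_eq_zero.1 h1).resolve_right (pow_ne_zero 2 h3)
    exact pow_eq_zero_iff (two_ne_zero) |>.1 ((mul_eq_zero.1 h4).resolve_right h2)
  filter_upwards [ae_all_iff.2 hm] with p hp hpos
  obtain ⟨m, hm'⟩ := exists_nat_ge |Real.log (s * p.1)|
  exact hp m ⟨hpos, hm'⟩

end Uniqueness

/-! ### Integrals against the Riemannian area -/

section AreaMeasure

variable {T : ℝ} [Fact (0 < T)] {g : Cyl T → Matrix (Fin 2) (Fin 2) ℝ} {U : Set (Cyl T)}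
  {E : Type*} [NormedAddCommGroup E] [NormedSpace ℝ E]

theorem aemeasurable_areaDensity (hg : IsRiemannianMetricOn g U) (hU : IsOpen U) :
    AEMeasurable (fun p => ENNReal.ofReal (areaDensity g p))
      ((volume : Measure (Cyl T)).restrict U) :=
  (((smoothOn_areaDensity hg).continuousOn hU).aemeasurable hU.measurableSet).ennreal_ofReal

theorem integral_areaMeasure (hg : IsRiemannianMetricOn g U) (hU : IsOpen U) (f : Cyl T → E) :
    ∫ p, f p ∂areaMeasure g U = ∫ p in U, areaDensity g p • f p := by
  rw [areaMeasure, integral_withDensity_eq_integral_toReal_smul₀ (aemeasurable_areaDensity hg hU)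
    (ae_of_all _ fun _ => ENNReal.ofReal_lt_top)]
  simp only [ENNReal.toReal_ofReal (show ∀ {p}, 0 ≤ areaDensity g p from Real.sqrt_nonneg _)]

theorem integrable_areaMeasure_iff (hg : IsRiemannianMetricOn g U) (hU : IsOpen U)
    {f : Cyl T → E} :
    Integrable f (areaMeasure g U) ↔ IntegrableOn (fun p => areaDensity g p • f p) U := by
  rw [areaMeasure, integrable_withDensity_iff_integrable_smul₀' (aemeasurable_areaDensity hg hU)
    (ae_of_all _ fun _ => ENNReal.ofReal_lt_top)]
  simp only [ENNReal.toReal_ofReal (show ∀ {p}, 0 ≤ areaDensity g p from Real.sqrt_nonneg _),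
    IntegrableOn]

theorem ae_areaMeasure_of_ae (U : Set (Cyl T)) {P : Cyl T → Prop}
    (h : ∀ᵐ p : Cyl T, p ∈ U → P p) (hU : IsOpen U) : ∀ᵐ p ∂areaMeasure g U, P p :=
  (withDensity_absolutelyContinuous _ _).ae_le ((ae_restrict_iff' hU.measurableSet).2 h)

theorem coeFn_testToL2 (hg : IsRiemannianMetricOn g U) (hU : IsOpen U) (f : testFunctions U) :
    testToL2 hg hU f =ᵐ[areaMeasure g U] f.1 :=
  MemLp.coeFn_toLp (memLp_of_mem_testFunctions hg hU f.2)

theorem inner_testToL2 (hg : IsRiemannianMetricOn g U) (hU : IsOpen U)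
    (u : Lp ℂ 2 (areaMeasure g U)) (f : testFunctions U) :
    Integrable (fun p => inner ℂ (u p) (f.1 p)) (areaMeasure g U) ∧
      inner ℂ u (testToL2 hg hU f) = ∫ p, inner ℂ (u p) (f.1 p) ∂areaMeasure g U := by
  have h : (fun p => inner ℂ (u p) (testToL2 hg hU f p)) =ᵐ[areaMeasure g U]
      fun p => inner ℂ (u p) (f.1 p) := by
    filter_upwards [coeFn_testToL2 hg hU f] with p hp
    rw [hp]
  exact ⟨(L2.integrable_inner u (testToL2 hg hU f)).congr h,
    (L2.inner_def u (testToL2 hg hU f)).trans (integral_congr_ae h)⟩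

theorem inner_testToL2_testToL2 (hg : IsRiemannianMetricOn g U) (hU : IsOpen U)
    (h f : testFunctions U) :
    inner ℂ (testToL2 hg hU h) (testToL2 hg hU f) =
      ∫ p in U, areaDensity g p • inner ℂ (h.1 p) (f.1 p) := by
  rw [(inner_testToL2 hg hU _ f).2, ← integral_areaMeasure hg hU]
  refine integral_congr_ae ?_
  filter_upwards [coeFn_testToL2 hg hU h] with p hp
  rw [hp]

/-- Orthogonality to a real test function, for the real and imaginary parts separately. -/
theorem integral_re_im_eq_zero (hg : IsRiemannianMetricOn g U) (hU : IsOpen U)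
    (u : Lp ℂ 2 (areaMeasure g U)) (f : testFunctions U) {r : Cyl T → ℝ}
    (hr : ∀ p ∈ U, f.1 p = (r p : ℂ)) (h : inner ℂ u (testToL2 hg hU f) = 0) :
    ∫ p in U, (u p).re * (areaDensity g p * r p) = 0 ∧
      ∫ p in U, (u p).im * (areaDensity g p * r p) = 0 := by
  obtain ⟨hi, he⟩ := inner_testToL2 hg hU u f
  rw [h] at he
  have h1 := integral_re hi
  have h2 := integral_im hi
  rw [← he, integral_areaMeasure hg hU] at h1 h2
  constructor
  · refine Eq.trans (setIntegral_congr_fun hU.measurableSet fun p hp => ?_) (h1.trans (by simp))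
    simp only [hr p hp, RCLike.inner_apply, smul_eq_mul]
    simp
    ring
  · rw [← neg_eq_zero, ← integral_neg]
    refine Eq.trans (setIntegral_congr_fun hU.measurableSet fun p hp => ?_) (h2.trans (by simp))
    simp only [hr p hp, RCLike.inner_apply, smul_eq_mul]
    simp
    ring

theorem integrableOn_sq_re_im (hg : IsRiemannianMetricOn g U) (hU : IsOpen U)
    (u : Lp ℂ 2 (areaMeasure g U)) :
    IntegrableOn (fun p => (u p).re ^ 2 * areaDensity g p) U ∧
      IntegrableOn (fun p => (u p).im ^ 2 * areaDensity g p) U := by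
  have hm := Lp.memLp u
  have h : ∀ {v : Cyl T → ℝ}, MemLp v 2 (areaMeasure g U) →
      IntegrableOn (fun p => v p ^ 2 * areaDensity g p) U := fun {v} hv =>
    ((integrable_areaMeasure_iff hg hU).1 hv.integrable_sq).congr
      (Eventually.of_forall fun p => by simp only [smul_eq_mul]; ring)
  exact ⟨h hm.re, h hm.im⟩

theorem measurable_re_im (u : Lp ℂ 2 (areaMeasure g U)) :
    Measurable (fun p => (u p).re) ∧ Measurable fun p => (u p).im := by
  have h : Measurable u := (Lp.stronglyMeasurable u).measurable
  exact ⟨Complex.measurable_re.comp h, Complex.measurable_im.comp h⟩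

/-- A class whose real and imaginary parts vanish almost everywhere on `U` is zero. -/
theorem Lp_eq_zero_of_re_im (hU : IsOpen U) (u : Lp ℂ 2 (areaMeasure g U))
    (hre : ∀ᵐ p : Cyl T, p ∈ U → (u p).re = 0) (him : ∀ᵐ p : Cyl T, p ∈ U → (u p).im = 0) :
    u = 0 := by
  refine (Lp.eq_zero_iff_ae_eq_zero).2 (ae_areaMeasure_of_ae U ?_ hU)
  filter_upwards [hre, him] with p h1 h2 hp
  exact Complex.ext (h1 hp) (h2 hp)

end AreaMeasure

/-! ### Real test functions -/

section RealTest

variable {T : ℝ} {U : Set (Cyl T)}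

theorem ofReal_mem_testFunctions {φ : Cyl T → ℝ} (hφ : SmoothOn φ univ) (hc : HasCompactSupport φ)
    (hφU : tsupport φ ⊆ U) : (fun p => (φ p : ℂ)) ∈ testFunctions U := by
  refine ⟨Complex.ofRealCLM.contDiff.comp_contDiffOn hφ, hc.comp_left Complex.ofReal_zero,
    (closure_mono (Function.support_comp_subset Complex.ofReal_zero φ)).trans hφU⟩

theorem pderiv_ofReal {f : Cyl T → ℝ} (hf : SmoothOn f U) (hU : IsOpen U) (i : Fin 2) {p : Cyl T}
    (hp : p ∈ U) : pderiv i (fun p => (f p : ℂ)) p = ((pderiv i f p : ℝ) : ℂ) :=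
  (hf.hasDerivAt hU i hp).ofReal_comp.deriv

theorem laplaceBeltrami_grushinMetric_ofReal {Φ φ : Cyl T → ℝ} (hΦ : SmoothOn Φ univ)
    (hφ : SmoothOn φ univ) {p : Cyl T} (hp : p.1 ≠ 0) :
    laplaceBeltrami (grushinMetric Φ) (fun p => (φ p : ℂ)) p =
      (((areaDensity (grushinMetric Φ) p)⁻¹ *
        ∑ i, pderiv i (fun p => coeff Φ i p * pderiv i φ p) p : ℝ) : ℂ) := by
  have h : ∀ i, pderiv i (fun q => coeff Φ i q • pderiv i (fun p => (φ p : ℂ)) q) p =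
      ((pderiv i (fun p => coeff Φ i p * pderiv i φ p) p : ℝ) : ℂ) := by
    intro i
    have h1 : (fun q => coeff Φ i q • pderiv i (fun p => (φ p : ℂ)) q) =
        fun q => ((coeff Φ i q * pderiv i φ q : ℝ) : ℂ) := by
      funext q
      rw [pderiv_ofReal hφ isOpen_univ i (mem_univ q), Complex.real_smul, Complex.ofReal_mul]
    rw [h1]
    exact pderiv_ofReal ((smoothOn_coeff hΦ i).mul
      ((hφ.pderiv isOpen_univ i).mono (subset_univ _))) (isOpen_Omega T) i hp
  rw [laplaceBeltrami_grushinMetric, Complex.real_smul, Complex.ofReal_mul, Complex.ofReal_sum]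
  simp only [h]

end RealTest

/-! ### Symmetry -/

section Symmetry

variable {T : ℝ} [Fact (0 < T)] {Φ : Cyl T → ℝ} {U : Set (Cyl T)}

/-- **Green's formula** `⟪h, Δ f⟫ = -∑ ∫ ω g^{ii} ⟪∂_i h, ∂_i f⟫`. -/
theorem inner_laplaceBeltrami (hΦ : SmoothOn Φ univ) (hU : IsOpen U) (hUO : U ⊆ Omega T)
    (hg : IsRiemannianMetricOn (grushinMetric Φ) U) (h f : testFunctions U) :
    inner ℂ (testToL2 hg hU h) (testToL2 hg hU (laplaceBeltramiTest hg hU f)) =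
      -∑ i, ∫ p, coeff Φ i p • inner ℂ (pderiv i h.1 p) (pderiv i f.1 p) := by
  obtain ⟨h, hh, hhc, hhU⟩ := h
  obtain ⟨f, hf, hfc, hfU⟩ := f
  have hO := isOpen_Omega T
  have hflux : ∀ i, SmoothOn (fun p => coeff Φ i p • pderiv i f p) univ := fun i =>
    ((smoothOn_coeff hΦ i).smul
      ((hf.pderiv isOpen_univ i).mono (subset_univ _))).of_tsupport_subset hO
      ((closure_mono (Function.support_smul_subset_right _ _)).trans
        ((tsupport_pderiv_subset i f).trans (hfU.trans hUO)))
  have hF : ∀ i, SmoothOn (fun p => inner ℂ (h p) (coeff Φ i p • pderiv i f p)) univ := fun i =>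
    ContDiffOn.inner ℂ hh (hflux i)
  have hFc : ∀ i, HasCompactSupport (fun p => inner ℂ (h p) (coeff Φ i p • pderiv i f p)) :=
    fun i => hhc.mono fun p hp h0 => hp (by simp only [h0, inner_zero_left])
  have hFd : ∀ i p, pderiv i (fun p => inner ℂ (h p) (coeff Φ i p • pderiv i f p)) p =
      inner ℂ (h p) (pderiv i (fun p => coeff Φ i p • pderiv i f p) p) +
        coeff Φ i p • inner ℂ (pderiv i h p) (pderiv i f p) := by
    intro i p
    refine ((hh.hasDerivAt isOpen_univ i (mem_univ p)).inner ℂ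
      ((hflux i).hasDerivAt isOpen_univ i (mem_univ p))).deriv.trans ?_
    simp only [zero_smul, cover_zero, add_zero, inner_smul_right_eq_smul]
  have i1 : ∀ i, Integrable (pderiv i fun p => inner ℂ (h p) (coeff Φ i p • pderiv i f p)) :=
    fun i => ((hF i).pderiv isOpen_univ i).continuous.integrable_of_hasCompactSupport
      (hasCompactSupport_pderiv (hFc i) i)
  have i2 : ∀ i, Integrable fun p =>
      inner ℂ (h p) (pderiv i (fun p => coeff Φ i p • pderiv i f p) p) := fun i =>
    (hh.continuous.inner ((hflux i).pderiv isOpen_univ i).continuous).integrable_of_hasCompactSupport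
      (hhc.mono fun p hp h0 => hp (by simp only [h0, inner_zero_left]))
  have i3 : ∀ i, Integrable fun p => coeff Φ i p • inner ℂ (pderiv i h p) (pderiv i f p) :=
    fun i => ((i1 i).sub (i2 i)).congr (Eventually.of_forall fun p => by
      rw [Pi.sub_apply, hFd]; ring)
  have key : ∀ i, ∫ p, inner ℂ (h p) (pderiv i (fun p => coeff Φ i p • pderiv i f p) p) =
      -∫ p, coeff Φ i p • inner ℂ (pderiv i h p) (pderiv i f p) := by
    intro i
    have h0 := integral_pderiv_eq_zero (hF i) (hFc i) i
    simp only [hFd] at h0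
    rw [integral_add (i2 i) (i3 i)] at h0
    exact eq_neg_of_add_eq_zero_left h0
  rw [inner_testToL2_testToL2, ← Finset.sum_neg_distrib]
  simp only [← key]
  rw [← integral_finsetSum _ fun i _ => i2 i]
  refine Eq.trans ?_ (setIntegral_eq_integral_of_forall_compl_eq_zero (s := U) fun p hp => ?_)
  · refine setIntegral_congr_fun hU.measurableSet fun p hp => ?_
    have hpos := areaDensity_grushinMetric_pos Φ (hUO hp)
    simp only [laplaceBeltramiTest, LinearMap.coe_mk, AddHom.coe_mk, laplaceBeltrami_grushinMetric,
      inner_smul_right_eq_smul, inner_sum]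
    rw [smul_smul, mul_inv_cancel₀ hpos.ne', one_smul]
  · have : h p = 0 := image_eq_zero_of_notMem_tsupport fun h' => hp (hhU h')
    simp [this]

theorem isFormalAdjoint_laplaceBeltramiOperator (hΦ : SmoothOn Φ univ) (hU : IsOpen U)
    (hUO : U ⊆ Omega T) (hg : IsRiemannianMetricOn (grushinMetric Φ) U) :
    (laplaceBeltramiOperator (grushinMetric Φ) U hg hU).IsFormalAdjoint
      (laplaceBeltramiOperator (grushinMetric Φ) U hg hU) := by
  rintro ⟨_, h, rfl⟩ ⟨_, f, rfl⟩
  simp only [laplaceBeltramiOperator_apply]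
  rw [← inner_conj_symm, inner_laplaceBeltrami hΦ hU hUO, inner_laplaceBeltrami hΦ hU hUO]
  simp only [map_neg, map_sum, ← integral_conj, Complex.real_smul, map_mul, Complex.conj_ofReal,
    inner_conj_symm]

theorem inner_laplaceBeltramiOperator_self_nonpos (hΦ : SmoothOn Φ univ) (hU : IsOpen U)
    (hUO : U ⊆ Omega T) (hg : IsRiemannianMetricOn (grushinMetric Φ) U)
    (x : (laplaceBeltramiOperator (grushinMetric Φ) U hg hU).domain) :
    (inner ℂ (laplaceBeltramiOperator (grushinMetric Φ) U hg hU x)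
      (x : Lp ℂ 2 (areaMeasure (grushinMetric Φ) U))).re ≤ 0 := by
  obtain ⟨_, f, rfl⟩ := x
  simp only [laplaceBeltramiOperator_apply]
  rw [← inner_conj_symm, Complex.conj_re, inner_laplaceBeltrami hΦ hU hUO, Complex.neg_re,
    Complex.re_sum, neg_nonpos]
  refine Finset.sum_nonneg fun i _ => ?_
  have h : ∀ p, coeff Φ i p • inner ℂ (pderiv i f.1 p) (pderiv i f.1 p) =
      ((coeff Φ i p * ‖pderiv i f.1 p‖ ^ 2 : ℝ) : ℂ) := by
    intro p
    rw [inner_self_eq_norm_sq_to_K, Complex.real_smul]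
    simp
  have e : ∫ p, ((coeff Φ i p * ‖pderiv i f.1 p‖ ^ 2 : ℝ) : ℂ) =
      ((∫ p, coeff Φ i p * ‖pderiv i f.1 p‖ ^ 2 : ℝ) : ℂ) := integral_ofReal
  simp only [h]
  rw [e, Complex.ofReal_re]
  refine integral_nonneg fun p => ?_
  by_cases hp : p.1 = 0
  · have : f.1 =ᶠ[𝓝 p] 0 := notMem_tsupport_iff_eventuallyEq.1 fun h => hUO (f.2.2.2 h) hp
    rw [pderiv_congr this]
    simp [pderiv]
  · exact mul_nonneg (coeff_pos Φ i hp).le (sq_nonneg _)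

end Symmetry

/-! ### Density of the test functions -/

section Density

variable {T : ℝ} [Fact (0 < T)] {Φ : Cyl T → ℝ}

/-- A locally square integrable function which is orthogonal to all real test functions vanishes:
test with `ζ J(ζ ω u)`, where `J` is a mollification. -/
theorem ae_eq_zero_of_integral_mul_test_eq_zero (hΦ : SmoothOn Φ univ) {I : Set ℝ}
    (hI : IsOpen I) (h0 : (0 : ℝ) ∉ I) {u : Cyl T → ℝ} (hum : Measurable u)
    (hu : IntegrableOn (fun p => u p ^ 2 * areaDensity (grushinMetric Φ) p) {p | p.1 ∈ I})
    (horth : ∀ φ : Cyl T → ℝ, SmoothOn φ univ → HasCompactSupport φ →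
      tsupport φ ⊆ {p | p.1 ∈ I} →
        ∫ p in {p | p.1 ∈ I}, u p * (areaDensity (grushinMetric Φ) p * φ p) = 0) :
    ∀ᵐ p : Cyl T, p.1 ∈ I → u p = 0 := by
  set ρ := areaDensity (grushinMetric Φ) with hρ
  have hρs : SmoothOn ρ (Omega T) := smoothOn_areaDensity (grushinMetric_isRiemannianMetricOn hΦ)
  have hIm : MeasurableSet {p : Cyl T | p.1 ∈ I} := (hI.preimage continuous_fst).measurableSet
  have hIOmega : {p : Cyl T | p.1 ∈ I} ⊆ Omega T := fun p hp h => h0 (by rw [← h]; exact hp)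
  have hloc : ∀ S : Set ℝ, IsCompact S → S ⊆ I → ∀ᵐ p : Cyl T, p.1 ∈ S → u p = 0 := by
    intro S hS hSI
    obtain ⟨K, ζ, hK, hSK, hKI, hζ, hζc, hζI, hζ1, hζ0⟩ := exists_cutoff hS hI hSI
    have hζs : tsupport (fun p : Cyl T => ζ p.1) ⊆ {p | p.1 ∈ I} :=
      (tsupport_comp_fst_subset ζ).trans fun p hp => hζI hp
    set v : Cyl T → ℝ := {p : Cyl T | p.1 ∈ tsupport ζ}.indicator u with hv
    have hvL : IsCompactL2 v := isCompactL2_indicator hΦ h0 hζc.isCompact hζI hum hu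
    have hb : SmoothOn (fun p => ζ p.1 * ρ p) univ :=
      hρs.mul_of_tsupport_subset (isOpen_Omega T) (smoothOn_comp_fst hζ _) (hζs.trans hIOmega)
    set w : Cyl T → ℝ := fun p => v p * (ζ p.1 * ρ p) with hw
    have hwL : IsCompactL2 w := hvL.mul_continuous hb.continuous
    obtain ⟨M, -, hmol⟩ := exists_isMollifier
    have hle : ∀ D : ℝ, 0 < D → ∫ p, w p ^ 2 ≤ D := by
      intro D hD
      obtain ⟨ε, hε, hεD⟩ := hwL.exists_translate_le hD
      obtain ⟨κ, hκ⟩ := hmol ε hε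
      have hJL := hwL.mollify hκ.smooth hκ.compact
      have hJs := smoothOn_mollify hκ.smooth hκ.compact hwL.integrable
      have h1 := hκ.integral_sq_mollify_sub_le hwL hεD
      have h2 := horth (fun p => ζ p.1 * mollify κ w p) ((smoothOn_comp_fst hζ _).mul hJs)
        (hasCompactSupport_comp_fst hζc).mul_right (tsupport_mul_subset_left.trans hζs)
      have h3 : ∫ p, w p * mollify κ w p = 0 := by
        rw [← h2, ← integral_indicator hIm]
        refine integral_congr_ae (Eventually.of_forall fun p => ?_)
        by_cases hp : p.1 ∈ tsupport ζ
        · rw [indicator_of_mem (show p ∈ {p : Cyl T | p.1 ∈ I} from hζI hp)]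
          simp only [hw, hv, indicator_of_mem (show p ∈ {p : Cyl T | p.1 ∈ tsupport ζ} from hp)]
          ring
        · have e : ζ p.1 = 0 := image_eq_zero_of_notMem_tsupport hp
          by_cases hpI : p ∈ {p : Cyl T | p.1 ∈ I}
          · simp [indicator_of_mem hpI, hw, e]
          · simp [indicator_of_notMem hpI, hw, e]
      have h4 : ∫ p, (mollify κ w p - w p) ^ 2 =
          (∫ p, mollify κ w p ^ 2) + (∫ p, w p ^ 2) - 2 * ∫ p, w p * mollify κ w p := by
        have i1 : Integrable fun p => mollify κ w p ^ 2 + w p ^ 2 := hJL.sq.add hwL.sq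
        rw [← integral_add hJL.sq hwL.sq, ← integral_const_mul,
          ← integral_sub i1 ((hwL.integrable_mul hJL).const_mul 2)]
        refine integral_congr_ae (Eventually.of_forall fun p => ?_)
        simp only
        ring
      have h5 : 0 ≤ ∫ p, mollify κ w p ^ 2 := integral_nonneg fun p => sq_nonneg _
      linarith
    have hzero : ∫ p, w p ^ 2 = 0 :=
      le_antisymm (le_of_forall_pos_le_add fun D hD => by simpa using hle D hD)
        (integral_nonneg fun p => sq_nonneg _)
    have hae := (integral_eq_zero_iff_of_nonneg (fun p => sq_nonneg (w p)) hwL.sq).1 hzero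
    filter_upwards [hae] with p hp hpS
    have hpK : p.1 ∈ K := interior_subset (hSK hpS)
    have hpζ : p.1 ∈ tsupport ζ := subset_tsupport ζ (by simp [hζ1 _ hpK])
    have h1 : w p = 0 := pow_eq_zero_iff (two_ne_zero) |>.1 hp
    simp only [hw, hv, indicator_of_mem (show p ∈ {p : Cyl T | p.1 ∈ tsupport ζ} from hpζ),
      hζ1 _ hpK, one_mul] at h1
    exact (mul_eq_zero.1 h1).resolve_right (areaDensity_grushinMetric_pos Φ (hIOmega (hKI hpK))).ne'
  rw [ae_iff]
  refine measure_null_of_locally_null _ fun p hp => ?_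
  obtain ⟨hpI, -⟩ := Classical.not_imp.1 hp
  obtain ⟨S, hS, hpS, hSI⟩ := exists_compact_subset hI hpI
  refine ⟨{q | ¬(q.1 ∈ S → u q = 0)}, ?_, ae_iff.1 (hloc S hS hSI)⟩
  filter_upwards [self_mem_nhdsWithin, mem_nhdsWithin_of_mem_nhds
    ((isOpen_interior.preimage continuous_fst).mem_nhds hpS)] with q hq hqS hq'
  exact hq fun _ => hq' (interior_subset hqS)

theorem dense_domain_laplaceBeltramiOperator (hΦ : SmoothOn Φ univ) {I : Set ℝ} (hI : IsOpen I)
    (h0 : (0 : ℝ) ∉ I) {U : Set (Cyl T)} (hUI : U = {p | p.1 ∈ I}) (hU : IsOpen U)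
    (hg : IsRiemannianMetricOn (grushinMetric Φ) U) :
    Dense ((laplaceBeltramiOperator (grushinMetric Φ) U hg hU).domain :
      Set (Lp ℂ 2 (areaMeasure (grushinMetric Φ) U))) := by
  rw [Submodule.dense_iff_topologicalClosure_eq_top, Submodule.topologicalClosure_eq_top_iff,
    Submodule.eq_bot_iff]
  intro u hu
  have key : ∀ φ : Cyl T → ℝ, SmoothOn φ univ → HasCompactSupport φ → tsupport φ ⊆ U →
      ∫ p in U, (u p).re * (areaDensity (grushinMetric Φ) p * φ p) = 0 ∧
        ∫ p in U, (u p).im * (areaDensity (grushinMetric Φ) p * φ p) = 0 := by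
    intro φ hφ hφc hφU
    exact integral_re_im_eq_zero hg hU u ⟨_, ofReal_mem_testFunctions hφ hφc hφU⟩
      (fun p _ => rfl) ((Submodule.mem_orthogonal' _ _).1 hu _ (LinearMap.mem_range_self _ _))
  have hm := measurable_re_im u
  have hi := integrableOn_sq_re_im hg hU u
  subst hUI
  exact Lp_eq_zero_of_re_im hU u
    (ae_eq_zero_of_integral_mul_test_eq_zero hΦ hI h0 hm.1 hi.1 fun φ h1 h2 h3 => (key φ h1 h2 h3).1)
    (ae_eq_zero_of_integral_mul_test_eq_zero hΦ hI h0 hm.2 hi.2 fun φ h1 h2 h3 => (key φ h1 h2 h3).2)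

end Density

/-! ### Essential self-adjointness -/

section Main

variable {T : ℝ} {Φ : Cyl T → ℝ}

theorem exists_abs_pderiv_le [Fact (0 < T)] (hΦ : SmoothOn Φ univ)
    (hconst : ∃ R c₁ c₂ : ℝ, ∀ p : Cyl T, (R < p.1 → Φ p = c₁) ∧ (p.1 < -R → Φ p = c₂)) :
    ∃ k : ℝ, 0 ≤ k ∧ ∀ p, |pderiv 0 Φ p| ≤ 2 * k := by
  obtain ⟨R, c₁, c₂, h⟩ := hconst
  have hc : ∀ (c : ℝ) (p : Cyl T), Φ =ᶠ[𝓝 p] (fun _ => c) → pderiv 0 Φ p = 0 := by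
    intro c p hp
    rw [pderiv_congr hp]
    simp [pderiv]
  obtain ⟨C, hC⟩ := (isCompact_strip (T := T)
    (isCompact_Icc (a := -|R|) (b := |R|))).exists_bound_of_continuousOn
    (hΦ.pderiv isOpen_univ 0).continuous.continuousOn
  have hC0 : 0 ≤ C := (norm_nonneg _).trans
    (hC (0, 0) ⟨neg_nonpos.2 (abs_nonneg R), abs_nonneg R⟩)
  refine ⟨C / 2, by positivity, fun p => ?_⟩
  rw [mul_div_cancel₀ C two_ne_zero]
  by_cases h1 : |R| < p.1
  · rw [hc c₁, abs_zero]
    · exact hC0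
    · filter_upwards [(isOpen_lt continuous_const continuous_fst).mem_nhds
        (lt_of_le_of_lt (le_abs_self R) h1)] with q hq
      exact (h q).1 hq
  by_cases h2 : p.1 < -|R|
  · rw [hc c₂, abs_zero]
    · exact hC0
    · filter_upwards [(isOpen_lt continuous_fst continuous_const).mem_nhds
        (lt_of_lt_of_le h2 (neg_le_neg (le_abs_self R)))] with q hq
      exact (h q).2 hq
  exact hC p ⟨not_lt.1 h2, not_lt.1 h1⟩

/-- The three domains `Ω`, `Ω₊`, `Ω₋` are treated at once: `U` is the part of the cylinder over a
union `I` of open half-lines starting at `0`. -/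
theorem isEssentiallySelfAdjoint_laplaceBeltramiOperator [Fact (0 < T)] (hΦ : SmoothOn Φ univ)
    (hconst : ∃ R c₁ c₂ : ℝ, ∀ p : Cyl T, (R < p.1 → Φ p = c₁) ∧ (p.1 < -R → Φ p = c₂))
    {I : Set ℝ} (hI : IsOpen I) (h0 : (0 : ℝ) ∉ I) (hcone : ∀ t ∈ I, ∀ r, 0 < t * r → r ∈ I)
    {U : Set (Cyl T)} (hUI : U = {p | p.1 ∈ I}) (hU : IsOpen U)
    (hg : IsRiemannianMetricOn (grushinMetric Φ) U) :
    IsEssentiallySelfAdjoint (laplaceBeltramiOperator (grushinMetric Φ) U hg hU) := by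
  have hUO : U ⊆ Omega T := by
    rw [hUI]
    exact fun p hp h => h0 (by rw [← h]; exact hp)
  obtain ⟨k, hk, hΦk⟩ := exists_abs_pderiv_le hΦ hconst
  have hc : 0 < k ^ 2 + 1 := by positivity
  refine isEssentiallySelfAdjoint_of_nonpos
    (dense_domain_laplaceBeltramiOperator hΦ hI h0 hUI hU hg)
    (isFormalAdjoint_laplaceBeltramiOperator hΦ hU hUO hg)
    (inner_laplaceBeltramiOperator_self_nonpos hΦ hU hUO hg) hc fun u hu => ?_
  set ρ := areaDensity (grushinMetric Φ) with hρ
  have key : ∀ φ : Cyl T → ℝ, SmoothOn φ univ → HasCompactSupport φ → tsupport φ ⊆ U →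
      ∫ p in U, (u p).re * ((∑ i, pderiv i (fun p => coeff Φ i p * pderiv i φ p) p) -
        (k ^ 2 + 1) * ρ p * φ p) = 0 ∧
      ∫ p in U, (u p).im * ((∑ i, pderiv i (fun p => coeff Φ i p * pderiv i φ p) p) -
        (k ^ 2 + 1) * ρ p * φ p) = 0 := by
    intro φ hφ hφc hφU
    set f : testFunctions U := ⟨_, ofReal_mem_testFunctions hφ hφc hφU⟩ with hf
    have h1 := hu ⟨testToL2 hg hU f, LinearMap.mem_range_self _ f⟩
    rw [laplaceBeltramiOperator_apply, ← map_smul, ← map_sub] at h1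
    have h2 := integral_re_im_eq_zero hg hU u _ (r := fun p => (ρ p)⁻¹ *
      (∑ i, pderiv i (fun p => coeff Φ i p * pderiv i φ p) p) - (k ^ 2 + 1) * φ p)
      (fun p hp => ?_) h1
    · have h3 : ∀ p ∈ U, ρ p * ((ρ p)⁻¹ *
          (∑ i, pderiv i (fun p => coeff Φ i p * pderiv i φ p) p) - (k ^ 2 + 1) * φ p) =
          (∑ i, pderiv i (fun p => coeff Φ i p * pderiv i φ p) p) - (k ^ 2 + 1) * ρ p * φ p := by
        intro p hp
        have := (areaDensity_grushinMetric_pos Φ (hUO hp)).ne'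
        rw [mul_sub, ← mul_assoc, mul_inv_cancel₀ this]
        ring
      refine ⟨(setIntegral_congr_fun hU.measurableSet fun p hp => ?_).trans h2.1,
        (setIntegral_congr_fun hU.measurableSet fun p hp => ?_).trans h2.2⟩
      · simp only [← hρ, h3 p hp]
      · simp only [← hρ, h3 p hp]
    · simp only [hf, laplaceBeltramiTest, LinearMap.coe_mk, AddHom.coe_mk, Submodule.coe_sub,
        Submodule.coe_smul, Pi.sub_apply, Pi.smul_apply,
        laplaceBeltrami_grushinMetric_ofReal hΦ hφ (hUO hp), smul_eq_mul]
      push_cast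
      rfl
  have hm := measurable_re_im u
  have hi := integrableOn_sq_re_im hg hU u
  -- each of the two half-cylinders is contained in `U` or disjoint from it
  have hhalf : ∀ {v : Cyl T → ℝ}, Measurable v → IntegrableOn (fun p => v p ^ 2 * ρ p) U →
      (∀ φ : Cyl T → ℝ, SmoothOn φ univ → HasCompactSupport φ → tsupport φ ⊆ U →
        ∫ p in U, v p * ((∑ i, pderiv i (fun p => coeff Φ i p * pderiv i φ p) p) -
          (k ^ 2 + 1) * ρ p * φ p) = 0) → ∀ᵐ p : Cyl T, p ∈ U → v p = 0 := by
    intro v hvm hvi hv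
    rw [hUI] at hvi hv
    have h : ∀ s : ℝ, s * s = 1 → ∀ᵐ p : Cyl T, p ∈ U → 0 < s * p.1 → v p = 0 := by
      intro s hs
      by_cases hsI : s ∈ I
      · filter_upwards [ae_eq_zero_of_weak_solution hΦ hk hΦk hI h0 hs (hcone s hsI) hvm hvi hv]
          with p hp _ using hp
      · refine Eventually.of_forall fun p hp hsp => absurd (hcone p.1 ?_ s ?_) hsI
        · rw [hUI] at hp; exact hp
        · rwa [mul_comm]
    filter_upwards [h 1 (by norm_num), h (-1) (by norm_num)] with p h1 h2 hp
    rcases lt_or_gt_of_ne (hUO hp) with hneg | hpos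
    · exact h2 hp (by linarith)
    · exact h1 hp (by linarith)
  exact Lp_eq_zero_of_re_im hU u (hhalf hm.1 hi.1 fun φ h1 h2 h3 => (key φ h1 h2 h3).1)
    (hhalf hm.2 hi.2 fun φ h1 h2 h3 => (key φ h1 h2 h3).2)

end Main

end GrushinCylinder

end

theorem mainTheorem2 (T : ℝ) [Fact (0 < T)] (Φ : GrushinCylinder.Cyl T → ℝ)
    (hΦ : GrushinCylinder.SmoothOn Φ Set.univ)
    (hconst : ∃ R c₁ c₂ : ℝ, ∀ p : GrushinCylinder.Cyl T,
      (R < p.1 → Φ p = c₁) ∧ (p.1 < -R → Φ p = c₂)) :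
    GrushinCylinder.IsEssentiallySelfAdjoint
        (GrushinCylinder.laplaceBeltramiOperator
          (GrushinCylinder.grushinMetric Φ) (GrushinCylinder.Omega T)
          (GrushinCylinder.grushinMetric_isRiemannianMetricOn hΦ)
          (GrushinCylinder.isOpen_Omega T)) ∧
      GrushinCylinder.IsEssentiallySelfAdjoint
        (GrushinCylinder.laplaceBeltramiOperator
          (GrushinCylinder.grushinMetric Φ) (GrushinCylinder.OmegaPlus T)
          ((GrushinCylinder.grushinMetric_isRiemannianMetricOn hΦ).mono
            (GrushinCylinder.OmegaPlus_subset T))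
          (GrushinCylinder.isOpen_OmegaPlus T)) ∧
      GrushinCylinder.IsEssentiallySelfAdjoint
        (GrushinCylinder.laplaceBeltramiOperator
          (GrushinCylinder.grushinMetric Φ) (GrushinCylinder.OmegaMinus T)
          ((GrushinCylinder.grushinMetric_isRiemannianMetricOn hΦ).mono
            (GrushinCylinder.OmegaMinus_subset T))
          (GrushinCylinder.isOpen_OmegaMinus T)) := by
  refine ⟨?_, ?_, ?_⟩
  · exact GrushinCylinder.isEssentiallySelfAdjoint_laplaceBeltramiOperator hΦ hconst
      (I := {0}ᶜ) isOpen_compl_singleton (by simp)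
      (fun t _ r h hr => by rw [mem_singleton_iff.1 hr, mul_zero] at h; exact lt_irrefl _ h) rfl _ _
  · exact GrushinCylinder.isEssentiallySelfAdjoint_laplaceBeltramiOperator hΦ hconst
      (I := Set.Ioi 0) isOpen_Ioi (lt_irrefl (0 : ℝ))
      (fun t ht r h => (pos_iff_pos_of_mul_pos h).1 ht) rfl _ _
  · exact GrushinCylinder.isEssentiallySelfAdjoint_laplaceBeltramiOperator hΦ hconst
      (I := Set.Iio 0) isOpen_Iio (lt_irrefl (0 : ℝ))
      (fun t ht r h => (neg_iff_neg_of_mul_pos h).1 ht) rfl _ _
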